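/- Let $\Bbbk$ be an integral domain in which $2$ is invertible. In a strict monoidal $\Bbbk$-linear supercategory, morphism spaces are $\mathbb Z_2$-graded, composition and $\otimes$ are bilinear and even, and $(f'\otimes g')\circ(f\otimes g)=(-1)^{|g'||f|}(f'\circ f)\otimes(g'\circ g)$. **The category.** $\mathfrak p\text{-}\mathbf{Web}_{\uparrow\downarrow}$ is the strict monoidal $\Bbbk$-linear supercategory whose objects are the words in $\uparrow_a,\downarrow_a$ ($a\in\mathbb Z_{\ge1}$), with concatenation as product and the empty word $\mathbf 1$ as unit, given by the following generators and relations. Strands labelled $0$ are deleted ($\uparrow_0=\downarrow_0=\mathbf 1$, and split, merge, crossing, cap, cup with a label $0$ are identities); diagrams with a negatively labelled strand are zero. Products of morphisms are written from left to right, $f;g=g\circ f$; an omitted tensor factor is an identity. *Generating morphisms* ($a,b\ge0$): splits $\mathsf s_{a,b}:\uparrow_{a+b}\to\uparrow_a\uparrow_b$, merges $\mathsf m_{a,b}:\uparrow_a\uparrow_b\to\uparrow_{a+b}$, leftward caps $\mathrm{cap}_a:\downarrow_a\uparrow_a\to\mathbf 1$, leftward cups $\mathrm{cup}_a:\mathbf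 1\to\uparrow_a\downarrow_a$, rightward crossings $R_{a,b}:\uparrow_a\downarrow_b\to\downarrow_b\uparrow_a$ (all even), and the odd tag-in $\tau:\uparrow_1\to\downarrow_1$ and tag-out $\bar\tau:\downarrow_1\to\uparrow_1$. *Derived morphisms.* $\cap=(\tau\otimes1);\mathrm{cap}_1:\uparrow_1\uparrow_1\to\mathbf 1$; $\cup=\mathrm{cup}_1;(1\otimes\bar\tau):\mathbf 1\to\uparrow_1\uparrow_1$; antenna $\alpha=\tfrac12\,\mathsf s_{1,1};\cap:\uparrow_2\to\mathbf 1$. On $\uparrow_a\uparrow_b$ put $E^{(s)}=(\mathsf s_{a-s,s}\otimes1);(1\otimes\mathsf m_{s,b}):\uparrow_a\uparrow_b\to\uparrow_{a-s}\uparrow_{b+s}$, $F^{(r)}=(1\otimes\mathsf s_{r,b-r});(\mathsf m_{a,r}\otimes1):\uparrow_a\uparrow_b\to\uparrow_{a+r}\uparrow_{b-r}$, $C=(\mathsf s_{a-1,1}\otimes\mathsf s_{1,b-1});(1\otimes\cap\otimes1):\uparrow_a\uparrow_b\to\uparrow_{a-1}\uparrow_{b-1}$, $K=(1\otimes\cup\otimes1);(\mathsf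 m_{a,1}\otimes\mathsf m_{1,b}):\uparrow_a\uparrow_b\to\uparrow_{a+1}\uparrow_{b+1}$, $A=(\mathsf s_{a-2,2}\otimes1);(1\otimes\alpha\otimes1)$ and $A'=(1\otimes\mathsf s_{2,b-2});(1\otimes\alpha\otimes1)$. The upward crossing is $X_{a,b}=\sum_{s-r=a-b;\ r,s\ge0}(-1)^{a-s}E^{(s)};F^{(r)}:\uparrow_a\uparrow_b\to\uparrow_b\uparrow_a$; the leftward crossing is $L_{a,b}=(1\otimes\mathrm{cup}_a);(1\otimes X_{b,a}\otimes1);(\mathrm{cap}_a\otimes1):\downarrow_a\uparrow_b\to\uparrow_b\downarrow_a$; the downward crossing $D_{a,b}:\downarrow_a\downarrow_b\to\downarrow_b\downarrow_a$ is $(1\otimes[\mathrm{cup}_a;(1\otimes\mathrm{cup}_b\otimes1)]);(1\otimes X_{a,b}\otimes1);([(1\otimes\mathrm{cap}_b\otimes1);\mathrm{cap}_a]\otimes1)$. The rightward cap and cup are $R_{a,a};\mathrm{cap}_a:\uparrow_a\downarrow_a\to\mathbf 1$ and $\mathrm{cup}_a;R_{a,a}:\mathbf 1\to\downarrow_a\uparrow_a$.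 *Relations*, for all nonnegative labels for which the source and target have nonnegative labels: (1) (co)associativity: $\mathsf s_{a+b,c};(\mathsf s_{a,b}\otimes1)=\mathsf s_{a,b+c};(1\otimes\mathsf s_{b,c})$ and $(\mathsf m_{a,b}\otimes1);\mathsf m_{a+b,c}=(1\otimes\mathsf m_{b,c});\mathsf m_{a,b+c}$; (2) on $\uparrow_a\uparrow_b$: $E^{(s)};F^{(r)}=\sum_{t\ge0}\binom{a-b+r-s}{t}F^{(r-t)};E^{(s-t)}$; (3) $(\cup\otimes1);(1\otimes\cap)=1_{\uparrow_1}=-(1\otimes\cup);(\cap\otimes1)$; (4) $\mathsf m_{1,1};\alpha=\cap$; (5) $E^{(r)};C=C;E^{(r)}+2A;E^{(r-1)}$ and $F^{(r)};C=C;F^{(r)}+2A';F^{(r-1)}$; (6) $K;E^{(r)}=E^{(r)};K$ and $K;F^{(r)}=F^{(r)};K$; (7) $(\mathrm{cup}_a\otimes1);(1\otimes\mathrm{cap}_a)=1_{\uparrow_a}$ and $(1\otimes\mathrm{cup}_a);(\mathrm{cap}_a\otimes1)=1_{\downarrow_a}$; (8) $L_{a,b};R_{b,a}=1$ and $R_{a,b};L_{b,a}=1$;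 (9) $\mathrm{cup}_a;R_{a,a};\mathrm{cap}_a=0$ for $a>0$. **Corollary.** Let $\beta_{X,Y}:XY\to YX$, for words $X,Y$, be the composite of the crossings $X_{a,b},R_{a,b},L_{a,b},D_{a,b}$ in which each strand of $X$ crosses each strand of $Y$ once. Then $\beta$ is a symmetric braiding of the monoidal supercategory $\mathfrak p\text{-}\mathbf{Web}_{\uparrow\downarrow}$: it is even, $\beta_{X',Y'}\circ(f\otimes g)=(-1)^{|f||g|}(g\otimes f)\circ\beta_{X,Y}$ for homogeneous $f:X\to X'$, $g:Y\to Y'$, it satisfies both hexagon axioms, and $\beta_{Y,X}\circ\beta_{X,Y}=1_{XY}$. For all $a$, the leftward cap and cup satisfy the two zigzag identities that make $\downarrow_a$ a left dual of $\uparrow_a$, and the rightward cap and cup those that make $\downarrow_a$ a right dual of $\uparrow_a$. More generally, for a word $X$ let $X^*$ be the word with the order of the letters and all orientations reversed; the rainbows of nested caps and cups $X^*X\to\mathbf 1$, $\mathbf 1\to XX^*$ (using the leftward cap/cup at an upward letter of $X$, the rightward one at a downward letter) make $X^*$ a left dual of $X$, and the rainbows $XX^*\to\mathbf 1$, $\mathbf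 1\to X^*X$ make $X^*$ a right dual of $X$. In particular $\mathfrak p\text{-}\mathbf{Web}_{\uparrow\downarrow}$ is rigid. -/

import Mathlib

open CategoryTheory

/-! ### Strict monoidal supercategories, symmetric braidings, duals -/

/-- The sign `(-1) ^ p` attached to a parity `p`. -/
def superSign (k : Type*) [CommRing k] (p : ZMod 2) : k := (-1) ^ p.val

/-- A strict monoidal `k`-linear supercategory: a `k`-linear category whose morphism spaces are
`k`-supermodules (with composition and identities even), together with a strictly associative and
strictly unital product, bilinear and even on morphisms, which satisfies the super-interchange law.
On objects the product is the multiplication of a monoid; `tensor f g` is the product of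
morphisms. -/
class StrictMonoidalSupercategory (k : Type*) [CommRing k] (C : Type*) [Category C]
    [Preadditive C] [Linear k C] [Monoid C] where
  /-- `parity X Y p` is the space of morphisms of parity `p`. -/
  parity (X Y : C) : ZMod 2 → Submodule k (X ⟶ Y)
  parity_internal (X Y : C) : DirectSum.IsInternal (parity X Y)
  id_mem (X : C) : 𝟙 X ∈ parity X X 0
  comp_mem {X Y Z : C} {p q : ZMod 2} {f : X ⟶ Y} {g : Y ⟶ Z} :
    f ∈ parity X Y p → g ∈ parity Y Z q → f ≫ g ∈ parity X Z (p + q)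
  /-- The product of morphisms. -/
  tensor {X Y X' Y' : C} : (X ⟶ Y) →ₗ[k] (X' ⟶ Y') →ₗ[k] (X * X' ⟶ Y * Y')
  tensor_mem {X Y X' Y' : C} {p q : ZMod 2} {f : X ⟶ Y} {g : X' ⟶ Y'} :
    f ∈ parity X Y p → g ∈ parity X' Y' q → tensor f g ∈ parity (X * X') (Y * Y') (p + q)
  id_tensor_id (X Y : C) : tensor (𝟙 X) (𝟙 Y) = 𝟙 (X * Y)
  /-- In terms of the usual composition, `(f' ⊗ g') ∘ (f ⊗ g) = (-1)^(|g'||f|) (f' ∘ f) ⊗ (g' ∘ g)`. -/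
  interchange {X Y Z X' Y' Z' : C} {p q : ZMod 2} (f : X ⟶ Y) (f' : Y ⟶ Z) (g : X' ⟶ Y')
    (g' : Y' ⟶ Z') : f ∈ parity X Y p → g' ∈ parity Y' Z' q →
    tensor f g ≫ tensor f' g' = superSign k (p * q) • tensor (f ≫ f') (g ≫ g')
  tensor_assoc {X Y X' Y' X'' Y'' : C} (f : X ⟶ Y) (f' : X' ⟶ Y') (f'' : X'' ⟶ Y'') :
    tensor (tensor f f') f'' ≫ eqToHom (mul_assoc Y Y' Y'') =
      eqToHom (mul_assoc X X' X'') ≫ tensor f (tensor f' f'')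
  one_tensor {X Y : C} (f : X ⟶ Y) :
    tensor (𝟙 (1 : C)) f ≫ eqToHom (one_mul Y) = eqToHom (one_mul X) ≫ f
  tensor_one {X Y : C} (f : X ⟶ Y) :
    tensor f (𝟙 (1 : C)) ≫ eqToHom (mul_one Y) = eqToHom (mul_one X) ≫ f

section Structures

open StrictMonoidalSupercategory

variable (k : Type*) [CommRing k] {C : Type*} [Category C] [Preadditive C] [Linear k C] [Monoid C]
  [StrictMonoidalSupercategory k C]

/-- The family `β` is a symmetric braiding on the strict monoidal supercategory `C`: it is even,
natural in both arguments (with the sign forced by the super-interchange law), it satisfies the two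
hexagon axioms (triangles, since `C` is strict), and `β X Y` and `β Y X` are mutually inverse. -/
structure IsSymmetricBraiding (β : ∀ X Y : C, X * Y ⟶ Y * X) : Prop where
  even (X Y : C) : β X Y ∈ parity (k := k) (X * Y) (Y * X) 0
  natural {X X' Y Y' : C} {p q : ZMod 2} (f : X ⟶ X') (g : Y ⟶ Y') :
    f ∈ parity (k := k) X X' p → g ∈ parity (k := k) Y Y' q →
    tensor (k := k) f g ≫ β X' Y' = superSign k (p * q) • (β X Y ≫ tensor (k := k) g f)
  hexagon_forward (X Y Z : C) :
    β X (Y * Z) = eqToHom (mul_assoc X Y Z).symm ≫ tensor (k := k) (β X Y) (𝟙 Z) ≫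
      eqToHom (mul_assoc Y X Z) ≫ tensor (k := k) (𝟙 Y) (β X Z) ≫ eqToHom (mul_assoc Y Z X).symm
  hexagon_reverse (X Y Z : C) :
    β (X * Y) Z = eqToHom (mul_assoc X Y Z) ≫ tensor (k := k) (𝟙 X) (β Y Z) ≫
      eqToHom (mul_assoc X Z Y).symm ≫ tensor (k := k) (β X Z) (𝟙 Y) ≫ eqToHom (mul_assoc Z X Y)
  symmetry (X Y : C) : β X Y ≫ β Y X = 𝟙 (X * Y)

/-- The even morphisms `ev : D ⊗ X ⟶ 1` and `coev : 1 ⟶ X ⊗ D` exhibit `D` as a left dual of `X`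
(and so `X` as a right dual of `D`): both zigzag identities hold. -/
structure IsDualPair (D X : C) (ev : D * X ⟶ 1) (coev : 1 ⟶ X * D) : Prop where
  ev_even : ev ∈ parity (k := k) (D * X) 1 0
  coev_even : coev ∈ parity (k := k) 1 (X * D) 0
  zigzag : eqToHom (one_mul X).symm ≫ tensor (k := k) coev (𝟙 X) ≫ eqToHom (mul_assoc X D X) ≫
    tensor (k := k) (𝟙 X) ev ≫ eqToHom (mul_one X) = 𝟙 X
  zigzag' : eqToHom (mul_one D).symm ≫ tensor (k := k) (𝟙 D) coev ≫
    eqToHom (mul_assoc D X D).symm ≫ tensor (k := k) ev (𝟙 D) ≫ eqToHom (one_mul D) = 𝟙 D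

variable (C) in
/-- A strict monoidal supercategory is rigid if every object has a left dual and a right dual. -/
def IsRigid : Prop :=
  ∀ X : C, (∃ (D : C) (ev : D * X ⟶ 1) (coev : 1 ⟶ X * D), IsDualPair k D X ev coev) ∧
    ∃ (D : C) (ev : X * D ⟶ 1) (coev : 1 ⟶ D * X), IsDualPair k X D ev coev

end Structures

/-! ### Strict monoidal supercategories by generators and relations -/

/-- Expressions for morphisms built from generators in `G`, between words in the alphabet `S`. Here
`comp f g` is `f` followed by `g`. -/
inductive DiagExpr (k S G : Type*)
  | gen (g : G)
  | id (X : List S)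
  | comp (f g : DiagExpr k S G)
  | tens (f g : DiagExpr k S G)
  | zero
  | plus (f g : DiagExpr k S G)
  | smul (c : k) (f : DiagExpr k S G)

namespace DiagExpr

infixr:70 " ⨾ " => DiagExpr.comp
infixr:75 " ⊠ " => DiagExpr.tens

variable {k S G : Type*}

/-- Finite sums of expressions. -/
def sum : List (DiagExpr k S G) → DiagExpr k S G
  | [] => zero
  | f :: l => plus f (sum l)

/-- The expression `f` if `c` holds, and zero otherwise. -/
def onlyIf (c : Prop) [Decidable c] (f : DiagExpr k S G) : DiagExpr k S G := if c then f else zero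

/-- `f` is a well-formed expression for a morphism `X ⟶ Y`, where the generator `g` is a morphism
`src g ⟶ tgt g`. -/
def HasType (src tgt : G → List S) : DiagExpr k S G → List S → List S → Prop
  | gen g, X, Y => X = src g ∧ Y = tgt g
  | id Z, X, Y => X = Z ∧ Y = Z
  | comp f g, X, Z => ∃ Y, HasType src tgt f X Y ∧ HasType src tgt g Y Z
  | tens f g, X, Y => ∃ X₁ Y₁ X₂ Y₂, HasType src tgt f X₁ Y₁ ∧ HasType src tgt g X₂ Y₂ ∧
      X = X₁ ++ X₂ ∧ Y = Y₁ ++ Y₂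
  | zero, _, _ => True
  | plus f g, X, Y => HasType src tgt f X Y ∧ HasType src tgt g X Y
  | smul _ f, X, Y => HasType src tgt f X Y

/-- `f` is homogeneous of parity `p`, where the generator `g` has parity `par g`. -/
def HasParity (par : G → ZMod 2) : DiagExpr k S G → ZMod 2 → Prop
  | gen g, p => p = par g
  | id _, p => p = 0
  | comp f g, p => ∃ q r, HasParity par f q ∧ HasParity par g r ∧ p = q + r
  | tens f g, p => ∃ q r, HasParity par f q ∧ HasParity par g r ∧ p = q + r
  | zero, _ => True
  | plus f g, p => HasParity par f p ∧ HasParity par g p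
  | smul _ f, p => HasParity par f p

end DiagExpr

/-- A presentation of a strict monoidal `k`-linear supercategory whose monoid of objects is free on
`Strand`: generating morphisms with their parities, and relations `rel X Y f g` (read `f = g` as
morphisms `X ⟶ Y`), which are well-formed and homogeneous. -/
structure SuperPresentation (k : Type*) [CommRing k] where
  Strand : Type
  Gen : Type
  src : Gen → List Strand
  tgt : Gen → List Strand
  par : Gen → ZMod 2
  rel : List Strand → List Strand → DiagExpr k Strand Gen → DiagExpr k Strand Gen → Prop
  rel_type {X Y f g} : rel X Y f g → f.HasType src tgt X Y ∧ g.HasType src tgt X Y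
  rel_parity {X Y f g} : rel X Y f g → ∃ p, f.HasParity par p ∧ g.HasParity par p

namespace SuperPresentation

open DiagExpr

universe u

variable {k : Type u} [CommRing k] (P : SuperPresentation k)

/-- Expressions in the generators of `P`. -/
abbrev Diag := DiagExpr k P.Strand P.Gen

/-- `f` is an expression for a morphism `X ⟶ Y`. -/
abbrev Typed (f : P.Diag) (X Y : List P.Strand) : Prop := f.HasType P.src P.tgt X Y

/-- The smallest congruence on expressions that contains the relations of `P` and the axioms of a
strict monoidal `k`-linear supercategory. -/
inductive Eqv : List P.Strand → List P.Strand → P.Diag → P.Diag → Prop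
  | rel {X Y f g} : P.rel X Y f g → Eqv X Y f g
  | refl {X Y f} : P.Typed f X Y → Eqv X Y f f
  | symm {X Y f g} : Eqv X Y f g → Eqv X Y g f
  | trans {X Y f g h} : Eqv X Y f g → Eqv X Y g h → Eqv X Y f h
  -- congruence
  | comp_congr {X Y Z f f' g g'} : Eqv X Y f f' → Eqv Y Z g g' → Eqv X Z (f ⨾ g) (f' ⨾ g')
  | tens_congr {X Y X' Y' f f' g g'} : Eqv X Y f f' → Eqv X' Y' g g' →
      Eqv (X ++ X') (Y ++ Y') (f ⊠ g) (f' ⊠ g')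
  | plus_congr {X Y f f' g g'} : Eqv X Y f f' → Eqv X Y g g' → Eqv X Y (plus f g) (plus f' g')
  | smul_congr {X Y f f'} (c : k) : Eqv X Y f f' → Eqv X Y (smul c f) (smul c f')
  -- morphism spaces are modules
  | plus_assoc {X Y f g h} : P.Typed f X Y → P.Typed g X Y → P.Typed h X Y →
      Eqv X Y (plus (plus f g) h) (plus f (plus g h))
  | plus_comm {X Y f g} : P.Typed f X Y → P.Typed g X Y → Eqv X Y (plus f g) (plus g f)
  | zero_plus {X Y f} : P.Typed f X Y → Eqv X Y (plus zero f) f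
  | smul_plus {X Y f g} (c : k) : P.Typed f X Y → P.Typed g X Y →
      Eqv X Y (smul c (plus f g)) (plus (smul c f) (smul c g))
  | plus_smul {X Y f} (c d : k) : P.Typed f X Y →
      Eqv X Y (smul (c + d) f) (plus (smul c f) (smul d f))
  | mul_smul {X Y f} (c d : k) : P.Typed f X Y → Eqv X Y (smul (c * d) f) (smul c (smul d f))
  | one_smul {X Y f} : P.Typed f X Y → Eqv X Y (smul 1 f) f
  | zero_smul {X Y f} : P.Typed f X Y → Eqv X Y (smul 0 f) zero
  -- composition: bilinear, unital, associative
  | plus_comp {X Y Z f f' g} : P.Typed f X Y → P.Typed f' X Y → P.Typed g Y Z →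
      Eqv X Z (plus f f' ⨾ g) (plus (f ⨾ g) (f' ⨾ g))
  | comp_plus {X Y Z f g g'} : P.Typed f X Y → P.Typed g Y Z → P.Typed g' Y Z →
      Eqv X Z (f ⨾ plus g g') (plus (f ⨾ g) (f ⨾ g'))
  | smul_comp {X Y Z f g} (c : k) : P.Typed f X Y → P.Typed g Y Z →
      Eqv X Z (smul c f ⨾ g) (smul c (f ⨾ g))
  | comp_smul {X Y Z f g} (c : k) : P.Typed f X Y → P.Typed g Y Z →
      Eqv X Z (f ⨾ smul c g) (smul c (f ⨾ g))
  | id_comp {X Y f} : P.Typed f X Y → Eqv X Y (id X ⨾ f) f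
  | comp_id {X Y f} : P.Typed f X Y → Eqv X Y (f ⨾ id Y) f
  | comp_assoc {W X Y Z f g h} : P.Typed f W X → P.Typed g X Y → P.Typed h Y Z →
      Eqv W Z ((f ⨾ g) ⨾ h) (f ⨾ g ⨾ h)
  -- product: bilinear, unital, associative, with super-interchange
  | plus_tens {X Y X' Y' f f' g} : P.Typed f X Y → P.Typed f' X Y → P.Typed g X' Y' →
      Eqv (X ++ X') (Y ++ Y') (plus f f' ⊠ g) (plus (f ⊠ g) (f' ⊠ g))
  | tens_plus {X Y X' Y' f g g'} : P.Typed f X Y → P.Typed g X' Y' → P.Typed g' X' Y' →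
      Eqv (X ++ X') (Y ++ Y') (f ⊠ plus g g') (plus (f ⊠ g) (f ⊠ g'))
  | smul_tens {X Y X' Y' f g} (c : k) : P.Typed f X Y → P.Typed g X' Y' →
      Eqv (X ++ X') (Y ++ Y') (smul c f ⊠ g) (smul c (f ⊠ g))
  | tens_smul {X Y X' Y' f g} (c : k) : P.Typed f X Y → P.Typed g X' Y' →
      Eqv (X ++ X') (Y ++ Y') (f ⊠ smul c g) (smul c (f ⊠ g))
  | id_tens_id (X Y) : Eqv (X ++ Y) (X ++ Y) (id X ⊠ id Y) (id (X ++ Y))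
  | nil_tens {X Y f} : P.Typed f X Y → Eqv X Y (id [] ⊠ f) f
  | tens_nil {X Y f} : P.Typed f X Y → Eqv X Y (f ⊠ id []) f
  | tens_assoc {X Y X' Y' X'' Y'' f f' f''} : P.Typed f X Y → P.Typed f' X' Y' →
      P.Typed f'' X'' Y'' →
      Eqv (X ++ X' ++ X'') (Y ++ Y' ++ Y'') ((f ⊠ f') ⊠ f'') (f ⊠ f' ⊠ f'')
  | interchange {X Y Z X' Y' Z' f f' g g'} {p q : ZMod 2} : P.Typed f X Y → P.Typed f' Y Z →
      P.Typed g X' Y' → P.Typed g' Y' Z' → f.HasParity P.par p → g'.HasParity P.par q →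
      Eqv (X ++ X') (Z ++ Z') ((f ⊠ g) ⨾ (f' ⊠ g'))
        (smul (superSign k (p * q)) ((f ⨾ f') ⊠ (g ⨾ g')))

variable {P}

theorem Typed.cast {f : P.Diag} {X Y X' Y' : List P.Strand} (h : P.Typed f X Y) (hX : X = X')
    (hY : Y = Y') : P.Typed f X' Y' := hX ▸ hY ▸ h

theorem Eqv.cast {f g : P.Diag} {X Y X' Y' : List P.Strand} (h : P.Eqv X Y f g) (hX : X = X')
    (hY : Y = Y') : P.Eqv X' Y' f g := hX ▸ hY ▸ h

theorem Typed.comp {f g : P.Diag} {X Y Z : List P.Strand} (hf : P.Typed f X Y)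
    (hg : P.Typed g Y Z) : P.Typed (f ⨾ g) X Z := ⟨Y, hf, hg⟩

theorem Typed.tens {f g : P.Diag} {X Y X' Y' : List P.Strand} (hf : P.Typed f X Y)
    (hg : P.Typed g X' Y') : P.Typed (f ⊠ g) (X ++ X') (Y ++ Y') :=
  ⟨X, Y, X', Y', hf, hg, rfl, rfl⟩

theorem Typed.plus {f g : P.Diag} {X Y : List P.Strand} (hf : P.Typed f X Y)
    (hg : P.Typed g X Y) : P.Typed (.plus f g) X Y := ⟨hf, hg⟩

theorem Typed.smul {f : P.Diag} {X Y : List P.Strand} (c : k) (hf : P.Typed f X Y) :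
    P.Typed (.smul c f) X Y := hf

theorem Typed.id (X : List P.Strand) : P.Typed (.id X) X X := ⟨rfl, rfl⟩

theorem Typed.zero {X Y : List P.Strand} : P.Typed .zero X Y := trivial

theorem Eqv.typed {f g : P.Diag} {X Y : List P.Strand} (h : P.Eqv X Y f g) :
    P.Typed f X Y ∧ P.Typed g X Y := by
  induction h with
  | rel h => exact P.rel_type h
  | refl h => exact ⟨h, h⟩
  | symm _ ih => exact ih.symm
  | trans _ _ ih₁ ih₂ => exact ⟨ih₁.1, ih₂.2⟩
  | comp_congr _ _ ih₁ ih₂ => exact ⟨ih₁.1.comp ih₂.1, ih₁.2.comp ih₂.2⟩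
  | tens_congr _ _ ih₁ ih₂ => exact ⟨ih₁.1.tens ih₂.1, ih₁.2.tens ih₂.2⟩
  | plus_congr _ _ ih₁ ih₂ => exact ⟨ih₁.1.plus ih₂.1, ih₁.2.plus ih₂.2⟩
  | smul_congr c _ ih => exact ih
  | plus_assoc hf hg hh => exact ⟨(hf.plus hg).plus hh, hf.plus (hg.plus hh)⟩
  | plus_comm hf hg => exact ⟨hf.plus hg, hg.plus hf⟩
  | zero_plus hf => exact ⟨Typed.zero.plus hf, hf⟩
  | smul_plus c hf hg => exact ⟨(hf.plus hg).smul c, (hf.smul c).plus (hg.smul c)⟩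
  | plus_smul c d hf => exact ⟨hf.smul _, (hf.smul c).plus (hf.smul d)⟩
  | mul_smul c d hf => exact ⟨hf.smul _, (hf.smul d).smul c⟩
  | one_smul hf => exact ⟨hf.smul _, hf⟩
  | zero_smul hf => exact ⟨hf.smul _, Typed.zero⟩
  | plus_comp hf hf' hg => exact ⟨(hf.plus hf').comp hg, (hf.comp hg).plus (hf'.comp hg)⟩
  | comp_plus hf hg hg' => exact ⟨hf.comp (hg.plus hg'), (hf.comp hg).plus (hf.comp hg')⟩
  | smul_comp c hf hg => exact ⟨(hf.smul c).comp hg, (hf.comp hg).smul c⟩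
  | comp_smul c hf hg => exact ⟨hf.comp (hg.smul c), (hf.comp hg).smul c⟩
  | id_comp hf => exact ⟨(Typed.id _).comp hf, hf⟩
  | comp_id hf => exact ⟨hf.comp (Typed.id _), hf⟩
  | comp_assoc hf hg hh => exact ⟨(hf.comp hg).comp hh, hf.comp (hg.comp hh)⟩
  | plus_tens hf hf' hg => exact ⟨(hf.plus hf').tens hg, (hf.tens hg).plus (hf'.tens hg)⟩
  | tens_plus hf hg hg' => exact ⟨hf.tens (hg.plus hg'), (hf.tens hg).plus (hf.tens hg')⟩
  | smul_tens c hf hg => exact ⟨(hf.smul c).tens hg, (hf.tens hg).smul c⟩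
  | tens_smul c hf hg => exact ⟨hf.tens (hg.smul c), (hf.tens hg).smul c⟩
  | id_tens_id X Y => exact ⟨(Typed.id _).tens (Typed.id _), Typed.id _⟩
  | nil_tens hf => exact ⟨(Typed.id []).tens hf, hf⟩
  | tens_nil hf =>
    exact ⟨((hf.tens (Typed.id [])).cast (List.append_nil _) (List.append_nil _)), hf⟩
  | tens_assoc hf hg hh =>
    exact ⟨(hf.tens hg).tens hh,
      (hf.tens (hg.tens hh)).cast (List.append_assoc ..).symm (List.append_assoc ..).symm⟩
  | interchange hf hf' hg hg' _ _ =>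
    exact ⟨(hf.tens hg).comp (hf'.tens hg'), ((hf.comp hf').tens (hg.comp hg')).smul _⟩

variable (P)

/-- The objects of the presented supercategory: words, with concatenation as product. -/
def Cat : Type := FreeMonoid P.Strand

instance : Monoid P.Cat := inferInstanceAs (Monoid (FreeMonoid P.Strand))

/-- Well-formed expressions modulo the congruence. -/
def homSetoid (X Y : List P.Strand) : Setoid {f : P.Diag // P.Typed f X Y} where
  r f g := P.Eqv X Y f g
  iseqv := ⟨fun f => .refl f.2, .symm, .trans⟩

/-- The morphisms of the presented supercategory. -/
def Hom (X Y : List P.Strand) : Type u := Quotient (P.homSetoid X Y)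

/-- The morphism represented by a well-formed expression. -/
def toHom {X Y : List P.Strand} (f : P.Diag) (hf : P.Typed f X Y) : P.Hom X Y :=
  Quotient.mk (P.homSetoid X Y) ⟨f, hf⟩

variable {P}

theorem toHom_eq {X Y : List P.Strand} {f g : P.Diag} {hf : P.Typed f X Y} {hg : P.Typed g X Y}
    (h : P.Eqv X Y f g) : P.toHom f hf = P.toHom g hg := Quotient.sound h

theorem toHom_exact {X Y : List P.Strand} {f g : P.Diag} {hf : P.Typed f X Y} {hg : P.Typed g X Y}
    (h : P.toHom f hf = P.toHom g hg) : P.Eqv X Y f g := Quotient.exact h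

theorem toHom_surj {X Y : List P.Strand} (f : P.Hom X Y) : ∃ t ht, f = P.toHom t ht := by
  obtain ⟨⟨t, ht⟩, rfl⟩ := Quotient.exists_rep f
  exact ⟨t, ht, rfl⟩

section Linear

variable {X Y : List P.Strand}

instance : Zero (P.Hom X Y) := ⟨P.toHom .zero Typed.zero⟩

instance : Add (P.Hom X Y) :=
  ⟨Quotient.map₂ (fun f g => ⟨.plus f.1 g.1, f.2.plus g.2⟩) fun _ _ h _ _ h' => .plus_congr h h'⟩

instance : SMul k (P.Hom X Y) :=
  ⟨fun c => Quotient.map (fun f => ⟨.smul c f.1, f.2.smul c⟩) fun _ _ h => .smul_congr c h⟩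

instance : Neg (P.Hom X Y) := ⟨fun f => (-1 : k) • f⟩

instance homAddCommGroup : AddCommGroup (P.Hom X Y) where
  add_assoc a b c := by
    obtain ⟨f, hf, rfl⟩ := toHom_surj a
    obtain ⟨g, hg, rfl⟩ := toHom_surj b
    obtain ⟨h, hh, rfl⟩ := toHom_surj c
    exact toHom_eq (.plus_assoc hf hg hh)
  zero_add a := by
    obtain ⟨f, hf, rfl⟩ := toHom_surj a
    exact toHom_eq (.zero_plus hf)
  add_zero a := by
    obtain ⟨f, hf, rfl⟩ := toHom_surj a
    exact toHom_eq (.trans (.plus_comm hf Typed.zero) (.zero_plus hf))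
  add_comm a b := by
    obtain ⟨f, hf, rfl⟩ := toHom_surj a
    obtain ⟨g, hg, rfl⟩ := toHom_surj b
    exact toHom_eq (.plus_comm hf hg)
  neg_add_cancel a := by
    obtain ⟨f, hf, rfl⟩ := toHom_surj a
    refine toHom_eq (g := .zero) (hf := (hf.smul _).plus hf) ?_
    refine .trans (.plus_congr (.refl (hf.smul _)) (.symm (.one_smul hf))) ?_
    refine .trans (.symm (.plus_smul (-1) 1 hf)) ?_
    rw [neg_add_cancel]
    exact .zero_smul hf
  nsmul := nsmulRec
  zsmul := zsmulRec

instance homModule : Module k (P.Hom X Y) :=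
  Module.ofMinimalAxioms
    (fun c a b => by
      obtain ⟨f, hf, rfl⟩ := toHom_surj a
      obtain ⟨g, hg, rfl⟩ := toHom_surj b
      exact toHom_eq (.smul_plus c hf hg))
    (fun c d a => by
      obtain ⟨f, hf, rfl⟩ := toHom_surj a
      exact toHom_eq (.plus_smul c d hf))
    (fun c d a => by
      obtain ⟨f, hf, rfl⟩ := toHom_surj a
      exact toHom_eq (.mul_smul c d hf))
    (fun a => by
      obtain ⟨f, hf, rfl⟩ := toHom_surj a
      exact toHom_eq (.one_smul hf))

end Linear

instance : Category P.Cat where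
  Hom X Y := P.Hom X Y
  id X := P.toHom (.id X) (Typed.id _)
  comp := Quotient.map₂ (fun f g => ⟨f.1 ⨾ g.1, f.2.comp g.2⟩) fun _ _ h _ _ h' => .comp_congr h h'
  id_comp a := by
    obtain ⟨f, hf, rfl⟩ := toHom_surj a
    exact toHom_eq (.id_comp hf)
  comp_id a := by
    obtain ⟨f, hf, rfl⟩ := toHom_surj a
    exact toHom_eq (.comp_id hf)
  assoc a b c := by
    obtain ⟨f, hf, rfl⟩ := toHom_surj a
    obtain ⟨g, hg, rfl⟩ := toHom_surj b
    obtain ⟨h, hh, rfl⟩ := toHom_surj c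
    exact toHom_eq (.comp_assoc hf hg hh)

instance : Preadditive P.Cat where
  homGroup X Y := homAddCommGroup (P := P) (X := X) (Y := Y)
  add_comp _ _ _ a b c := by
    obtain ⟨f, hf, rfl⟩ := toHom_surj a
    obtain ⟨g, hg, rfl⟩ := toHom_surj b
    obtain ⟨h, hh, rfl⟩ := toHom_surj c
    exact toHom_eq (.plus_comp hf hg hh)
  comp_add _ _ _ a b c := by
    obtain ⟨f, hf, rfl⟩ := toHom_surj a
    obtain ⟨g, hg, rfl⟩ := toHom_surj b
    obtain ⟨h, hh, rfl⟩ := toHom_surj c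
    exact toHom_eq (.comp_plus hf hg hh)

instance : Linear k P.Cat where
  homModule X Y := SuperPresentation.homModule (P := P) (X := X) (Y := Y)
  smul_comp _ _ _ c a b := by
    obtain ⟨f, hf, rfl⟩ := toHom_surj a
    obtain ⟨g, hg, rfl⟩ := toHom_surj b
    exact toHom_eq (.smul_comp c hf hg)
  comp_smul _ _ _ a c b := by
    obtain ⟨f, hf, rfl⟩ := toHom_surj a
    obtain ⟨g, hg, rfl⟩ := toHom_surj b
    exact toHom_eq (.comp_smul c hf hg)

/-- The product of morphisms of the presented supercategory. -/
def tensorHom {X Y X' Y' : P.Cat} : (X ⟶ Y) →ₗ[k] (X' ⟶ Y') →ₗ[k] (X * X' ⟶ Y * Y') :=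
  LinearMap.mk₂ k
    (Quotient.map₂ (fun f g => ⟨f.1 ⊠ g.1, f.2.tens g.2⟩) fun _ _ h _ _ h' => .tens_congr h h')
    (fun a b c => by
      obtain ⟨f, hf, rfl⟩ := toHom_surj a
      obtain ⟨g, hg, rfl⟩ := toHom_surj b
      obtain ⟨h, hh, rfl⟩ := toHom_surj c
      exact toHom_eq (.plus_tens hf hg hh))
    (fun c a b => by
      obtain ⟨f, hf, rfl⟩ := toHom_surj a
      obtain ⟨g, hg, rfl⟩ := toHom_surj b
      exact toHom_eq (.smul_tens c hf hg))
    (fun a b c => by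
      obtain ⟨f, hf, rfl⟩ := toHom_surj a
      obtain ⟨g, hg, rfl⟩ := toHom_surj b
      obtain ⟨h, hh, rfl⟩ := toHom_surj c
      exact toHom_eq (.tens_plus hf hg hh))
    (fun c a b => by
      obtain ⟨f, hf, rfl⟩ := toHom_surj a
      obtain ⟨g, hg, rfl⟩ := toHom_surj b
      exact toHom_eq (.tens_smul c hf hg))

/-- The morphism represented by a well-formed expression, as a morphism of the category. -/
def mor {X Y : P.Cat} (f : P.Diag) (hf : P.Typed f X Y) : X ⟶ Y := P.toHom f hf

theorem mor_comp {X Y Z : P.Cat} {f g : P.Diag} (hf : P.Typed f X Y) (hg : P.Typed g Y Z) :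
    mor f hf ≫ mor g hg = mor (f ⨾ g) (Typed.comp hf hg) := rfl

theorem mor_add {X Y : P.Cat} {f g : P.Diag} (hf : P.Typed f X Y) (hg : P.Typed g X Y) :
    mor f hf + mor g hg = mor (plus f g) (Typed.plus hf hg) := rfl

theorem smul_mor {X Y : P.Cat} {f : P.Diag} (c : k) (hf : P.Typed f X Y) :
    c • mor f hf = mor (smul c f) (Typed.smul c hf) := rfl

theorem tensor_mor {X Y X' Y' : P.Cat} {f g : P.Diag} (hf : P.Typed f X Y)
    (hg : P.Typed g X' Y') : tensorHom (mor f hf) (mor g hg) =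
      (mor (f ⊠ g) (Typed.tens hf hg) : X * X' ⟶ Y * Y') := rfl

variable (P) in
/-- Morphisms of parity `p`: those represented by a homogeneous expression of parity `p`. -/
def parity (X Y : P.Cat) (p : ZMod 2) : Submodule k (X ⟶ Y) where
  carrier := {a | ∃ f, ∃ hf : P.Typed f X Y, f.HasParity P.par p ∧ a = P.toHom f hf}
  add_mem' := by
    rintro _ _ ⟨f, hf, pf, rfl⟩ ⟨g, hg, pg, rfl⟩
    exact ⟨.plus f g, hf.plus hg, ⟨pf, pg⟩, rfl⟩
  zero_mem' := ⟨.zero, Typed.zero, trivial, rfl⟩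
  smul_mem' := by
    rintro c _ ⟨f, hf, pf, rfl⟩
    exact ⟨.smul c f, hf.smul c, pf, rfl⟩

theorem comp_mem {X Y Z : P.Cat} {p q : ZMod 2} {f : X ⟶ Y} {g : Y ⟶ Z} :
    f ∈ P.parity X Y p → g ∈ P.parity Y Z q → f ≫ g ∈ P.parity X Z (p + q) := by
  rintro ⟨f, hf, pf, rfl⟩ ⟨g, hg, pg, rfl⟩
  exact ⟨f ⨾ g, hf.comp hg, ⟨p, q, pf, pg, rfl⟩, rfl⟩

theorem tensor_mem {X Y X' Y' : P.Cat} {p q : ZMod 2} {f : X ⟶ Y} {g : X' ⟶ Y'} :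
    f ∈ P.parity X Y p → g ∈ P.parity X' Y' q →
      tensorHom f g ∈ P.parity (X * X') (Y * Y') (p + q) := by
  rintro ⟨f, hf, pf, rfl⟩ ⟨g, hg, pg, rfl⟩
  exact ⟨f ⊠ g, hf.tens hg, ⟨p, q, pf, pg, rfl⟩, rfl⟩

theorem eqToHom_eq {X Y : P.Cat} (h : X = Y) :
    eqToHom h = P.toHom (.id X) ((Typed.id (P := P) X).cast rfl h) := by
  subst h; rfl

theorem superSign_add (p q : ZMod 2) : superSign k (p + q) = superSign k p * superSign k q := by
  have h (p : ZMod 2) : p = 0 ∨ p = 1 := by revert p; decide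
  have h2 : (1 : ZMod 2) + 1 = 0 := by decide
  have h1 : superSign k 1 = -1 := by simp [superSign, ZMod.val_one]
  have h0 : superSign k 0 = 1 := by simp [superSign]
  rcases h p with rfl | rfl <;> rcases h q with rfl | rfl <;> simp [h0, h1, h2]

variable (P) in
/-- The parity involution, which multiplies a generator of parity `p` by `(-1) ^ p`. -/
def flip : P.Diag → P.Diag
  | .gen g => .smul (superSign k (P.par g)) (.gen g)
  | .id X => .id X
  | .comp f g => flip f ⨾ flip g
  | .tens f g => flip f ⊠ flip g
  | .zero => .zero
  | .plus f g => .plus (flip f) (flip g)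
  | .smul c f => .smul c (flip f)

theorem flip_typed {f : P.Diag} {X Y : List P.Strand} (h : P.Typed f X Y) :
    P.Typed (P.flip f) X Y := by
  induction f generalizing X Y with
  | gen g => exact h
  | id Z => exact h
  | comp f g ihf ihg => obtain ⟨Z, h₁, h₂⟩ := h; exact (ihf h₁).comp (ihg h₂)
  | tens f g ihf ihg =>
    obtain ⟨_, _, _, _, h₁, h₂, rfl, rfl⟩ := h; exact (ihf h₁).tens (ihg h₂)
  | zero => trivial
  | plus f g ihf ihg => exact ⟨ihf h.1, ihg h.2⟩
  | smul c f ih => exact ih h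

theorem flip_parity {f : P.Diag} {p : ZMod 2} (h : f.HasParity P.par p) :
    (P.flip f).HasParity P.par p := by
  induction f generalizing p with
  | gen g => exact h
  | id Z => exact h
  | comp f g ihf ihg => obtain ⟨q, r, h₁, h₂, h₃⟩ := h; exact ⟨q, r, ihf h₁, ihg h₂, h₃⟩
  | tens f g ihf ihg => obtain ⟨q, r, h₁, h₂, h₃⟩ := h; exact ⟨q, r, ihf h₁, ihg h₂, h₃⟩
  | zero => trivial
  | plus f g ihf ihg => exact ⟨ihf h.1, ihg h.2⟩
  | smul c f ih => exact ih h

theorem flip_of_parity {f : P.Diag} {p : ZMod 2} {X Y : List P.Strand} (h : P.Typed f X Y)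
    (hp : f.HasParity P.par p) : P.Eqv X Y (P.flip f) (smul (superSign k p) f) := by
  induction f generalizing X Y p with
  | gen g => cases hp; exact .refl h
  | id Z => cases hp; simpa [superSign, flip] using (Eqv.one_smul h).symm
  | comp f g ihf ihg =>
    obtain ⟨Z, h₁, h₂⟩ : ∃ Z, P.Typed f X Z ∧ P.Typed g Z Y := h
    obtain ⟨q, r, p₁, p₂, rfl⟩ := hp
    rw [superSign_add]
    exact (Eqv.comp_congr (ihf h₁ p₁) (ihg h₂ p₂)).trans <|
      (Eqv.smul_comp _ h₁ (h₂.smul _)).trans <|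
      (Eqv.smul_congr _ (.comp_smul _ h₁ h₂)).trans (Eqv.mul_smul _ _ (h₁.comp h₂)).symm
  | tens f g ihf ihg =>
    obtain ⟨_, _, _, _, h₁, h₂, rfl, rfl⟩ : ∃ X₁ Y₁ X₂ Y₂, P.Typed f X₁ Y₁ ∧ P.Typed g X₂ Y₂ ∧
      X = X₁ ++ X₂ ∧ Y = Y₁ ++ Y₂ := h
    obtain ⟨q, r, p₁, p₂, rfl⟩ := hp
    rw [superSign_add]
    exact (Eqv.tens_congr (ihf h₁ p₁) (ihg h₂ p₂)).trans <|
      (Eqv.smul_tens _ h₁ (h₂.smul _)).trans <|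
      (Eqv.smul_congr _ (.tens_smul _ h₁ h₂)).trans (Eqv.mul_smul _ _ (h₁.tens h₂)).symm
  | zero =>
    refine (Eqv.zero_smul h).symm.trans <| Eqv.trans ?_ (.smul_congr _ (.zero_smul h))
    simpa using Eqv.mul_smul (superSign k p) 0 h
  | plus f g ihf ihg =>
    exact (Eqv.plus_congr (ihf h.1 hp.1) (ihg h.2 hp.2)).trans (Eqv.smul_plus _ h.1 h.2).symm
  | smul c f ih =>
    have h' : P.Typed f X Y := h
    refine (Eqv.smul_congr c (ih h hp)).trans <| (Eqv.mul_smul _ _ h').symm.trans ?_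
    rw [mul_comm]
    exact .mul_smul _ _ h'

theorem flip_eqv {f g : P.Diag} {X Y : List P.Strand} (h : P.Eqv X Y f g) :
    P.Eqv X Y (P.flip f) (P.flip g) := by
  induction h with
  | rel h =>
    obtain ⟨p, hf, hg⟩ := P.rel_parity h
    obtain ⟨tf, tg⟩ := P.rel_type h
    exact (flip_of_parity tf hf).trans <| (Eqv.smul_congr _ (.rel h)).trans
      (flip_of_parity tg hg).symm
  | refl h => exact .refl (flip_typed h)
  | symm _ ih => exact ih.symm
  | trans _ _ ih₁ ih₂ => exact ih₁.trans ih₂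
  | comp_congr _ _ ih₁ ih₂ => exact .comp_congr ih₁ ih₂
  | tens_congr _ _ ih₁ ih₂ => exact .tens_congr ih₁ ih₂
  | plus_congr _ _ ih₁ ih₂ => exact .plus_congr ih₁ ih₂
  | smul_congr c _ ih => exact .smul_congr c ih
  | plus_assoc hf hg hh => exact .plus_assoc (flip_typed hf) (flip_typed hg) (flip_typed hh)
  | plus_comm hf hg => exact .plus_comm (flip_typed hf) (flip_typed hg)
  | zero_plus hf => exact .zero_plus (flip_typed hf)
  | smul_plus c hf hg => exact .smul_plus c (flip_typed hf) (flip_typed hg)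
  | plus_smul c d hf => exact .plus_smul c d (flip_typed hf)
  | mul_smul c d hf => exact .mul_smul c d (flip_typed hf)
  | one_smul hf => exact .one_smul (flip_typed hf)
  | zero_smul hf => exact .zero_smul (flip_typed hf)
  | plus_comp hf hf' hg => exact .plus_comp (flip_typed hf) (flip_typed hf') (flip_typed hg)
  | comp_plus hf hg hg' => exact .comp_plus (flip_typed hf) (flip_typed hg) (flip_typed hg')
  | smul_comp c hf hg => exact .smul_comp c (flip_typed hf) (flip_typed hg)
  | comp_smul c hf hg => exact .comp_smul c (flip_typed hf) (flip_typed hg)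
  | id_comp hf => exact .id_comp (flip_typed hf)
  | comp_id hf => exact .comp_id (flip_typed hf)
  | comp_assoc hf hg hh => exact .comp_assoc (flip_typed hf) (flip_typed hg) (flip_typed hh)
  | plus_tens hf hf' hg => exact .plus_tens (flip_typed hf) (flip_typed hf') (flip_typed hg)
  | tens_plus hf hg hg' => exact .tens_plus (flip_typed hf) (flip_typed hg) (flip_typed hg')
  | smul_tens c hf hg => exact .smul_tens c (flip_typed hf) (flip_typed hg)
  | tens_smul c hf hg => exact .tens_smul c (flip_typed hf) (flip_typed hg)
  | id_tens_id X Y => exact .id_tens_id X Y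
  | nil_tens hf => exact .nil_tens (flip_typed hf)
  | tens_nil hf => exact .tens_nil (flip_typed hf)
  | tens_assoc hf hg hh => exact .tens_assoc (flip_typed hf) (flip_typed hg) (flip_typed hh)
  | interchange hf hf' hg hg' p₁ p₂ =>
    exact .interchange (flip_typed hf) (flip_typed hf') (flip_typed hg) (flip_typed hg')
      (flip_parity p₁) (flip_parity p₂)

theorem exists_parity_add {X Y : P.Cat} (f : P.Diag) (h : P.Typed f X Y) :
    ∃ a ∈ P.parity X Y 0, ∃ b ∈ P.parity X Y 1, mor f h = a + b := by
  have h2 : (1 : ZMod 2) + 1 = 0 := by decide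
  induction f generalizing X Y with
  | gen g =>
    have hp (p : ZMod 2) : p = 0 ∨ p = 1 := by revert p; decide
    rcases hp (P.par g) with hg | hg
    · exact ⟨mor _ h, ⟨_, h, hg.symm, rfl⟩, 0, zero_mem _, (_root_.add_zero (mor _ h)).symm⟩
    · exact ⟨0, zero_mem _, mor _ h, ⟨_, h, hg.symm, rfl⟩, (_root_.zero_add (mor _ h)).symm⟩
  | id Z => exact ⟨mor _ h, ⟨_, h, rfl, rfl⟩, 0, zero_mem _, (_root_.add_zero (mor _ h)).symm⟩
  | comp f g ihf ihg =>
    obtain ⟨Z, hf, hg⟩ : ∃ Z : P.Cat, P.Typed f X Z ∧ P.Typed g Z Y := h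
    obtain ⟨a, ha, b, hb, e⟩ := ihf (Y := Z) hf
    obtain ⟨c, hc, d, hd, e'⟩ := ihg (X := Z) hg
    refine ⟨a ≫ c + b ≫ d, add_mem (comp_mem ha hc) (h2 ▸ comp_mem hb hd),
      a ≫ d + b ≫ c, add_mem (comp_mem ha hd) (comp_mem hb hc), ?_⟩
    rw [← mor_comp (Y := Z) hf hg, e, e', Preadditive.add_comp, Preadditive.comp_add, Preadditive.comp_add]
    abel
  | tens f g ihf ihg =>
    obtain ⟨X₁, Y₁, X₂, Y₂, hf, hg, rfl, rfl⟩ := h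
    obtain ⟨a, ha, b, hb, e⟩ := ihf (X := X₁) (Y := Y₁) hf
    obtain ⟨c, hc, d, hd, e'⟩ := ihg (X := X₂) (Y := Y₂) hg
    refine ⟨tensorHom a c + tensorHom b d, add_mem (tensor_mem ha hc) (h2 ▸ tensor_mem hb hd),
      tensorHom a d + tensorHom b c, add_mem (tensor_mem ha hd) (tensor_mem hb hc), ?_⟩
    refine (tensor_mor (X := X₁) (Y := Y₁) (X' := X₂) (Y' := Y₂) hf hg).symm.trans ?_
    rw [e, e']
    simp only [map_add, LinearMap.add_apply]
    abel
  | zero => exact ⟨0, zero_mem _, 0, zero_mem _, (_root_.add_zero (0 : X ⟶ Y)).symm⟩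
  | plus f g ihf ihg =>
    obtain ⟨a, ha, b, hb, e⟩ := ihf h.1
    obtain ⟨c, hc, d, hd, e'⟩ := ihg h.2
    refine ⟨a + c, add_mem ha hc, b + d, add_mem hb hd, ?_⟩
    rw [← mor_add h.1 h.2, e, e']
    abel
  | smul c f ih =>
    obtain ⟨a, ha, b, hb, e⟩ := ih h
    exact ⟨c • a, Submodule.smul_mem _ c ha, c • b, Submodule.smul_mem _ c hb, by
      have h' : P.Typed f X Y := h
      rw [← _root_.smul_add, ← e]; exact (smul_mor c h').symm⟩

theorem parity_disjoint [Invertible (2 : k)] (X Y : P.Cat) :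
    Disjoint (P.parity X Y 0) (P.parity X Y 1) := by
  rw [Submodule.disjoint_def]
  rintro _ ⟨f, hf, pf, rfl⟩ ⟨g, hg, pg, e⟩
  have h : P.Eqv X Y (smul (superSign k 0) f) (smul (superSign k 1) g) :=
    (flip_of_parity hf pf).symm.trans <| (flip_eqv (toHom_exact e)).trans (flip_of_parity hg pg)
  have h' : superSign k 0 • mor f hf = superSign k 1 • mor g hg :=
    toHom_eq h
  rw [← (show mor f hf = mor g hg from e)] at h'
  have h'' : (2 : k) • mor f hf = 0 := by
    rw [two_smul]
    nth_rewrite 1 [show mor f hf = superSign k 0 • mor f hf by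
      simp [superSign]]
    rw [h']
    simp [superSign, ZMod.val_one]
  calc mor f hf = (⅟(2 : k) * 2) • mor f hf := by simp
    _ = 0 := by rw [SemigroupAction.mul_smul, h'', smul_zero]

/-- The supercategory presented by `P`. -/
instance [Invertible (2 : k)] : StrictMonoidalSupercategory k P.Cat where
  parity X Y := P.parity X Y
  parity_internal X Y := by
    rw [DirectSum.isInternal_submodule_iff_isCompl (P.parity X Y) (i := 0) (j := 1) (by decide)
      (by ext p; revert p; decide)]
    refine ⟨parity_disjoint X Y, codisjoint_iff.2 (eq_top_iff.2 fun f _ => ?_)⟩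
    obtain ⟨f, hf, rfl⟩ := toHom_surj f
    obtain ⟨a, ha, b, hb, e⟩ := exists_parity_add f hf
    exact Submodule.mem_sup.2 ⟨a, ha, b, hb, e.symm⟩
  id_mem X := ⟨.id X, Typed.id _, rfl, rfl⟩
  comp_mem := comp_mem
  tensor := tensorHom
  tensor_mem := tensor_mem
  id_tensor_id X Y := toHom_eq (.id_tens_id X Y)
  interchange := by
    rintro X Y Z X' Y' Z' p q _ b c _ ⟨f, hf, pf, rfl⟩ ⟨g', hg', pg', rfl⟩
    obtain ⟨f', hf', rfl⟩ := toHom_surj b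
    obtain ⟨g, hg, rfl⟩ := toHom_surj c
    exact toHom_eq (.interchange hf hf' hg hg' pf pg')
  tensor_assoc {X Y X' Y' X'' Y''} a b c := by
    obtain ⟨f, hf, rfl⟩ := toHom_surj a
    obtain ⟨g, hg, rfl⟩ := toHom_surj b
    obtain ⟨h, hh, rfl⟩ := toHom_surj c
    rw [eqToHom_eq, eqToHom_eq]
    have e := Eqv.tens_assoc hf hg hh
    have t := (hf.tens hg).tens hh
    have t' : P.Typed (f ⊠ g ⊠ h) (X * (X' * X'')) (Y * (Y' * Y'')) := hf.tens (hg.tens hh)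
    refine toHom_eq (((Eqv.comp_id t).trans (e.trans ?_)).cast rfl (List.append_assoc ..))
    rw [← mul_assoc, ← mul_assoc] at t'
    exact (Eqv.id_comp t').symm
  one_tensor {X Y} a := by
    obtain ⟨f, hf, rfl⟩ := toHom_surj a
    rw [eqToHom_eq, eqToHom_eq]
    exact toHom_eq ((Eqv.comp_id ((Typed.id []).tens hf)).trans <|
      (Eqv.nil_tens hf).trans (Eqv.id_comp hf).symm)
  tensor_one {X Y} a := by
    obtain ⟨f, hf, rfl⟩ := toHom_surj a
    rw [eqToHom_eq, eqToHom_eq]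
    have t : P.Typed (f ⊠ .id []) (X * 1) (Y * 1) := hf.tens (Typed.id [])
    have e : P.Eqv (X * 1) Y ((f ⊠ .id []) ⨾ .id (Y * 1)) (f ⊠ .id []) :=
      (Eqv.comp_id t).cast rfl (mul_one Y)
    have e' : P.Eqv (X * 1) Y (f ⊠ .id []) f := (Eqv.tens_nil hf).cast (mul_one X).symm rfl
    have t' : P.Typed f (X * 1) Y := hf.cast (mul_one X).symm rfl
    exact toHom_eq (e.trans (e'.trans (Eqv.id_comp t').symm))

end SuperPresentation

set_option linter.unusedSectionVars false

/-! ### Oriented webs of type P -/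

/-- Generating objects: upward and downward strands labelled by positive integers. -/
inductive WebStrand
  | up (a : ℕ+)
  | down (a : ℕ+)

/-- Generating morphisms. Here `split a b : ↑(a+b) ⟶ ↑a ↑b`, `merge a b : ↑a ↑b ⟶ ↑(a+b)`,
`lcap a : ↓a ↑a ⟶ 1` (leftward cap), `lcup a : 1 ⟶ ↑a ↓a` (leftward cup), `tagIn : ↑1 ⟶ ↓1`,
`tagOut : ↓1 ⟶ ↑1` and `rcross a b : ↑a ↓b ⟶ ↓b ↑a` (rightward crossing). The labels may be zero:
strands labelled by zero are deleted, and the relations make the generators with a label zero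
trivial. -/
inductive WebGen
  | split (a b : ℕ)
  | merge (a b : ℕ)
  | lcap (a : ℕ)
  | lcup (a : ℕ)
  | tagIn
  | tagOut
  | rcross (a b : ℕ)

namespace Web

open DiagExpr WebGen

/-- The upward strand labelled `a`, which is deleted if `a = 0`. -/
def u (a : ℕ) : List WebStrand := if h : 0 < a then [.up ⟨a, h⟩] else []

/-- The downward strand labelled `a`, which is deleted if `a = 0`. -/
def d (a : ℕ) : List WebStrand := if h : 0 < a then [.down ⟨a, h⟩] else []

/-- The source of a generator. -/
def src : WebGen → List WebStrand
  | split a b => u (a + b)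
  | merge a b => u a ++ u b
  | lcap a => d a ++ u a
  | lcup _ => []
  | tagIn => u 1
  | tagOut => d 1
  | rcross a b => u a ++ d b

/-- The target of a generator. -/
def tgt : WebGen → List WebStrand
  | split a b => u a ++ u b
  | merge a b => u (a + b)
  | lcap _ => []
  | lcup a => u a ++ d a
  | tagIn => d 1
  | tagOut => u 1
  | rcross a b => d b ++ u a

/-- The parity of a generator: the tags are odd, everything else is even. -/
def par : WebGen → ZMod 2
  | tagIn => 1
  | tagOut => 1
  | _ => 0

variable (k : Type*) [CommRing k]

/-- Expressions in the generators. -/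
abbrev Ex := DiagExpr k WebStrand WebGen

variable {k}

/-- The odd cap `↑1 ↑1 ⟶ 1`. -/
def upCap : Ex k := (gen tagIn ⊠ .id (u 1)) ⨾ gen (lcap 1)

/-- The odd cup `1 ⟶ ↑1 ↑1`. -/
def upCup : Ex k := gen (lcup 1) ⨾ (.id (u 1) ⊠ gen tagOut)

/-- The antenna `↑2 ⟶ 1`. -/
def antenna [Invertible (2 : k)] : Ex k := smul (⅟(2 : k)) (gen (split 1 1) ⨾ upCap)

/-- The rung of thickness `s` from the left to the right strand:
`↑a ↑b ⟶ ↑(a-s) ↑(b+s)`, for `s ≤ a`. -/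
def rungR (a b s : ℕ) : Ex k :=
  (gen (split (a - s) s) ⊠ .id (u b)) ⨾ (.id (u (a - s)) ⊠ gen (merge s b))

/-- The rung of thickness `r` from the right to the left strand:
`↑a ↑b ⟶ ↑(a+r) ↑(b-r)`, for `r ≤ b`. -/
def rungL (a b r : ℕ) : Ex k :=
  (.id (u a) ⊠ gen (split r (b - r))) ⨾ (gen (merge a r) ⊠ .id (u (b - r)))

/-- The cap of thickness one between two strands: `↑a ↑b ⟶ ↑(a-1) ↑(b-1)`, for `a, b ≥ 1`. -/
def capRung (a b : ℕ) : Ex k :=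
  (gen (split (a - 1) 1) ⊠ gen (split 1 (b - 1))) ⨾ (.id (u (a - 1)) ⊠ upCap ⊠ .id (u (b - 1)))

/-- The cup of thickness one between two strands: `↑a ↑b ⟶ ↑(a+1) ↑(b+1)`. -/
def cupRung (a b : ℕ) : Ex k :=
  (.id (u a) ⊠ upCup ⊠ .id (u b)) ⨾ (gen (merge a 1) ⊠ gen (merge 1 b))

/-- The upward crossing `↑a ↑b ⟶ ↑b ↑a`: the alternating sum
`∑ (-1) ^ (a - s) rungL r ∘ rungR s` over all `r, s ≥ 0` with `s - r = a - b` and `s ≤ a`. -/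
def crossUp (a b : ℕ) : Ex k :=
  sum ((List.range (a + 1)).map fun s =>
    onlyIf (a ≤ s + b) (smul ((-1) ^ (a - s)) (rungR a b s ⨾ rungL (a - s) (b + s) (s + b - a))))

/-- The leftward crossing `↓a ↑b ⟶ ↑b ↓a`. -/
def crossLeft (a b : ℕ) : Ex k :=
  (.id (d a ++ u b) ⊠ gen (lcup a)) ⨾ (.id (d a) ⊠ crossUp b a ⊠ .id (d a)) ⨾
    (gen (lcap a) ⊠ .id (u b ++ d a))

/-- The downward crossing `↓a ↓b ⟶ ↓b ↓a`. -/
def crossDown (a b : ℕ) : Ex k :=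
  (.id (d a ++ d b) ⊠ (gen (lcup a) ⨾ (.id (u a) ⊠ gen (lcup b) ⊠ .id (d a)))) ⨾
    (.id (d a ++ d b) ⊠ crossUp a b ⊠ .id (d b ++ d a)) ⨾
    (((.id (d a) ⊠ gen (lcap b) ⊠ .id (u a)) ⨾ gen (lcap a)) ⊠ .id (d b ++ d a))

/-- The rightward cap `↑a ↓a ⟶ 1`. -/
def rcap (a : ℕ) : Ex k := gen (rcross a a) ⨾ gen (lcap a)

/-- The rightward cup `1 ⟶ ↓a ↑a`. -/
def rcup (a : ℕ) : Ex k := gen (lcup a) ⨾ gen (rcross a a)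

/-- The defining relations. -/
inductive Rel [Invertible (2 : k)] :
    List WebStrand → List WebStrand → Ex k → Ex k → Prop
  -- strands labelled by zero are deleted
  | split_zero_left (a : ℕ) : Rel (u a) (u a) (gen (split 0 a)) (.id (u a))
  | split_zero_right (a : ℕ) : Rel (u a) (u a) (gen (split a 0)) (.id (u a))
  | merge_zero_left (a : ℕ) : Rel (u a) (u a) (gen (merge 0 a)) (.id (u a))
  | merge_zero_right (a : ℕ) : Rel (u a) (u a) (gen (merge a 0)) (.id (u a))
  | lcap_zero : Rel [] [] (gen (lcap 0)) (.id [])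
  | lcup_zero : Rel [] [] (gen (lcup 0)) (.id [])
  | rcross_zero_left (a : ℕ) : Rel (d a) (d a) (gen (rcross 0 a)) (.id (d a))
  | rcross_zero_right (a : ℕ) : Rel (u a) (u a) (gen (rcross a 0)) (.id (u a))
  -- (co)associativity
  | split_assoc (a b c : ℕ) : Rel (u (a + b + c)) (u a ++ u b ++ u c)
      (gen (split (a + b) c) ⨾ (gen (split a b) ⊠ .id (u c)))
      (gen (split a (b + c)) ⨾ (.id (u a) ⊠ gen (split b c)))
  | merge_assoc (a b c : ℕ) : Rel (u a ++ u b ++ u c) (u (a + b + c))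
      ((gen (merge a b) ⊠ .id (u c)) ⨾ gen (merge (a + b) c))
      ((.id (u a) ⊠ gen (merge b c)) ⨾ gen (merge a (b + c)))
  -- opposite rungs; diagrams with a strand labelled by a negative integer are zero
  | rung_swap (a b r s : ℕ) : s ≤ a + r → r ≤ b + s →
      Rel (u a ++ u b) (u (a + r - s) ++ u (b + s - r))
        (onlyIf (s ≤ a) (rungR a b s ⨾ rungL (a - s) (b + s) r))
        (sum ((List.range (min r s + 1)).map fun t => onlyIf (r - t ≤ b)
          (smul ((Ring.choose ((a : ℤ) - b + r - s) t : ℤ) : k)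
            (rungL a b (r - t) ⨾ rungR (a + (r - t)) (b - (r - t)) (s - t)))))
  -- the odd cap and cup
  | straighten_right : Rel (u 1) (u 1)
      ((upCup ⊠ .id (u 1)) ⨾ (.id (u 1) ⊠ upCap)) (.id (u 1))
  | straighten_left : Rel (u 1) (u 1)
      ((.id (u 1) ⊠ upCup) ⨾ (upCap ⊠ .id (u 1))) (smul (-1) (.id (u 1)))
  | merge_antenna : Rel (u 1 ++ u 1) [] (gen (merge 1 1) ⨾ antenna) upCap
  | cap_rungR (a b r : ℕ) : r + 1 ≤ a → 1 ≤ b + r →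
      Rel (u a ++ u b) (u (a - r - 1) ++ u (b + r - 1))
        (rungR a b r ⨾ capRung (a - r) (b + r))
        (plus (onlyIf (1 ≤ b) (capRung a b ⨾ rungR (a - 1) (b - 1) r))
          (smul 2 (onlyIf (1 ≤ r) ((gen (split (a - 2) 2) ⊠ .id (u b)) ⨾
            (.id (u (a - 2)) ⊠ antenna ⊠ .id (u b)) ⨾ rungR (a - 2) b (r - 1)))))
  | cap_rungL (a b r : ℕ) : r + 1 ≤ b → 1 ≤ a + r →
      Rel (u a ++ u b) (u (a + r - 1) ++ u (b - r - 1))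
        (rungL a b r ⨾ capRung (a + r) (b - r))
        (plus (onlyIf (1 ≤ a) (capRung a b ⨾ rungL (a - 1) (b - 1) r))
          (smul 2 (onlyIf (1 ≤ r) ((.id (u a) ⊠ gen (split 2 (b - 2))) ⨾
            (.id (u a) ⊠ antenna ⊠ .id (u (b - 2))) ⨾ rungL a (b - 2) (r - 1)))))
  | cup_rungR (a b r : ℕ) : r ≤ a + 1 →
      Rel (u a ++ u b) (u (a + 1 - r) ++ u (b + 1 + r))
        (cupRung a b ⨾ rungR (a + 1) (b + 1) r)
        (onlyIf (r ≤ a) (rungR a b r ⨾ cupRung (a - r) (b + r)))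
  | cup_rungL (a b r : ℕ) : r ≤ b + 1 →
      Rel (u a ++ u b) (u (a + 1 + r) ++ u (b + 1 - r))
        (cupRung a b ⨾ rungL (a + 1) (b + 1) r)
        (onlyIf (r ≤ b) (rungL a b r ⨾ cupRung (a + r) (b - r)))
  -- leftward caps and cups, and the rightward crossing
  | zigzag_up (a : ℕ) : Rel (u a) (u a)
      ((gen (lcup a) ⊠ .id (u a)) ⨾ (.id (u a) ⊠ gen (lcap a))) (.id (u a))
  | zigzag_down (a : ℕ) : Rel (d a) (d a)
      ((.id (d a) ⊠ gen (lcup a)) ⨾ (gen (lcap a) ⊠ .id (d a))) (.id (d a))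
  | left_right (a b : ℕ) : Rel (d a ++ u b) (d a ++ u b)
      (crossLeft a b ⨾ gen (rcross b a)) (.id (d a ++ u b))
  | right_left (a b : ℕ) : Rel (u a ++ d b) (u a ++ d b)
      (gen (rcross a b) ⨾ crossLeft b a) (.id (u a ++ d b))
  | bubble (a : ℕ) : 0 < a → Rel [] [] (gen (lcup a) ⨾ gen (rcross a a) ⨾ gen (lcap a)) zero

/-! The relations are well-formed and homogeneous. -/

/-- `f` is a well-formed expression for a morphism `X ⟶ Y`. -/
abbrev WT (f : Ex k) (X Y : List WebStrand) : Prop := f.HasType src tgt X Y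

/-- `f` is homogeneous of parity `p`. -/
abbrev HP (f : Ex k) (p : ZMod 2) : Prop := f.HasParity par p

section Typing

variable {f g : Ex k} {X Y Z X' Y' : List WebStrand}

theorem u_zero : u 0 = [] := rfl
theorem d_zero : d 0 = [] := rfl
theorem u_coe (a : ℕ+) : u a = [.up a] := dif_pos a.pos
theorem d_coe (a : ℕ+) : d a = [.down a] := dif_pos a.pos

theorem WT.cast (h : WT f X Y) (hX : X = X') (hY : Y = Y') : WT f X' Y' := hX ▸ hY ▸ h

theorem WT.id (X : List WebStrand) : WT (k := k) (.id X) X X := ⟨rfl, rfl⟩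

theorem WT.comp (hf : WT f X Y) (hg : WT g Y Z) : WT (f ⨾ g) X Z := ⟨Y, hf, hg⟩

theorem WT.tens (hf : WT f X Y) (hg : WT g X' Y') : WT (f ⊠ g) (X ++ X') (Y ++ Y') :=
  ⟨X, Y, X', Y', hf, hg, rfl, rfl⟩

theorem WT.gen (x : WebGen) : WT (k := k) (.gen x) (src x) (tgt x) := ⟨rfl, rfl⟩

theorem WT.onlyIf {c : Prop} [Decidable c] (h : c → WT f X Y) : WT (.onlyIf c f) X Y := by
  unfold DiagExpr.onlyIf
  split_ifs with hc
  · exact h hc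
  · trivial

theorem WT.sum {l : List (Ex k)} (h : ∀ f ∈ l, WT f X Y) : WT (.sum l) X Y := by
  induction l with
  | nil => trivial
  | cons f l ih => exact ⟨h f (by simp), ih fun g hg => h g (by simp [hg])⟩

theorem HP.onlyIf {c : Prop} [Decidable c] {p : ZMod 2} (h : HP f p) : HP (.onlyIf c f) p := by
  unfold DiagExpr.onlyIf
  split_ifs
  · exact h
  · trivial

theorem HP.sum {l : List (Ex k)} {p : ZMod 2} (h : ∀ f ∈ l, HP f p) : HP (.sum l) p := by
  induction l with
  | nil => trivial
  | cons f l ih => exact ⟨h f (by simp), ih fun g hg => h g (by simp [hg])⟩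

theorem wt_upCap : WT (k := k) upCap (u 1 ++ u 1) [] :=
  ((WT.gen tagIn).tens (.id _)).comp (.gen (lcap 1))

theorem wt_upCup : WT (k := k) upCup [] (u 1 ++ u 1) :=
  (WT.gen (lcup 1)).comp ((WT.id _).tens (.gen tagOut))

theorem wt_antenna [Invertible (2 : k)] : WT (k := k) antenna (u 2) [] :=
  (WT.gen (split 1 1)).comp wt_upCap

theorem wt_rungR (a b s : ℕ) {c e : ℕ} (h : s ≤ a) (hc : c = a - s) (he : e = b + s) :
    WT (k := k) (rungR a b s) (u a ++ u b) (u c ++ u e) := by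
  obtain rfl : e = s + b := by omega
  subst hc
  have h₁ := ((WT.gen (k := k) (split (a - s) s)).tens (.id (u b)))
  have h₂ := (WT.id (k := k) (u (a - s))).tens (.gen (merge s b))
  refine WT.comp (h₁.cast ?_ (List.append_assoc ..)) h₂
  simp [src, Nat.sub_add_cancel h]

theorem wt_rungL (a b r : ℕ) {c e : ℕ} (h : r ≤ b) (hc : c = a + r) (he : e = b - r) :
    WT (k := k) (rungL a b r) (u a ++ u b) (u c ++ u e) := by
  subst hc he
  have h₁ := (WT.id (k := k) (u a)).tens (.gen (split r (b - r)))
  have h₂ := ((WT.gen (k := k) (merge a r)).tens (.id (u (b - r))))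
  refine WT.comp (h₁.cast ?_ (List.append_assoc ..).symm) h₂
  simp [src, Nat.add_sub_cancel' h]

theorem wt_capRung (a b : ℕ) {c e : ℕ} (ha : a = c + 1) (hb : b = e + 1) :
    WT (k := k) (capRung a b) (u a ++ u b) (u c ++ u e) := by
  subst ha hb
  have h₁ := (WT.gen (k := k) (split c 1)).tens (.gen (split 1 e))
  have h₂ := (WT.id (u c)).tens ((wt_upCap (k := k)).tens (.id (u e)))
  refine WT.comp (h₁.cast ?_ rfl) (h₂.cast ?_ rfl)
  · simp [src, Nat.add_comm]
  · simp [tgt]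

theorem wt_cupRung (a b : ℕ) {c e : ℕ} (hc : c = a + 1) (he : e = b + 1) :
    WT (k := k) (cupRung a b) (u a ++ u b) (u c ++ u e) := by
  subst hc he
  have h₁ := (WT.id (u a)).tens ((wt_upCup (k := k)).tens (.id (u b)))
  have h₂ := (WT.gen (k := k) (merge a 1)).tens (.gen (merge 1 b))
  refine WT.comp (h₁.cast rfl ?_) (h₂.cast rfl ?_)
  · simp [src]
  · simp [tgt, Nat.add_comm]

theorem wt_crossUp (a b : ℕ) : WT (k := k) (crossUp a b) (u a ++ u b) (u b ++ u a) := by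
  refine WT.sum fun f hf => ?_
  obtain ⟨s, hs, rfl⟩ := List.mem_map.1 hf
  rw [List.mem_range] at hs
  refine WT.onlyIf fun h => ?_
  exact WT.comp (wt_rungR a b s (by omega) rfl rfl)
    (wt_rungL _ _ _ (by omega) (by omega) (by omega))

theorem wt_crossLeft (a b : ℕ) : WT (k := k) (crossLeft a b) (d a ++ u b) (u b ++ d a) := by
  have h₁ := (WT.id (k := k) (d a ++ u b)).tens (.gen (lcup a))
  have h₂ := (WT.id (d a)).tens ((wt_crossUp (k := k) b a).tens (.id (d a)))
  have h₃ := (WT.gen (k := k) (lcap a)).tens (.id (u b ++ d a))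
  exact WT.comp (h₁.cast (by simp [src]) rfl)
    (WT.comp (h₂.cast (by simp [tgt]) rfl) (h₃.cast (by simp [src]) (by simp [tgt])))

theorem wt_crossDown (a b : ℕ) : WT (k := k) (crossDown a b) (d a ++ d b) (d b ++ d a) := by
  have h₀ := WT.comp (WT.gen (k := k) (lcup a)) (((WT.id (u a)).tens
    ((WT.gen (lcup b)).tens (.id (d a)))).cast (by simp [src, tgt]) rfl)
  have h₁ := (WT.id (k := k) (d a ++ d b)).tens h₀
  have h₂ := (WT.id (d a ++ d b)).tens ((wt_crossUp (k := k) a b).tens (.id (d b ++ d a)))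
  have h₃ := WT.comp ((WT.id (k := k) (d a)).tens ((WT.gen (lcap b)).tens (.id (u a))))
    ((WT.gen (lcap a)).cast (by simp [src, tgt]) rfl)
  have h₄ := h₃.tens (.id (d b ++ d a))
  exact WT.comp (h₁.cast (by simp [src]) rfl)
    (WT.comp (h₂.cast (by simp [tgt]) rfl) (h₄.cast (by simp [src]) (by simp [tgt])))

theorem wt_rcap (a : ℕ) : WT (k := k) (rcap a) (u a ++ d a) [] :=
  (WT.gen (rcross a a)).comp (.gen (lcap a))

theorem wt_rcup (a : ℕ) : WT (k := k) (rcup a) [] (d a ++ u a) :=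
  (WT.gen (lcup a)).comp (.gen (rcross a a))

theorem HP.comp {p q r : ZMod 2} (hf : HP f p) (hg : HP g q) (h : r = p + q) : HP (f ⨾ g) r :=
  ⟨p, q, hf, hg, h⟩

theorem HP.tens {p q r : ZMod 2} (hf : HP f p) (hg : HP g q) (h : r = p + q) : HP (f ⊠ g) r :=
  ⟨p, q, hf, hg, h⟩

theorem hp_id (X : List WebStrand) : HP (k := k) (.id X) 0 := rfl

theorem hp_upCap : HP (k := k) upCap 1 :=
  .comp (p := 1) (q := 0) (.tens (p := 1) (q := 0) rfl rfl rfl) rfl rfl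

theorem hp_upCup : HP (k := k) upCup 1 :=
  .comp (p := 0) (q := 1) rfl (.tens (p := 0) (q := 1) rfl rfl rfl) rfl

theorem hp_antenna [Invertible (2 : k)] : HP (k := k) antenna 1 :=
  HP.comp (p := 0) (q := 1) rfl hp_upCap rfl

theorem hp_rungR (a b s : ℕ) : HP (k := k) (rungR a b s) 0 :=
  .comp (p := 0) (q := 0) (.tens (p := 0) (q := 0) rfl rfl rfl)
    (.tens (p := 0) (q := 0) rfl rfl rfl) rfl

theorem hp_rungL (a b r : ℕ) : HP (k := k) (rungL a b r) 0 :=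
  .comp (p := 0) (q := 0) (.tens (p := 0) (q := 0) rfl rfl rfl)
    (.tens (p := 0) (q := 0) rfl rfl rfl) rfl

theorem hp_capRung (a b : ℕ) : HP (k := k) (capRung a b) 1 :=
  .comp (p := 0) (q := 1) (.tens (p := 0) (q := 0) rfl rfl rfl)
    (.tens (p := 0) (q := 1) rfl (.tens (p := 1) (q := 0) hp_upCap rfl rfl) rfl) rfl

theorem hp_cupRung (a b : ℕ) : HP (k := k) (cupRung a b) 1 :=
  .comp (p := 1) (q := 0) (.tens (p := 0) (q := 1) rfl
    (.tens (p := 1) (q := 0) hp_upCup rfl rfl) rfl) (.tens (p := 0) (q := 0) rfl rfl rfl) rfl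

theorem hp_crossUp (a b : ℕ) : HP (k := k) (crossUp a b) 0 := by
  refine HP.sum fun f hf => ?_
  obtain ⟨s, -, rfl⟩ := List.mem_map.1 hf
  exact HP.onlyIf (HP.comp (p := 0) (q := 0) (hp_rungR ..) (hp_rungL ..) rfl)

theorem hp_crossLeft (a b : ℕ) : HP (k := k) (crossLeft a b) 0 :=
  .comp (p := 0) (q := 0) (.tens (p := 0) (q := 0) rfl rfl rfl)
    (.comp (p := 0) (q := 0) (.tens (p := 0) (q := 0) rfl
      (.tens (p := 0) (q := 0) (hp_crossUp ..) rfl rfl) rfl)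
      (.tens (p := 0) (q := 0) rfl rfl rfl) rfl) rfl

end Typing

theorem Rel.wt [Invertible (2 : k)] {X Y : List WebStrand} {f g : Ex k} (h : Rel X Y f g) :
    WT f X Y ∧ WT g X Y := by
  induction h with
  | split_zero_left a => exact ⟨(WT.gen _).cast (by simp [src]) (by simp [tgt, u_zero]), .id _⟩
  | split_zero_right a => exact ⟨(WT.gen _).cast (by simp [src]) (by simp [tgt, u_zero]), .id _⟩
  | merge_zero_left a => exact ⟨(WT.gen _).cast (by simp [src, u_zero]) (by simp [tgt]), .id _⟩
  | merge_zero_right a => exact ⟨(WT.gen _).cast (by simp [src, u_zero]) (by simp [tgt]), .id _⟩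
  | lcap_zero => exact ⟨WT.gen _, .id _⟩
  | lcup_zero => exact ⟨WT.gen _, .id _⟩
  | rcross_zero_left a =>
    exact ⟨(WT.gen _).cast (by simp [src, u_zero]) (by simp [tgt, u_zero]), .id _⟩
  | rcross_zero_right a =>
    exact ⟨(WT.gen _).cast (by simp [src, d_zero]) (by simp [tgt, d_zero]), .id _⟩
  | split_assoc a b c =>
    refine ⟨(WT.gen (split (a + b) c)).comp ((WT.gen (split a b)).tens (.id _)), ?_⟩
    exact WT.comp ((WT.gen _).cast (by simp [src, Nat.add_assoc]) rfl)
      (((WT.id _).tens (WT.gen (split b c))).cast rfl (by simp [tgt]))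
  | merge_assoc a b c =>
    refine ⟨((WT.gen (merge a b)).tens (.id _)).comp (WT.gen (merge (a + b) c)), ?_⟩
    exact WT.comp (((WT.id _).tens (WT.gen (merge b c))).cast (by simp [src]) rfl)
      ((WT.gen _).cast rfl (by simp [tgt, Nat.add_assoc]))
  | rung_swap a b r s h₁ h₂ =>
    constructor
    · refine WT.onlyIf fun h => ?_
      exact (wt_rungR a b s h rfl rfl).comp (wt_rungL _ _ _ h₂ (by omega) (by omega))
    · refine WT.sum fun f hf => ?_
      obtain ⟨t, ht, rfl⟩ := List.mem_map.1 hf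
      rw [List.mem_range] at ht
      refine WT.onlyIf fun h => ?_
      exact WT.comp (wt_rungL a b _ h rfl rfl) (wt_rungR _ _ _ (by omega) (by omega) (by omega))
  | straighten_right =>
    have h₁ := (wt_upCup (k := k)).tens (.id (u 1))
    have h₂ := (WT.id (u 1)).tens (wt_upCap (k := k))
    exact ⟨h₁.comp h₂, .id _⟩
  | straighten_left =>
    have h₁ := (WT.id (u 1)).tens (wt_upCup (k := k))
    have h₂ := (wt_upCap (k := k)).tens (.id (u 1))
    exact ⟨h₁.comp h₂, WT.id (k := k) (u 1)⟩
  | merge_antenna => exact ⟨(WT.gen (merge 1 1)).comp wt_antenna, wt_upCap⟩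
  | cap_rungR a b r h₁ h₂ =>
    refine ⟨(wt_rungR a b r (by omega) rfl rfl).comp (wt_capRung _ _ (by omega) (by omega)),
      WT.onlyIf fun h => ?_, WT.onlyIf fun h => ?_⟩
    · exact (wt_capRung a b (c := a - 1) (e := b - 1) (by omega) (by omega)).comp
        (wt_rungR _ _ _ (by omega) (by omega) (by omega))
    · have t₁ := (WT.gen (k := k) (split (a - 2) 2)).tens (.id (u b))
      have t₂ := (WT.id (u (a - 2))).tens ((wt_antenna (k := k)).tens (.id (u b)))
      have e : a - 2 + 2 = a := by omega
      exact WT.comp (t₁.cast (by simp [src, e]) rfl) (WT.comp (t₂.cast (by simp [tgt]) rfl)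
        (wt_rungR _ _ _ (by omega) (by omega) (by omega)))
  | cap_rungL a b r h₁ h₂ =>
    refine ⟨(wt_rungL a b r (by omega) rfl rfl).comp (wt_capRung _ _ (by omega) (by omega)),
      WT.onlyIf fun h => ?_, WT.onlyIf fun h => ?_⟩
    · exact (wt_capRung a b (c := a - 1) (e := b - 1) (by omega) (by omega)).comp
        (wt_rungL _ _ _ (by omega) (by omega) (by omega))
    · have t₁ := (WT.id (u a)).tens (WT.gen (k := k) (split 2 (b - 2)))
      have t₂ := (WT.id (u a)).tens ((wt_antenna (k := k)).tens (.id (u (b - 2))))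
      have e : 2 + (b - 2) = b := by omega
      exact WT.comp (t₁.cast (by simp [src, e]) rfl) (WT.comp (t₂.cast (by simp [tgt]) rfl)
        (wt_rungL _ _ _ (by omega) (by omega) (by omega)))
  | cup_rungR a b r h =>
    refine ⟨(wt_cupRung a b rfl rfl).comp (wt_rungR _ _ _ (by omega) (by omega) (by omega)),
      WT.onlyIf fun h => ?_⟩
    exact (wt_rungR a b r h rfl rfl).comp (wt_cupRung _ _ (by omega) (by omega))
  | cup_rungL a b r h =>
    refine ⟨(wt_cupRung a b rfl rfl).comp (wt_rungL _ _ _ (by omega) (by omega) (by omega)),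
      WT.onlyIf fun h => ?_⟩
    exact (wt_rungL a b r h rfl rfl).comp (wt_cupRung _ _ (by omega) (by omega))
  | zigzag_up a =>
    have h₁ := (WT.gen (k := k) (lcup a)).tens (.id (u a))
    have h₂ := (WT.id (u a)).tens (WT.gen (k := k) (lcap a))
    exact ⟨WT.comp h₁ (h₂.cast (by simp [src, tgt]) (by simp [tgt])), .id _⟩
  | zigzag_down a =>
    have h₁ := (WT.id (d a)).tens (WT.gen (k := k) (lcup a))
    have h₂ := (WT.gen (k := k) (lcap a)).tens (.id (d a))
    exact ⟨WT.comp (h₁.cast (by simp [src]) rfl) (h₂.cast (by simp [src, tgt]) rfl), .id _⟩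
  | left_right a b => exact ⟨(wt_crossLeft a b).comp (.gen (rcross b a)), .id _⟩
  | right_left a b => exact ⟨(WT.gen (rcross a b)).comp (wt_crossLeft b a), .id _⟩
  | bubble a _ =>
    exact ⟨(WT.gen (lcup a)).comp ((WT.gen (rcross a a)).comp (.gen (lcap a))), trivial⟩

theorem Rel.hp [Invertible (2 : k)] {X Y : List WebStrand} {f g : Ex k} (h : Rel X Y f g) :
    ∃ p, HP f p ∧ HP g p := by
  have c {f g : Ex k} (hf : HP f 0) (hg : HP g 0) : HP (f ⨾ g) 0 := hf.comp hg rfl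
  have c₁ {f g : Ex k} (hf : HP f 1) (hg : HP g 0) : HP (f ⨾ g) 1 := hf.comp hg rfl
  have c₂ {f g : Ex k} (hf : HP f 0) (hg : HP g 1) : HP (f ⨾ g) 1 := hf.comp hg rfl
  have c₃ {f g : Ex k} (hf : HP f 1) (hg : HP g 1) : HP (f ⨾ g) 0 := hf.comp hg rfl
  have t {f g : Ex k} (hf : HP f 0) (hg : HP g 0) : HP (f ⊠ g) 0 := hf.tens hg rfl
  have t₁ {f g : Ex k} (hf : HP f 1) (hg : HP g 0) : HP (f ⊠ g) 1 := hf.tens hg rfl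
  have t₂ {f g : Ex k} (hf : HP f 0) (hg : HP g 1) : HP (f ⊠ g) 1 := hf.tens hg rfl
  induction h with
  | split_zero_left a => exact ⟨0, rfl, rfl⟩
  | split_zero_right a => exact ⟨0, rfl, rfl⟩
  | merge_zero_left a => exact ⟨0, rfl, rfl⟩
  | merge_zero_right a => exact ⟨0, rfl, rfl⟩
  | lcap_zero => exact ⟨0, rfl, rfl⟩
  | lcup_zero => exact ⟨0, rfl, rfl⟩
  | rcross_zero_left a => exact ⟨0, rfl, rfl⟩
  | rcross_zero_right a => exact ⟨0, rfl, rfl⟩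
  | split_assoc => exact ⟨0, c rfl (t rfl rfl), c rfl (t rfl rfl)⟩
  | merge_assoc => exact ⟨0, c (t rfl rfl) rfl, c (t rfl rfl) rfl⟩
  | rung_swap a b r s =>
    refine ⟨0, HP.onlyIf (c (hp_rungR ..) (hp_rungL ..)), HP.sum fun f hf => ?_⟩
    obtain ⟨t, -, rfl⟩ := List.mem_map.1 hf
    exact HP.onlyIf (c (hp_rungL ..) (hp_rungR ..))
  | straighten_right => exact ⟨0, c₃ (t₁ hp_upCup rfl) (t₂ rfl hp_upCap), rfl⟩
  | straighten_left => exact ⟨0, c₃ (t₂ rfl hp_upCup) (t₁ hp_upCap rfl), rfl⟩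
  | merge_antenna => exact ⟨1, c₂ rfl hp_antenna, hp_upCap⟩
  | cap_rungR =>
    exact ⟨1, c₂ (hp_rungR ..) (hp_capRung ..), HP.onlyIf (c₁ (hp_capRung ..) (hp_rungR ..)),
      HP.onlyIf (c₂ (t rfl rfl) (c₁ (t₂ rfl (t₁ hp_antenna rfl)) (hp_rungR ..)))⟩
  | cap_rungL =>
    exact ⟨1, c₂ (hp_rungL ..) (hp_capRung ..), HP.onlyIf (c₁ (hp_capRung ..) (hp_rungL ..)),
      HP.onlyIf (c₂ (t rfl rfl) (c₁ (t₂ rfl (t₁ hp_antenna rfl)) (hp_rungL ..)))⟩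
  | cup_rungR =>
    exact ⟨1, c₁ (hp_cupRung ..) (hp_rungR ..), HP.onlyIf (c₂ (hp_rungR ..) (hp_cupRung ..))⟩
  | cup_rungL =>
    exact ⟨1, c₁ (hp_cupRung ..) (hp_rungL ..), HP.onlyIf (c₂ (hp_rungL ..) (hp_cupRung ..))⟩
  | zigzag_up => exact ⟨0, c (t rfl rfl) (t rfl rfl), rfl⟩
  | zigzag_down => exact ⟨0, c (t rfl rfl) (t rfl rfl), rfl⟩
  | left_right => exact ⟨0, c (hp_crossLeft ..) rfl, rfl⟩
  | right_left => exact ⟨0, c rfl (hp_crossLeft ..), rfl⟩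
  | bubble => exact ⟨0, c rfl (c rfl rfl), trivial⟩

variable (k) in
/-- The presentation of the category of oriented webs of type P. -/
def presentation [Invertible (2 : k)] : SuperPresentation k where
  Strand := WebStrand
  Gen := WebGen
  src := src
  tgt := tgt
  par := par
  rel := Rel
  rel_type := Rel.wt
  rel_parity := Rel.hp

/-! Crossings and rainbows for arbitrary words. -/

/-- The crossing of two strands. -/
def crossStrand : WebStrand → WebStrand → Ex k
  | .up a, .up b => crossUp a b
  | .up a, .down b => gen (rcross a b)
  | .down a, .up b => crossLeft a b
  | .down a, .down b => crossDown a b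

/-- The crossing `x Y ⟶ Y x` of a strand with a word. -/
def crossOne (x : WebStrand) : List WebStrand → Ex k
  | [] => .id [x]
  | y :: Y => (crossStrand x y ⊠ .id Y) ⨾ (.id [y] ⊠ crossOne x Y)

/-- The crossing `X Y ⟶ Y X` of two words. -/
def crossWord : List WebStrand → List WebStrand → Ex k
  | [], Y => .id Y
  | x :: X, Y => (.id [x] ⊠ crossWord X Y) ⨾ (crossOne x Y ⊠ .id X)

/-- The strand with the opposite orientation. -/
def dualStrand : WebStrand → WebStrand
  | .up a => .down a
  | .down a => .up a

/-- The dual of a word: all orientations and the order of the letters are reversed. -/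
def dualWord : List WebStrand → List WebStrand
  | [] => []
  | x :: X => dualWord X ++ [dualStrand x]

/-- The cap `x* x ⟶ 1`: leftward if `x` is upward, rightward if `x` is downward. -/
def evStrand : WebStrand → Ex k
  | .up a => gen (lcap a)
  | .down a => rcap a

/-- The cup `1 ⟶ x x*`: leftward if `x` is upward, rightward if `x` is downward. -/
def coevStrand : WebStrand → Ex k
  | .up a => gen (lcup a)
  | .down a => rcup a

/-- The rainbow of caps `X* X ⟶ 1`. -/
def evWord : List WebStrand → Ex k
  | [] => .id []
  | x :: X => (.id (dualWord X) ⊠ evStrand x ⊠ .id X) ⨾ evWord X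

/-- The rainbow of cups `1 ⟶ X X*`. -/
def coevWord : List WebStrand → Ex k
  | [] => .id []
  | x :: X => coevStrand x ⨾ (.id [x] ⊠ coevWord X ⊠ .id [dualStrand x])

/-- The rainbow of caps `X X* ⟶ 1`. -/
def evWord' : List WebStrand → Ex k
  | [] => .id []
  | x :: X => (.id [x] ⊠ evWord' X ⊠ .id [dualStrand x]) ⨾ evStrand (dualStrand x)

/-- The rainbow of cups `1 ⟶ X* X`. -/
def coevWord' : List WebStrand → Ex k
  | [] => .id []
  | x :: X => coevWord' X ⨾ (.id (dualWord X) ⊠ coevStrand (dualStrand x) ⊠ .id X)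

theorem wt_crossStrand (x y : WebStrand) : WT (k := k) (crossStrand x y) [x, y] [y, x] := by
  cases x <;> cases y
  · exact (wt_crossUp _ _).cast (by simp [u_coe]) (by simp [u_coe])
  · exact (WT.gen _).cast (by simp [src, u_coe, d_coe]) (by simp [tgt, u_coe, d_coe])
  · exact (wt_crossLeft _ _).cast (by simp [u_coe, d_coe]) (by simp [u_coe, d_coe])
  · exact (wt_crossDown _ _).cast (by simp [d_coe]) (by simp [d_coe])

theorem wt_crossOne (x : WebStrand) (Y : List WebStrand) :
    WT (k := k) (crossOne x Y) ([x] ++ Y) (Y ++ [x]) := by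
  induction Y with
  | nil => exact WT.id _
  | cons y Y ih => exact ((wt_crossStrand x y).tens (.id Y)).comp ((WT.id [y]).tens ih)

theorem wt_crossWord (X Y : List WebStrand) : WT (k := k) (crossWord X Y) (X ++ Y) (Y ++ X) := by
  induction X with
  | nil => exact (WT.id _).cast rfl (by simp)
  | cons x X ih =>
    exact ((WT.id [x]).tens ih).comp (((wt_crossOne x Y).tens (.id X)).cast (by simp) (by simp))

theorem dualStrand_dualStrand (x : WebStrand) : dualStrand (dualStrand x) = x := by
  cases x <;> rfl

theorem wt_evStrand (x : WebStrand) : WT (k := k) (evStrand x) [dualStrand x, x] [] := by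
  cases x
  · exact (WT.gen _).cast (by simp [src, u_coe, d_coe, dualStrand]) rfl
  · exact (wt_rcap _).cast (by simp [u_coe, d_coe, dualStrand]) rfl

theorem wt_coevStrand (x : WebStrand) : WT (k := k) (coevStrand x) [] [x, dualStrand x] := by
  cases x
  · exact (WT.gen _).cast rfl (by simp [tgt, u_coe, d_coe, dualStrand])
  · exact (wt_rcup _).cast rfl (by simp [u_coe, d_coe, dualStrand])

theorem wt_evWord (X : List WebStrand) : WT (k := k) (evWord X) (dualWord X ++ X) [] := by
  induction X with
  | nil => exact WT.id _
  | cons x X ih =>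
    have h := (WT.id (dualWord X)).tens ((wt_evStrand (k := k) x).tens (.id X))
    exact (h.cast (by simp [dualWord]) rfl).comp ih

theorem wt_coevWord (X : List WebStrand) : WT (k := k) (coevWord X) [] (X ++ dualWord X) := by
  induction X with
  | nil => exact WT.id _
  | cons x X ih =>
    have h := (WT.id [x]).tens (ih.tens (.id [dualStrand x]))
    exact (wt_coevStrand x).comp (h.cast rfl (by simp [dualWord]))

theorem wt_evWord' (X : List WebStrand) : WT (k := k) (evWord' X) (X ++ dualWord X) [] := by
  induction X with
  | nil => exact WT.id _
  | cons x X ih =>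
    have h := (WT.id [x]).tens (ih.tens (.id [dualStrand x]))
    exact (h.cast (by simp [dualWord]) rfl).comp
      ((wt_evStrand (dualStrand x)).cast (by rw [dualStrand_dualStrand]; rfl) rfl)

theorem wt_coevWord' (X : List WebStrand) : WT (k := k) (coevWord' X) [] (dualWord X ++ X) := by
  induction X with
  | nil => exact WT.id _
  | cons x X ih =>
    have h := (WT.id (dualWord X)).tens ((wt_coevStrand (k := k) (dualStrand x)).tens (.id X))
    exact ih.comp (h.cast rfl (by simp [dualWord, dualStrand_dualStrand]))

end Web

section PWebUD

open Web

variable (k : Type*) [CommRing k] [Invertible (2 : k)]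

/-- The strict monoidal supercategory of oriented webs of type P over `k`. -/
abbrev PWebUD := (presentation k).Cat

namespace PWebUD

open SuperPresentation

/-- The object `↑a`; the unit object if `a = 0`. -/
def up (a : ℕ) : PWebUD k := u a

/-- The object `↓a`; the unit object if `a = 0`. -/
def down (a : ℕ) : PWebUD k := d a

/-- The leftward cap. -/
def leftCap (a : ℕ) : down k a * up k a ⟶ 1 := mor (P := presentation k) _ (WT.gen (.lcap a))

/-- The leftward cup. -/
def leftCup (a : ℕ) : 1 ⟶ up k a * down k a := mor (P := presentation k) _ (WT.gen (.lcup a))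

/-- The rightward cap. -/
def rightCap (a : ℕ) : up k a * down k a ⟶ 1 := mor (P := presentation k) _ (wt_rcap a)

/-- The rightward cup. -/
def rightCup (a : ℕ) : 1 ⟶ down k a * up k a := mor (P := presentation k) _ (wt_rcup a)

/-- The crossing of two objects, composed of the oriented crossings of their strands. -/
def crossing (X Y : PWebUD k) : X * Y ⟶ Y * X := mor (P := presentation k) _ (wt_crossWord X Y)

variable {k}

/-- The dual of an object. -/
def dual (X : PWebUD k) : PWebUD k := dualWord X

/-- The rainbow of caps `X* X ⟶ 1`. -/
def rainbowCap (X : PWebUD k) : dual X * X ⟶ 1 := mor (P := presentation k) _ (wt_evWord X)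

/-- The rainbow of cups `1 ⟶ X X*`. -/
def rainbowCup (X : PWebUD k) : 1 ⟶ X * dual X := mor (P := presentation k) _ (wt_coevWord X)

/-- The rainbow of caps `X X* ⟶ 1`. -/
def rainbowCap' (X : PWebUD k) : X * dual X ⟶ 1 := mor (P := presentation k) _ (wt_evWord' X)

/-- The rainbow of cups `1 ⟶ X* X`. -/
def rainbowCup' (X : PWebUD k) : 1 ⟶ dual X * X := mor (P := presentation k) _ (wt_coevWord' X)

end PWebUD

end PWebUD

/-! All identities are proved in the total algebra, the direct sum of all morphism spaces, with
composition as a multiplication that vanishes on morphisms that do not match. There the product of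
morphisms is associative on the nose and transports along equalities of words disappear. Each
morphism space embeds, so identities descend to the category.

Upward strands come first. Splits and merges build rungs E and F, which obey relations of
divided-power type with integer coefficients, and the crossing is an alternating sum of products E
F. In the product of two opposite crossings every term can be rewritten through the elements F^(n)
E^(n); Vandermonde's identity and an alternating row sum of Pascal's triangle leave only n = 0
(`X_mul_X`). For the passage of a merge through a crossing (`merge_tn_mul_X`), both sides are
expanded in one family of ladders; their difference has coefficients given by Pascal's rule and
vanishes because high finite differences of low-degree polynomials are zero. Reflection and
`X_mul_X` give the statement for splits.

The odd cap must also pass through a crossing with a strand of thickness c. Its exchange relations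
with rungs yield this after precomposition with a split. For c = 1 the split is removed with the
braid relation and division by 2 (`IsCap.X_tn_mul_one`). For larger c, `merge_mul_split_one` writes
a merge followed by a split as the identity plus a term through a thinner merge, so induction works
without dividing by factorials (`IsCap.X_tn_mul`).

A crossing whose first strand is downward is the mate, under the duality of the leftward cap and
cup, of a crossing with the corresponding upward strand (`crossing_down`). Taking mates is
compatible with concatenation and with naturality, so caps and cups pass through crossings, and
naturality for a downward strand follows from naturality for an upward one. The rightward crossings
are natural as inverses of leftward ones. Tag-in is the odd cap with one leg bent down, and tag-out
is its inverse. Thus every generator passes through every crossing with a single strand; closure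
under the operations and the hexagons gives all morphisms and all words (`natural_ev`). Symmetry for
words is symmetry for pairs of strands, by induction.

Finally, a left dual in the presence of such a symmetric braiding is also a right dual, with cap and
cup twisted by the crossing (`Dual.symm`). This turns the leftward duality into the rightward one,
and nesting dualities gives the rainbows. -/

/-! ### The total algebra of a presented supercategory -/

namespace SuperPresentation

open DiagExpr DirectSum

universe u

variable {k : Type u} [CommRing k] (P : SuperPresentation k)

/-- The direct sum of all morphism spaces. -/
def Alg : Type u := ⨁ p : P.Cat × P.Cat, (p.1 ⟶ p.2)

noncomputable instance : AddCommGroup P.Alg :=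
  inferInstanceAs (AddCommGroup (⨁ p : P.Cat × P.Cat, (p.1 ⟶ p.2)))

noncomputable instance : Module k P.Alg :=
  inferInstanceAs (Module k (⨁ p : P.Cat × P.Cat, (p.1 ⟶ p.2)))

open Classical in
/-- The inclusion of a morphism space into the total algebra. -/
noncomputable def of (X Y : P.Cat) : (X ⟶ Y) →ₗ[k] P.Alg :=
  DirectSum.lof k (P.Cat × P.Cat) (fun p => (p.1 ⟶ p.2)) (X, Y)

theorem of_injective (X Y : P.Cat) : Function.Injective (P.of X Y) := by
  classical
  exact DirectSum.of_injective (β := fun p : P.Cat × P.Cat => (p.1 ⟶ p.2)) (X, Y)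

variable {P} in
theorem Alg.induction {motive : P.Alg → Prop} (f : P.Alg) (zero : motive 0)
    (of : ∀ X Y (f : X ⟶ Y), motive (P.of X Y f))
    (add : ∀ f g, motive f → motive g → motive (f + g)) : motive f := by
  classical
  exact DirectSum.induction_on f zero (fun p => of p.1 p.2) add

open Classical in
/-- Extend a family of linear maps to the total algebra. -/
noncomputable def lift {M : Type*} [AddCommGroup M] [Module k M]
    (F : ∀ X Y : P.Cat, (X ⟶ Y) →ₗ[k] M) : P.Alg →ₗ[k] M :=
  DirectSum.toModule k (P.Cat × P.Cat) M fun p => F p.1 p.2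

theorem lift_of {M : Type*} [AddCommGroup M] [Module k M]
    (F : ∀ X Y : P.Cat, (X ⟶ Y) →ₗ[k] M) (X Y : P.Cat) (f : X ⟶ Y) :
    P.lift F (P.of X Y f) = F X Y f := by
  classical
  exact DirectSum.toModule_lof k (φ := fun p : P.Cat × P.Cat => F p.1 p.2) (X, Y) f

/-- Extend a family of bilinear maps to the total algebra. -/
noncomputable def lift₂ (F : ∀ X Y X' Y' : P.Cat, (X ⟶ Y) →ₗ[k] (X' ⟶ Y') →ₗ[k] P.Alg) :
    P.Alg →ₗ[k] P.Alg →ₗ[k] P.Alg :=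
  P.lift fun X Y => (P.lift fun X' Y' => (F X Y X' Y').flip).flip

theorem lift₂_of (F : ∀ X Y X' Y' : P.Cat, (X ⟶ Y) →ₗ[k] (X' ⟶ Y') →ₗ[k] P.Alg)
    {X Y X' Y' : P.Cat} (f : X ⟶ Y) (g : X' ⟶ Y') :
    P.lift₂ F (P.of X Y f) (P.of X' Y' g) = F X Y X' Y' f g := by
  rw [lift₂, lift_of, LinearMap.flip_apply, lift_of, LinearMap.flip_apply]

open Classical in
/-- Composition of morphisms, which is zero if they do not match. -/
noncomputable def compAux (X Y Y' Z : P.Cat) : (X ⟶ Y) →ₗ[k] (Y' ⟶ Z) →ₗ[k] P.Alg :=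
  if h : Y = Y' then by subst h; exact (Linear.comp X Y Z).compr₂ (P.of X Z) else 0

noncomputable instance : Mul P.Alg := ⟨fun f g => P.lift₂ P.compAux f g⟩

theorem of_mul_of {X Y Z : P.Cat} (f : X ⟶ Y) (g : Y ⟶ Z) :
    P.of X Y f * P.of Y Z g = P.of X Z (f ≫ g) := by
  refine (P.lift₂_of _ f g).trans ?_
  simp [compAux, Linear.comp]

theorem of_mul_of_ne {X Y Y' Z : P.Cat} (f : X ⟶ Y) (g : Y' ⟶ Z) (h : Y ≠ Y') :
    P.of X Y f * P.of Y' Z g = 0 := by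
  refine (P.lift₂_of _ f g).trans ?_
  simp [compAux, h]

noncomputable instance : NonUnitalRing P.Alg where
  left_distrib f g h := map_add (P.lift₂ P.compAux f) g h
  right_distrib f g h := LinearMap.map_add₂ (P.lift₂ P.compAux) f g h
  zero_mul f := LinearMap.map_zero₂ (P.lift₂ P.compAux) f
  mul_zero f := map_zero (P.lift₂ P.compAux f)
  mul_assoc f g h := by
    have add_mul (f g h : P.Alg) : (f + g) * h = f * h + g * h :=
      LinearMap.map_add₂ (P.lift₂ P.compAux) f g h
    have mul_add (f g h : P.Alg) : f * (g + h) = f * g + f * h :=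
      map_add (P.lift₂ P.compAux f) g h
    have zero_mul (f : P.Alg) : 0 * f = 0 := LinearMap.map_zero₂ (P.lift₂ P.compAux) f
    have mul_zero (f : P.Alg) : f * 0 = 0 := map_zero (P.lift₂ P.compAux f)
    induction f using Alg.induction with
    | zero => simp only [zero_mul]
    | add f f' ih ih' => simp only [add_mul, ih, ih']
    | of X Y f =>
    induction g using Alg.induction with
    | zero => simp only [zero_mul, mul_zero]
    | add f f' ih ih' => simp only [add_mul, mul_add, ih, ih']
    | of Y' Z g =>
    induction h using Alg.induction with
    | zero => simp only [mul_zero]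
    | add f f' ih ih' => simp only [mul_add, ih, ih']
    | of Z' W h =>
    by_cases hY : Y = Y'
    · subst hY
      by_cases hZ : Z = Z'
      · subst hZ; simp only [of_mul_of, Category.assoc]
      · simp only [of_mul_of, of_mul_of_ne P _ _ hZ, mul_zero]
    · by_cases hZ : Z = Z'
      · subst hZ; simp only [of_mul_of, of_mul_of_ne P _ _ hY, zero_mul]
      · simp only [of_mul_of_ne P _ _ hZ, of_mul_of_ne P _ _ hY, zero_mul, mul_zero]

instance : IsScalarTower k P.Alg P.Alg :=
  ⟨fun c f g => LinearMap.map_smul₂ (P.lift₂ P.compAux) c f g⟩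

instance : SMulCommClass k P.Alg P.Alg :=
  ⟨fun c f g => (map_smul (P.lift₂ P.compAux f) c g).symm⟩

/-- The product of morphisms in the total algebra. -/
noncomputable def tn : P.Alg →ₗ[k] P.Alg →ₗ[k] P.Alg :=
  P.lift₂ fun X Y X' Y' => (tensorHom (P := P)).compr₂ (P.of (X * X') (Y * Y'))

variable {P}

local notation:75 f:76 " ⊙ " g:75 => tn _ f g

theorem of_tn_of {X Y X' Y' : P.Cat} (f : X ⟶ Y) (g : X' ⟶ Y') :
    P.of X Y f ⊙ P.of X' Y' g = P.of (X * X') (Y * Y') (tensorHom f g) := by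
  simp [tn, lift₂_of]

variable (P) in
/-- The identity of an object in the total algebra. -/
noncomputable def e (X : List P.Strand) : P.Alg := P.of X X (CategoryStruct.id (obj := P.Cat) X)

variable (P) in
/-- The elements of the total algebra that are morphisms from `X` to `Y`. -/
noncomputable def homs (X Y : P.Cat) : Submodule k P.Alg := LinearMap.range (P.of X Y)

variable (P) in
/-- The elements of the total algebra that are morphisms of parity `p` from `X` to `Y`. -/
noncomputable def phoms (X Y : P.Cat) (p : ZMod 2) : Submodule k P.Alg :=
  (P.parity X Y p).map (P.of X Y)

variable (P) in
/-- The element of the total algebra represented by an expression. -/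
noncomputable def ev : P.Diag → P.Alg
  | .gen g => P.of (P.src g : P.Cat) (P.tgt g : P.Cat) (P.toHom (.gen g) ⟨rfl, rfl⟩)
  | .id X => P.e X
  | .comp f g => ev f * ev g
  | .tens f g => ev f ⊙ ev g
  | .zero => 0
  | .plus f g => ev f + ev g
  | .smul c f => c • ev f

/-- The value depends on the expression alone and not on the words used to type it. This is what
makes reassociation of words harmless. -/
theorem of_toHom {X Y : P.Cat} {f : P.Diag} (h : P.Typed f X Y) :
    P.of X Y (P.toHom f h) = P.ev f := by
  induction f generalizing X Y with
  | gen g => obtain ⟨rfl, rfl⟩ := h; rfl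
  | id Z => obtain ⟨rfl, rfl⟩ := h; rfl
  | comp f g ihf ihg =>
    obtain ⟨Z, hf, hg⟩ := h
    refine Eq.trans ?_ (congrArg₂ (· * ·) (ihf (Y := (Z : P.Cat)) hf) (ihg hg))
    exact (of_mul_of P (Y := (Z : P.Cat)) (P.toHom f hf) (P.toHom g hg)).symm
  | tens f g ihf ihg =>
    obtain ⟨X₁, Y₁, X₂, Y₂, hf, hg, rfl, rfl⟩ := h
    refine Eq.trans ?_ (congrArg₂ (fun a b => tn P a b) (ihf (X := (X₁ : P.Cat)) (Y := (Y₁ : P.Cat)) hf)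
      (ihg (X := (X₂ : P.Cat)) (Y := (Y₂ : P.Cat)) hg))
    exact (of_tn_of (P := P) (X := X₁) (Y := Y₁) (X' := X₂) (Y' := Y₂)
      (P.toHom f hf) (P.toHom g hg)).symm
  | zero => exact map_zero (P.of X Y)
  | plus f g ihf ihg =>
    refine Eq.trans ?_ (congrArg₂ (· + ·) (ihf h.1) (ihg h.2))
    exact map_add (P.of X Y) (mor f h.1) (mor g h.2)
  | smul c f ih =>
    refine Eq.trans ?_ (congrArg (c • ·) (ih h))
    exact map_smul (P.of X Y) c (mor f h)

theorem of_mor {X Y : P.Cat} {f : P.Diag} (h : P.Typed f X Y) : P.of X Y (mor f h) = P.ev f :=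
  of_toHom h

theorem ev_eq_of_eqv {X Y : List P.Strand} {f g : P.Diag} (h : P.Eqv X Y f g) :
    P.ev f = P.ev g := by
  rw [← of_toHom (X := X) (Y := Y) h.typed.1, ← of_toHom (X := X) (Y := Y) h.typed.2]
  exact congrArg _ (toHom_eq h)

theorem exists_ev {X Y : P.Cat} (f : X ⟶ Y) : ∃ t, P.Typed t X Y ∧ P.of X Y f = P.ev t := by
  obtain ⟨t, ht, rfl⟩ := toHom_surj f
  exact ⟨t, ht, of_toHom ht⟩

theorem ev_mem {X Y : List P.Strand} {f : P.Diag} (h : P.Typed f X Y) : P.ev f ∈ P.homs X Y :=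
  ⟨P.toHom f h, of_toHom h⟩

theorem ev_mem_phoms {X Y : List P.Strand} {f : P.Diag} {p : ZMod 2} (h : P.Typed f X Y)
    (hp : f.HasParity P.par p) : P.ev f ∈ P.phoms X Y p :=
  ⟨P.toHom f h, ⟨f, h, hp, rfl⟩, of_toHom h⟩

theorem exists_of_mem_phoms {X Y : List P.Strand} {f : P.Alg} {p : ZMod 2}
    (h : f ∈ P.phoms X Y p) : ∃ t, P.Typed t X Y ∧ t.HasParity P.par p ∧ f = P.ev t := by
  obtain ⟨_, ⟨t, ht, hp, rfl⟩, rfl⟩ := h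
  exact ⟨t, ht, hp, of_toHom ht⟩

theorem exists_of_mem_homs {X Y : List P.Strand} {f : P.Alg}
    (h : f ∈ P.homs X Y) : ∃ t, P.Typed t X Y ∧ f = P.ev t := by
  obtain ⟨f, rfl⟩ := h
  exact exists_ev f

theorem phoms_le {X Y : List P.Strand} {p : ZMod 2} : P.phoms X Y p ≤ P.homs X Y :=
  fun _ ⟨a, _, h⟩ => ⟨a, h⟩

theorem e_mem (X : List P.Strand) : P.e X ∈ P.phoms X X 0 :=
  ev_mem_phoms (f := .id X) (Typed.id X) rfl

theorem mul_mem {X Y Z : List P.Strand} {f g : P.Alg} (hf : f ∈ P.homs X Y) (hg : g ∈ P.homs Y Z) :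
    f * g ∈ P.homs X Z := by
  obtain ⟨f, tf, rfl⟩ := exists_of_mem_homs hf
  obtain ⟨g, tg, rfl⟩ := exists_of_mem_homs hg
  exact ev_mem (f := f ⨾ g) (Typed.comp tf tg)

theorem tn_mem {X Y X' Y' : List P.Strand} {f g : P.Alg} (hf : f ∈ P.homs X Y)
    (hg : g ∈ P.homs X' Y') : f ⊙ g ∈ P.homs (X ++ X') (Y ++ Y') := by
  obtain ⟨f, tf, rfl⟩ := exists_of_mem_homs hf
  obtain ⟨g, tg, rfl⟩ := exists_of_mem_homs hg
  exact ev_mem (f := f ⊠ g) (Typed.tens tf tg)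

theorem mul_mem_even {X Y Z : List P.Strand} {f g : P.Alg} (hf : f ∈ P.phoms X Y 0)
    (hg : g ∈ P.phoms Y Z 0) : f * g ∈ P.phoms X Z 0 := by
  obtain ⟨f, tf, pf, rfl⟩ := exists_of_mem_phoms hf
  obtain ⟨g, tg, pg, rfl⟩ := exists_of_mem_phoms hg
  exact ev_mem_phoms (f := f ⨾ g) (Typed.comp tf tg) ⟨0, 0, pf, pg, rfl⟩

theorem tn_mem_even {X Y X' Y' : List P.Strand} {f g : P.Alg} (hf : f ∈ P.phoms X Y 0)
    (hg : g ∈ P.phoms X' Y' 0) : f ⊙ g ∈ P.phoms (X ++ X') (Y ++ Y') 0 := by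
  obtain ⟨f, tf, pf, rfl⟩ := exists_of_mem_phoms hf
  obtain ⟨g, tg, pg, rfl⟩ := exists_of_mem_phoms hg
  exact ev_mem_phoms (f := f ⊠ g) (Typed.tens tf tg) ⟨0, 0, pf, pg, rfl⟩

theorem e_mul {X Y : List P.Strand} {f : P.Alg} (hf : f ∈ P.homs X Y) : P.e X * f = f := by
  obtain ⟨f, tf, rfl⟩ := exists_of_mem_homs hf
  exact ev_eq_of_eqv (.id_comp tf)

theorem mul_e {X Y : List P.Strand} {f : P.Alg} (hf : f ∈ P.homs X Y) : f * P.e Y = f := by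
  obtain ⟨f, tf, rfl⟩ := exists_of_mem_homs hf
  exact ev_eq_of_eqv (.comp_id tf)

theorem e_tn_e (X Y : List P.Strand) : P.e X ⊙ P.e Y = P.e (X ++ Y) :=
  ev_eq_of_eqv (.id_tens_id X Y)

theorem tn_assoc (f g h : P.Alg) : (f ⊙ g) ⊙ h = f ⊙ g ⊙ h := by
  induction f using Alg.induction with
  | zero => simp
  | add f f' ih ih' => simp_all
  | of X Y f =>
  induction g using Alg.induction with
  | zero => simp
  | add f f' ih ih' => simp_all
  | of X' Y' g =>
  induction h using Alg.induction with
  | zero => simp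
  | add f f' ih ih' => simp_all
  | of X'' Y'' h =>
  obtain ⟨f, hf, rfl⟩ := toHom_surj f
  obtain ⟨g, hg, rfl⟩ := toHom_surj g
  obtain ⟨h, hh, rfl⟩ := toHom_surj h
  rw [of_toHom, of_toHom, of_toHom]
  exact ev_eq_of_eqv (.tens_assoc hf hg hh)

theorem nil_tn (f : P.Alg) : P.e [] ⊙ f = f := by
  induction f using Alg.induction with
  | zero => simp
  | add f f' ih ih' => simp_all
  | of X Y f =>
  obtain ⟨f, hf, rfl⟩ := toHom_surj f
  rw [of_toHom]
  exact ev_eq_of_eqv (.nil_tens hf)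

theorem tn_nil (f : P.Alg) : f ⊙ P.e [] = f := by
  induction f using Alg.induction with
  | zero => simp
  | add f f' ih ih' => simp_all
  | of X Y f =>
  obtain ⟨f, hf, rfl⟩ := toHom_surj f
  rw [of_toHom]
  exact ev_eq_of_eqv (.tens_nil hf)

theorem superSign_zero : superSign k 0 = 1 := by simp [superSign]

/-- The interchange sign involves the parity of the identity on `X`, which is even, so no sign
appears. -/
theorem e_tn_mul (X : List P.Strand) (f g : P.Alg) : P.e X ⊙ (f * g) = (P.e X ⊙ f) * (P.e X ⊙ g) := by
  induction f using Alg.induction with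
  | zero => simp
  | add f f' ih ih' => simp_all [add_mul]
  | of A B f =>
  induction g using Alg.induction with
  | zero => simp
  | add f f' ih ih' => simp_all [mul_add]
  | of B' C g =>
  by_cases h : B = B'
  · subst h
    -- The interchange relation is stated only when its outer factors are homogeneous, so `g` is
    -- first split into its even and odd parts.
    obtain ⟨f, hf, rfl⟩ := toHom_surj f
    obtain ⟨a, ha, b, hb, rfl⟩ : ∃ a ∈ P.parity B C 0, ∃ b ∈ P.parity B C 1, g = a + b := by
      obtain ⟨g, hg, rfl⟩ := toHom_surj g
      exact exists_parity_add g hg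
    have key (p : ZMod 2) (g : B ⟶ C) (hg : g ∈ P.parity B C p) :
        P.e X ⊙ (P.ev f * P.of B C g) = (P.e X ⊙ P.ev f) * (P.e X ⊙ P.of B C g) := by
      obtain ⟨g, hg, pg, rfl⟩ := hg
      rw [of_toHom]
      have h := ev_eq_of_eqv (Eqv.interchange (p := 0) (q := p) (Typed.id (P := P) X) (Typed.id X)
        hf hg rfl pg |>.trans
          (.smul_congr _ (.tens_congr (.id_comp (Typed.id X)) (.refl (hf.comp hg)))))
      simp only [ev, zero_mul, superSign_zero, one_smul] at h
      exact h.symm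
    rw [of_toHom, map_add, mul_add]
    simp only [map_add, mul_add]
    exact congrArg₂ (· + ·) (key 0 a ha) (key 1 b hb)
  -- Morphisms that do not match stay unmatched after tensoring with `X`: words can be cancelled on
  -- the left.
  · rw [of_mul_of_ne _ _ _ h, map_zero]
    refine (Eq.trans (congrArg₂ (· * ·) (of_tn_of (X := X) (Y := X) _ f)
      (of_tn_of (X := X) (Y := X) _ g)) ?_).symm
    exact of_mul_of_ne _ _ _ fun h' => h (List.append_cancel_left h')

theorem tn_e_mul (X : List P.Strand) (f g : P.Alg) :
    (f * g) ⊙ P.e X = (f ⊙ P.e X) * (g ⊙ P.e X) := by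
  induction f using Alg.induction with
  | zero => simp
  | add f f' ih ih' => simp_all [add_mul]
  | of A B f =>
  induction g using Alg.induction with
  | zero => simp
  | add f f' ih ih' => simp_all [mul_add]
  | of B' C g =>
  by_cases h : B = B'
  · subst h
    obtain ⟨a, ha, b, hb, rfl⟩ : ∃ a ∈ P.parity A B 0, ∃ b ∈ P.parity A B 1, f = a + b := by
      obtain ⟨f, hf, rfl⟩ := toHom_surj f
      exact exists_parity_add f hf
    have key (p : ZMod 2) (f : A ⟶ B) (hf : f ∈ P.parity A B p) :
        (P.of A B f * P.of B C g) ⊙ P.e X = (P.of A B f ⊙ P.e X) * (P.of B C g ⊙ P.e X) := by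
      obtain ⟨f, hf, pf, rfl⟩ := hf
      obtain ⟨g, hg, rfl⟩ := toHom_surj g
      rw [of_toHom, of_toHom]
      have h := ev_eq_of_eqv (Eqv.interchange (p := p) (q := 0) hf hg (Typed.id (P := P) X)
        (Typed.id X) pf rfl |>.trans
          (.smul_congr _ (.tens_congr (.refl (hf.comp hg)) (.id_comp (Typed.id X)))))
      simp only [ev, mul_zero, superSign_zero, one_smul] at h
      exact h.symm
    rw [map_add, add_mul]
    simp only [map_add, LinearMap.add_apply, add_mul]
    exact congrArg₂ (· + ·) (key 0 a ha) (key 1 b hb)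
  · rw [of_mul_of_ne _ _ _ h, map_zero, LinearMap.zero_apply]
    refine (Eq.trans (congrArg₂ (· * ·) (of_tn_of (X' := X) (Y' := X) f _)
      (of_tn_of (X' := X) (Y' := X) g _)) ?_).symm
    exact of_mul_of_ne _ _ _ fun h' => h (List.append_cancel_right h')

/-- In this order the sign of the interchange law only sees two identities, so no homogeneity is
needed; the opposite order, treated next, produces the sign. -/
theorem tn_eq_right_left {X Y X' Y' : List P.Strand} {f g : P.Alg}
    (hf : f ∈ P.homs X Y) (hg : g ∈ P.homs X' Y') : (P.e X ⊙ g) * (f ⊙ P.e Y') = f ⊙ g := by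
  obtain ⟨f, tf, rfl⟩ := exists_of_mem_homs hf
  obtain ⟨g, tg, rfl⟩ := exists_of_mem_homs hg
  have h := ev_eq_of_eqv (Eqv.interchange (p := 0) (q := 0) (Typed.id (P := P) X) tf tg
    (Typed.id Y') rfl rfl |>.trans (.smul_congr _ (.tens_congr (.id_comp tf) (.comp_id tg))))
  simpa only [ev, mul_zero, superSign_zero, one_smul] using h

theorem tn_eq_left_right {X Y X' Y' : List P.Strand} {f g : P.Alg} {p q : ZMod 2}
    (hf : f ∈ P.phoms X Y p) (hg : g ∈ P.phoms X' Y' q) :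
    (f ⊙ P.e X') * (P.e Y ⊙ g) = superSign k (p * q) • (f ⊙ g) := by
  obtain ⟨f, tf, pf, rfl⟩ := exists_of_mem_phoms hf
  obtain ⟨g, tg, pg, rfl⟩ := exists_of_mem_phoms hg
  have h := ev_eq_of_eqv (Eqv.interchange (p := p) (q := q) tf (Typed.id (P := P) Y) (Typed.id X') tg
    pf pg |>.trans (.smul_congr _ (.tens_congr (.comp_id tf) (.id_comp tg))))
  simpa only [ev] using h

theorem exists_add_of_mem_homs {X Y : P.Cat} {f : P.Alg} (hf : f ∈ P.homs X Y) :
    ∃ a ∈ P.phoms X Y 0, ∃ b ∈ P.phoms X Y 1, f = a + b := by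
  obtain ⟨f, rfl⟩ := hf
  obtain ⟨f, hf, rfl⟩ := toHom_surj f
  obtain ⟨a, ha, b, hb, h⟩ := exists_parity_add (P := P) f hf
  refine ⟨_, ⟨a, ha, rfl⟩, _, ⟨b, hb, rfl⟩, ?_⟩
  exact (congrArg (P.of X Y) h).trans (map_add _ a b)

/-- Morphisms far apart commute if one of them is even. -/
theorem slide {X Y X' Y' : List P.Strand} {f g : P.Alg}
    (hf : f ∈ P.phoms X Y 0) (hg : g ∈ P.homs X' Y') :
    (f ⊙ P.e X') * (P.e Y ⊙ g) = (P.e X ⊙ g) * (f ⊙ P.e Y') := by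
  rw [tn_eq_right_left (phoms_le hf) hg]
  obtain ⟨a, ha, b, hb, rfl⟩ := exists_add_of_mem_homs hg
  simp only [map_add, mul_add]
  have h₁ := tn_eq_left_right hf ha
  have h₂ := tn_eq_left_right hf hb
  simp only [zero_mul, superSign_zero, one_smul] at h₁ h₂
  rw [h₁, h₂]

theorem slide' {X Y X' Y' : List P.Strand} {f g : P.Alg}
    (hf : f ∈ P.homs X Y) (hg : g ∈ P.phoms X' Y' 0) :
    (f ⊙ P.e X') * (P.e Y ⊙ g) = (P.e X ⊙ g) * (f ⊙ P.e Y') := by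
  rw [tn_eq_right_left hf (phoms_le hg)]
  obtain ⟨a, ha, b, hb, rfl⟩ := exists_add_of_mem_homs hf
  simp only [map_add, add_mul, LinearMap.add_apply]
  have h₁ := tn_eq_left_right ha hg
  have h₂ := tn_eq_left_right hb hg
  simp only [mul_zero, superSign_zero, one_smul] at h₁ h₂
  rw [h₁, h₂]

end SuperPresentation

/-! ### Sums of binomial coefficients -/

section Binomial

open Finset

/-- The square is cut down to the triangle where `f` can be nonzero, and this is sliced by the total
index. -/
theorem sum_range_range_eq_sum_antidiagonal {M : Type*} [AddCommMonoid M] (N : ℕ)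
    (f : ℕ → ℕ → M) (h : ∀ p t, N ≤ p + t → f p t = 0) :
    ∑ p ∈ range N, ∑ t ∈ range N, f p t =
      ∑ n ∈ range N, ∑ x ∈ antidiagonal n, f x.1 x.2 := by
  rw [← Finset.sum_product']
  rw [← Finset.sum_filter_of_ne (p := fun x : ℕ × ℕ => x.1 + x.2 < N) fun x _ hx => by
    by_contra h'
    exact hx (h _ _ (by omega))]
  rw [← Finset.sum_fiberwise_of_maps_to (g := fun x : ℕ × ℕ => x.1 + x.2) (t := range N)
    fun x hx => by simpa using (mem_filter.1 hx).2]
  refine Finset.sum_congr rfl fun n hn => Finset.sum_congr ?_ fun _ _ => rfl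
  ext ⟨p, t⟩
  simp only [mem_filter, mem_product, mem_range, HasAntidiagonal.mem_antidiagonal] at hn ⊢
  omega

theorem choose_neg_sub_one (x : ℤ) (n : ℕ) :
    Ring.choose (-x - 1) n = (-1) ^ n * Ring.choose (x + n) n := by
  rw [show -x - 1 = -(x + 1) by ring, Ring.choose_neg, show x + 1 + n - 1 = x + n by ring,
    Int.negOnePow_def, Units.smul_def]
  simp

theorem choose_eq_zero_of_lt {x : ℤ} {n : ℕ} (h₀ : 0 ≤ x) (h : x < n) : Ring.choose x n = 0 := by
  obtain ⟨m, rfl⟩ := Int.eq_ofNat_of_zero_le h₀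
  rw [Ring.choose_natCast, Nat.choose_eq_zero_of_lt (by exact_mod_cast h)]
  rfl

/-- Vandermonde for upper indices that add up to 0. -/
theorem sum_antidiagonal_choose_neg (x : ℤ) (n : ℕ) :
    ∑ p ∈ antidiagonal n, Ring.choose (-x) p.1 * Ring.choose x p.2 = if n = 0 then 1 else 0 := by
  rw [← Ring.add_choose_eq n (Commute.all _ _), neg_add_cancel, Ring.choose_zero_ite]

/-- Vandermonde for the upper indices `-a - 1` and `a`, whose sum is -1. -/
theorem sum_antidiagonal_neg_one_pow_choose (a n : ℕ) :
    ∑ p ∈ antidiagonal n, (-1) ^ p.1 * (Ring.choose (a + p.1 : ℤ) p.1 * Ring.choose (a : ℤ) p.2) =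
      (-1) ^ n := by
  have h := Ring.add_choose_eq (R := ℤ) (r := -a - 1) (s := a) n (Commute.all _ _)
  simp only [choose_neg_sub_one, mul_assoc] at h
  rw [← h, show (-a - 1 + a : ℤ) = -0 - 1 by ring, choose_neg_sub_one, zero_add,
    Ring.choose_natCast]
  simp

/-- The left side is the `q`-th finite difference of a polynomial of degree `j`. -/
theorem sum_choose_add_eq_zero (x : ℤ) {j q : ℕ} (h : j < q) :
    ∑ u ∈ range (q + 1), (-1) ^ (q - u) * ((q.choose u : ℤ) * Ring.choose (x + u) j) = 0 := by
  have step (j : ℕ) : fwdDiff (1 : ℤ) (fun x : ℤ => Ring.choose x (j + 1)) =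
      fun x => Ring.choose x j := by
    ext x
    rw [fwdDiff, Ring.choose_succ_succ]
    ring
  have zero (n : ℕ) : (fwdDiff (1 : ℤ))^[n] (0 : ℤ → ℤ) = 0 := by
    induction n with
    | zero => rfl
    | succ n ih => rw [Function.iterate_succ_apply, show fwdDiff (1 : ℤ) (0 : ℤ → ℤ) = 0 by
        ext; simp [fwdDiff], ih]
  have main : (fwdDiff (1 : ℤ))^[q] (fun x : ℤ => Ring.choose x j) = 0 := by
    induction q generalizing j with
    | zero => omega
    | succ q ih =>
      rw [Function.iterate_succ_apply]
      cases j with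
      | zero =>
        simp only [Ring.choose_zero_right]
        rw [show fwdDiff (1 : ℤ) (fun _ : ℤ => (1 : ℤ)) = 0 by ext; simp [fwdDiff], zero]
      | succ j => rw [step, ih (by omega)]
  have h' := fwdDiff_iter_eq_sum_shift (1 : ℤ) (fun x : ℤ => Ring.choose x j) q x
  rw [main] at h'
  simpa [mul_assoc] using h'.symm

/-- Only the terms with `p.2 ≤ q` survive, and these form a `q`-th finite difference of a polynomial
of degree `j`, up to sign. -/
theorem sum_antidiagonal_choose_sub_eq_zero (b : ℤ) {w j q : ℕ} (h : j < q) (hw : q ≤ w) :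
    ∑ p ∈ antidiagonal w, (-1) ^ p.1 * (Ring.choose (p.1 - b) j * Ring.choose (q : ℤ) p.2) = 0 := by
  rw [← Finset.Nat.sum_antidiagonal_swap,
    Nat.sum_antidiagonal_eq_sum_range_succ_mk]
  simp only [Prod.swap_prod_mk]
  rw [show w.succ = (q + 1) + (w - q) by omega, Finset.sum_range_add]
  rw [Finset.sum_eq_zero (s := range (w - q)) fun u _ => by
    rw [Ring.choose_natCast, Nat.choose_eq_zero_of_lt (by omega)]; simp, add_zero,
    ← Finset.sum_range_reflect, ← mul_zero ((-1) ^ w),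
    ← sum_choose_add_eq_zero (w - q - b) h, Finset.mul_sum]
  refine Finset.sum_congr rfl fun u hu => ?_
  rw [mem_range] at hu
  obtain ⟨v, rfl⟩ := Nat.exists_eq_add_of_le (Nat.lt_succ_iff.1 hu)
  obtain ⟨w, rfl⟩ := Nat.exists_eq_add_of_le hw
  rw [Ring.choose_natCast, show u + v + 1 - 1 - u = v by omega, show u + v - u = v by omega,
    show u + v + w - v = u + w by omega, Nat.choose_symm_add,
    show ((u + w : ℕ) : ℤ) - b = ((u + v + w : ℕ) : ℤ) - ((u + v : ℕ) : ℤ) - b + u by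
      push_cast; ring]
  have : (-1 : ℤ) ^ (u + v + w) * (-1) ^ v = (-1) ^ (u + w) := by
    rw [← pow_add, show u + v + w + v = u + w + 2 * v by ring, pow_add _ _ (2 * v), pow_mul]
    simp
  rw [← this]
  ring

end Binomial

/-! ### Ladders -/

section Ladders

open Finset MulOpposite

/-- The rung of thickness `r` from left to right. -/
def ladderE {A : Type*} [NonUnitalRing A] (T : A →+ A →+ A) (i : ℤ → A) (s m : ℤ → ℤ → A)
    (a b r : ℤ) : A := T (s (a - r) r) (i b) * T (i (a - r)) (m r b)

/-- The rung of thickness `r` from right to left. -/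
def ladderF {A : Type*} [NonUnitalRing A] (T : A →+ A →+ A) (i : ℤ → A) (s m : ℤ → ℤ → A)
    (a b r : ℤ) : A := T (i a) (s r (b - r)) * T (m a r) (i (b - r))

/-- Splits and merges of strands labelled by integers, where diagrams with negative labels are
zero. The multiplication of `A` is composition, and `tn` is the product of morphisms. -/
structure LadderAlgebra (A : Type*) [NonUnitalRing A] where
  tn : A →+ A →+ A
  i : ℤ → A
  s : ℤ → ℤ → A
  m : ℤ → ℤ → A
  tn_assoc (f g h : A) : tn (tn f g) h = tn f (tn g h)
  zero_tn (f : A) : tn (i 0) f = f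
  tn_zero (f : A) : tn f (i 0) = f
  i_tn_mul (a : ℤ) (f g : A) : tn (i a) (f * g) = tn (i a) f * tn (i a) g
  mul_tn_i (a : ℤ) (f g : A) : tn (f * g) (i a) = tn f (i a) * tn g (i a)
  i_mul_i (a : ℤ) : i a * i a = i a
  i_mul_s (a b : ℤ) : i (a + b) * s a b = s a b
  s_mul_i (a b : ℤ) : s a b * tn (i a) (i b) = s a b
  i_mul_m (a b : ℤ) : tn (i a) (i b) * m a b = m a b
  m_mul_i (a b : ℤ) : m a b * i (a + b) = m a b
  i_neg (a : ℤ) : a < 0 → i a = 0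
  s_zero_left (a : ℤ) : s 0 a = i a
  s_zero_right (a : ℤ) : s a 0 = i a
  m_zero_left (a : ℤ) : m 0 a = i a
  m_zero_right (a : ℤ) : m a 0 = i a
  s_s (a b c d : ℤ) : tn (s a b) (i (c + d)) * tn (i a) (tn (i b) (s c d)) =
    tn (i (a + b)) (s c d) * tn (s a b) (tn (i c) (i d))
  s_m (a b c d : ℤ) : tn (s a b) (tn (i c) (i d)) * tn (i a) (tn (i b) (m c d)) =
    tn (i (a + b)) (m c d) * tn (s a b) (i (c + d))
  m_s (a b c d : ℤ) : tn (m a b) (i (c + d)) * tn (i (a + b)) (s c d) =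
    tn (i a) (tn (i b) (s c d)) * tn (m a b) (tn (i c) (i d))
  m_m (a b c d : ℤ) : tn (m a b) (tn (i c) (i d)) * tn (i (a + b)) (m c d) =
    tn (i a) (tn (i b) (m c d)) * tn (m a b) (i (c + d))
  s_assoc (a b c : ℤ) : s (a + b) c * tn (s a b) (i c) = s a (b + c) * tn (i a) (s b c)
  m_assoc (a b c : ℤ) : tn (m a b) (i c) * m (a + b) c = tn (i a) (m b c) * m a (b + c)
  swap (a b r s' : ℤ) (N : ℕ) : r < N → s' < N →
    ladderE tn i s m a b s' * ladderF tn i s m (a - s') (b + s') r =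
      ∑ t ∈ range N, Ring.choose (a - b + r - s') t •
        (ladderF tn i s m a b (r - t) * ladderE tn i s m (a + (r - t)) (b - (r - t)) (s' - t))

namespace LadderAlgebra

section Basic

variable {A : Type*} [NonUnitalRing A] (W : LadderAlgebra A)

local notation:75 f:76 " ⊙ " g:75 => W.tn f g
local notation "𝕚" => W.i
local notation "𝕤" => W.s
local notation "𝕞" => W.m

/-- The rung of thickness `r` from left to right. -/
def E (a b r : ℤ) : A := ladderE W.tn W.i W.s W.m a b r

/-- The rung of thickness `r` from right to left. -/
def F (a b r : ℤ) : A := ladderF W.tn W.i W.s W.m a b r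

theorem E_def (a b r : ℤ) : W.E a b r = (𝕤 (a - r) r ⊙ 𝕚 b) * (𝕚 (a - r) ⊙ 𝕞 r b) := rfl

theorem F_def (a b r : ℤ) : W.F a b r = (𝕚 a ⊙ 𝕤 r (b - r)) * (𝕞 a r ⊙ 𝕚 (b - r)) := rfl

theorem E_add (a b r : ℤ) : W.E (a + r) b r = (𝕤 a r ⊙ 𝕚 b) * (𝕚 a ⊙ 𝕞 r b) := by
  rw [E_def, add_sub_cancel_right]

theorem F_add (a b r : ℤ) : W.F a (b + r) r = (𝕚 a ⊙ 𝕤 r b) * (𝕞 a r ⊙ 𝕚 b) := by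
  rw [F_def, add_sub_cancel_right]

theorem E_mul_F (a b r s : ℤ) (N : ℕ) (hr : r < N) (hs : s < N) :
    W.E a b s * W.F (a - s) (b + s) r = ∑ t ∈ range N, Ring.choose (a - b + r - s) t •
      (W.F a b (r - t) * W.E (a + (r - t)) (b - (r - t)) (s - t)) := W.swap a b r s N hr hs

theorem s_neg_left {a : ℤ} (h : a < 0) (b : ℤ) : 𝕤 a b = 0 := by
  rw [← W.s_mul_i, W.i_neg a h]; simp

theorem s_neg_right {b : ℤ} (h : b < 0) (a : ℤ) : 𝕤 a b = 0 := by
  rw [← W.s_mul_i, W.i_neg b h]; simp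

theorem E_neg {r : ℤ} (h : r < 0) (a b : ℤ) : W.E a b r = 0 := by
  rw [E_def, W.s_neg_right h]; simp

theorem E_of_lt {a r : ℤ} (h : a < r) (b : ℤ) : W.E a b r = 0 := by
  rw [E_def, W.s_neg_left (by omega)]; simp

theorem F_neg {r : ℤ} (h : r < 0) (a b : ℤ) : W.F a b r = 0 := by
  rw [F_def, W.s_neg_left h]; simp

theorem F_of_lt {b r : ℤ} (h : b < r) (a : ℤ) : W.F a b r = 0 := by
  rw [F_def, W.s_neg_right (by omega)]; simp

theorem E_zero (a b : ℤ) : W.E a b 0 = 𝕚 a ⊙ 𝕚 b := by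
  rw [E_def, sub_zero, W.s_zero_right, W.m_zero_left, ← W.i_tn_mul, W.i_mul_i]

theorem F_zero (a b : ℤ) : W.F a b 0 = 𝕚 a ⊙ 𝕚 b := by
  rw [F_def, sub_zero, W.s_zero_left, W.m_zero_right, ← W.i_tn_mul, W.i_mul_i]

/-- Splits and merges are rungs that begin or end on a deleted strand. With the next three lemmas,
this specialises ladder relations to single splits and merges. -/
theorem E_right_zero (a b : ℤ) : W.E (a + b) 0 b = 𝕤 a b := by
  rw [E_def, W.m_zero_right, W.tn_zero, add_sub_cancel_right, W.s_mul_i]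

theorem F_right_self (a b : ℤ) : W.F a b b = 𝕞 a b := by
  rw [F_def, sub_self, W.s_zero_right, W.tn_zero, W.i_mul_m]

theorem E_left_self (a b : ℤ) : W.E a b a = 𝕞 a b := by
  rw [E_def, sub_self, W.s_zero_left, W.zero_tn, W.i_mul_m]

theorem F_left_zero (a b : ℤ) : W.F 0 (a + b) a = 𝕤 a b := by
  rw [F_def, W.m_zero_left, W.zero_tn, add_sub_cancel_left, W.s_mul_i]

/-- The digon relation. -/
theorem s_mul_m (a : ℤ) (b : ℕ) : 𝕤 a b * 𝕞 a b = Ring.choose (a + b) b • 𝕚 (a + b) := by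
  -- The right strand is empty, so F-rungs of positive thickness vanish and only the summand `t = b`
  -- remains.
  have h := W.E_mul_F (a + b) 0 b b (b + 1) (by simp) (by simp)
  rw [W.E_right_zero, add_sub_cancel_right, zero_add, W.F_right_self, Finset.sum_range_succ,
    Finset.sum_eq_zero, sub_self, sub_self, W.F_zero, add_zero, sub_zero, W.E_zero, W.tn_zero,
    W.i_mul_i, zero_add] at h
  · rw [h]; congr 2; ring
  · intro t ht
    rw [Finset.mem_range] at ht
    rw [W.F_of_lt (by omega), zero_mul, smul_zero]

theorem s_mul_m' (a : ℕ) (b : ℤ) : 𝕤 a b * 𝕞 a b = Ring.choose (a + b) a • 𝕚 (a + b) := by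
  rcases lt_or_ge b 0 with hb | hb
  · rw [W.s_neg_right hb, zero_mul]
    rcases lt_or_ge (a + b) 0 with h | h
    · rw [W.i_neg _ h, smul_zero]
    · rw [choose_eq_zero_of_lt h (by omega), zero_smul]
  · lift b to ℕ using hb
    rw [W.s_mul_m, ← Nat.cast_add, Ring.choose_natCast, Ring.choose_natCast, Nat.choose_symm_add]

/-- The exchange relation `E_mul_F` is unitriangular, and the binomial coefficients of opposite
upper index invert it by `sum_antidiagonal_choose_neg`. -/
theorem F_mul_E (a b r s : ℤ) (N : ℕ) (hr : r < N) (hs : s < N) :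
    W.F a b r * W.E (a + r) (b - r) s = ∑ t ∈ range N, Ring.choose (b - a + s - r) t •
      (W.E a b (s - t) * W.F (a - (s - t)) (b + (s - t)) (r - t)) := by
  symm
  calc _ = ∑ t ∈ range N, ∑ t' ∈ range N, (Ring.choose (-(a - b + r - s)) t *
        Ring.choose (a - b + r - s) t') • (W.F a b (r - ((t + t' : ℕ) : ℤ)) *
          W.E (a + (r - ((t + t' : ℕ) : ℤ))) (b - (r - ((t + t' : ℕ) : ℤ)))
            (s - ((t + t' : ℕ) : ℤ))) := by
        refine Finset.sum_congr rfl fun t _ => ?_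
        -- Lowering both thicknesses by `t` leaves `a - b + r - s` unchanged, so the upper index of
        -- the inner expansion does not depend on `t`.
        rw [W.E_mul_F a b (r - t) (s - t) N (by omega) (by omega), Finset.smul_sum]
        refine Finset.sum_congr rfl fun t' _ => ?_
        rw [smul_smul]
        push_cast
        congr 2 <;> ring_nf
    _ = _ := by
        rw [sum_range_range_eq_sum_antidiagonal N (fun t t' => _)]
        · rw [Finset.sum_eq_single 0]
          · simp
          · intro n _ hn
            have := sum_antidiagonal_choose_neg (a - b + r - s) n
            rw [if_neg hn] at this
            rw [← zero_smul ℤ (W.F a b (r - n) * W.E (a + (r - n)) (b - (r - n)) (s - n)), ← this,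
              Finset.sum_smul]
            refine Finset.sum_congr rfl fun x hx => ?_
            rw [← Finset.HasAntidiagonal.mem_antidiagonal.1 hx]
          · intro h
            have : N = 0 := by simpa using h
            subst this
            simp [W.F_neg (show r < 0 by simpa using hr)]
        · intro p t h
          rw [W.F_neg (by omega)]; simp

end Basic

/-- Reflection in a horizontal line. -/
def op {A : Type*} [NonUnitalRing A] (W : LadderAlgebra A) : LadderAlgebra Aᵐᵒᵖ where
  tn := AddMonoidHom.mk' (fun f => AddMonoidHom.mk' (fun g => .op (W.tn f.unop g.unop))
    (by intros; simp)) (by intros; ext; simp)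
  i a := .op (W.i a)
  s a b := .op (W.m a b)
  m a b := .op (W.s a b)
  tn_assoc f g h := congrArg _ (W.tn_assoc _ _ _)
  zero_tn f := congrArg _ (W.zero_tn _)
  tn_zero f := congrArg _ (W.tn_zero _)
  i_tn_mul a f g := congrArg _ (W.i_tn_mul _ _ _)
  mul_tn_i a f g := congrArg _ (W.mul_tn_i _ _ _)
  i_mul_i a := congrArg _ (W.i_mul_i _)
  i_mul_s a b := congrArg _ (W.m_mul_i _ _)
  s_mul_i a b := congrArg _ (W.i_mul_m _ _)
  i_mul_m a b := congrArg _ (W.s_mul_i _ _)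
  m_mul_i a b := congrArg _ (W.i_mul_s _ _)
  i_neg a h := congrArg _ (W.i_neg a h)
  s_zero_left a := congrArg _ (W.m_zero_left a)
  s_zero_right a := congrArg _ (W.m_zero_right a)
  m_zero_left a := congrArg _ (W.s_zero_left a)
  m_zero_right a := congrArg _ (W.s_zero_right a)
  s_s a b c d := congrArg _ (W.m_m a b c d).symm
  s_m a b c d := congrArg _ (W.m_s a b c d).symm
  m_s a b c d := congrArg _ (W.s_m a b c d).symm
  m_m a b c d := congrArg _ (W.s_s a b c d).symm
  s_assoc a b c := congrArg _ (W.m_assoc a b c)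
  m_assoc a b c := congrArg _ (W.s_assoc a b c)
  swap a b r s N hr hs := by
    have h := congrArg MulOpposite.op (W.E_mul_F (a - s + r) (b + s - r) s r N hs hr)
    refine Eq.trans ?_ (h.trans ?_)
    · rw [show a - s + r - r = a - s by ring, show b + s - r + r = b + s by ring, W.E_add, W.F_add]
      rfl
    · rw [Finset.op_sum]
      refine Finset.sum_congr rfl fun t _ => ?_
      rw [MulOpposite.op_smul, show a - s + r - (b + s - r) + s - r = a - b + r - s by ring,
        show a - s + r = a + (r - t) - (s - t) by ring,
        show b + s - r = b - (r - t) + (s - t) by ring, W.F_add, add_sub_cancel_right,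
        sub_add_cancel, W.E_add]
      rfl

/-- Reflection in a vertical line. -/
def mirror {A : Type*} [NonUnitalRing A] (W : LadderAlgebra A) : LadderAlgebra A where
  tn := W.tn.flip
  i := W.i
  s a b := W.s b a
  m a b := W.m b a
  tn_assoc f g h := (W.tn_assoc _ _ _).symm
  zero_tn f := W.tn_zero _
  tn_zero f := W.zero_tn _
  i_tn_mul a f g := W.mul_tn_i _ _ _
  mul_tn_i a f g := W.i_tn_mul _ _ _
  i_mul_i a := W.i_mul_i _
  i_mul_s a b := by rw [add_comm]; exact W.i_mul_s _ _
  s_mul_i a b := W.s_mul_i _ _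
  i_mul_m a b := W.i_mul_m _ _
  m_mul_i a b := by rw [add_comm]; exact W.m_mul_i _ _
  i_neg a h := W.i_neg a h
  s_zero_left a := W.s_zero_right a
  s_zero_right a := W.s_zero_left a
  m_zero_left a := W.m_zero_right a
  m_zero_right a := W.m_zero_left a
  s_s a b c d := by
    have := W.s_s d c b a
    simp only [← W.tn_assoc, AddMonoidHom.flip_apply] at this ⊢
    rw [add_comm c, add_comm a, this]
  s_m a b c d := by
    have := W.m_s d c b a
    simp only [← W.tn_assoc, AddMonoidHom.flip_apply] at this ⊢
    rw [add_comm c, add_comm a, this]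
  m_s a b c d := by
    have := W.s_m d c b a
    simp only [← W.tn_assoc, AddMonoidHom.flip_apply] at this ⊢
    rw [add_comm c, add_comm a, this]
  m_m a b c d := by
    have := W.m_m d c b a
    simp only [← W.tn_assoc, AddMonoidHom.flip_apply] at this ⊢
    rw [add_comm c, add_comm a, this]
  s_assoc a b c := by
    have := (W.s_assoc c b a).symm
    rw [add_comm b a, add_comm c b] at this
    exact this
  m_assoc a b c := by
    have := (W.m_assoc c b a).symm
    rw [add_comm b a, add_comm c b] at this
    exact this
  -- The reflection exchanges the two kinds of rungs, so this axiom is the inverted exchange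
  -- relation.
  swap a b r s N hr hs := W.F_mul_E b a s r N hs hr

end LadderAlgebra

theorem sum_range_eq_sum_range {M : Type*} [AddCommMonoid M] (f : ℕ → M) (m n : ℕ)
    (hm : ∀ p, m ≤ p → f p = 0) (hn : ∀ p, n ≤ p → f p = 0) :
    ∑ p ∈ range m, f p = ∑ p ∈ range n, f p := by
  rcases le_total m n with h | h
  · exact Finset.sum_subset (Finset.range_subset_range.2 h) fun p _ hp => hm p (by simpa using hp)
  · exact (Finset.sum_subset (Finset.range_subset_range.2 h) fun p _ hp =>
      hn p (by simpa using hp)).symm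

theorem mul_mul_of_mul_eq {A : Type*} [Semigroup A] {x y z : A} (h : x * y = z) (t : A) :
    x * (y * t) = z * t := by rw [← mul_assoc, h]

/-! ### Divided powers of rungs, and the square of the crossing -/

namespace LadderAlgebra

variable {A : Type*} [NonUnitalRing A] (W : LadderAlgebra A)

local notation:75 f:76 " ⊙ " g:75 => W.tn f g
local notation "𝕚" => W.i
local notation "𝕤" => W.s
local notation "𝕞" => W.m

/-- (Co)associativity fuses consecutive parallel rungs into one rung that contains a digon. The
digon's value is a hypothesis so that the mirrored version can use it as well, with the other
thickness a natural number. -/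
theorem E_mul_E_of_digon (a b r s : ℤ) (c : ℤ) (h : 𝕤 s r * 𝕞 s r = c • 𝕚 (s + r)) :
    W.E a b r * W.E (a - r) (b + r) s = c • W.E a b (r + s) := by
  obtain ⟨x, rfl⟩ : ∃ x, a = x + s + r := ⟨a - s - r, by ring⟩
  rw [add_sub_cancel_right, W.E_add, W.E_add, show x + s + r = x + (s + r) by ring,
    add_comm r s, W.E_add, add_comm b r]
  have h₁ := W.s_m x s r b
  have h₂ : (𝕤 (x + s) r ⊙ 𝕚 b) * (𝕤 x s ⊙ 𝕚 r ⊙ 𝕚 b) =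
      (𝕤 x (s + r) ⊙ 𝕚 b) * (𝕚 x ⊙ 𝕤 s r ⊙ 𝕚 b) := by
    rw [← W.tn_assoc, ← W.mul_tn_i, W.s_assoc, W.mul_tn_i, W.tn_assoc]
  have h₃ : (𝕚 x ⊙ 𝕚 s ⊙ 𝕞 r b) * (𝕚 x ⊙ 𝕞 s (r + b)) =
      (𝕚 x ⊙ 𝕞 s r ⊙ 𝕚 b) * (𝕚 x ⊙ 𝕞 (s + r) b) := by
    rw [← W.i_tn_mul, ← W.m_assoc, W.i_tn_mul]
  have h₄ : (𝕚 x ⊙ 𝕤 s r ⊙ 𝕚 b) * (𝕚 x ⊙ 𝕞 s r ⊙ 𝕚 b) = c • (𝕚 x ⊙ 𝕚 (s + r) ⊙ 𝕚 b) := by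
    rw [← W.i_tn_mul, ← W.mul_tn_i, h, map_zsmul, AddMonoidHom.zsmul_apply, map_zsmul]
  have h₅ : (𝕤 x (s + r) ⊙ 𝕚 b) * (𝕚 x ⊙ 𝕚 (s + r) ⊙ 𝕚 b) = 𝕤 x (s + r) ⊙ 𝕚 b := by
    rw [← W.tn_assoc, ← W.mul_tn_i, W.s_mul_i]
  calc _ = (𝕤 (x + s) r ⊙ 𝕚 b) * ((𝕚 (x + s) ⊙ 𝕞 r b) * (𝕤 x s ⊙ 𝕚 (r + b))) *
        (𝕚 x ⊙ 𝕞 s (r + b)) := by simp only [mul_assoc]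
    _ = ((𝕤 (x + s) r ⊙ 𝕚 b) * (𝕤 x s ⊙ 𝕚 r ⊙ 𝕚 b)) *
        ((𝕚 x ⊙ 𝕚 s ⊙ 𝕞 r b) * (𝕚 x ⊙ 𝕞 s (r + b))) := by rw [← h₁]; simp only [mul_assoc]
    _ = (𝕤 x (s + r) ⊙ 𝕚 b) * ((𝕚 x ⊙ 𝕤 s r ⊙ 𝕚 b) * (𝕚 x ⊙ 𝕞 s r ⊙ 𝕚 b)) *
        (𝕚 x ⊙ 𝕞 (s + r) b) := by rw [h₂, h₃]; simp only [mul_assoc]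
    _ = _ := by rw [h₄, mul_smul_comm, h₅, smul_mul_assoc]

theorem E_mul_E (a b r : ℤ) (s : ℕ) :
    W.E a b r * W.E (a - r) (b + r) s = Ring.choose (r + s) s • W.E a b (r + s) :=
  W.E_mul_E_of_digon a b r s _ (by rw [W.s_mul_m', add_comm r])

theorem F_mul_F (a b : ℤ) (r : ℕ) (s : ℤ) :
    W.F a b r * W.F (a + r) (b - r) s = Ring.choose (r + s) r • W.F a b (r + s) :=
  W.mirror.E_mul_E_of_digon b a r s _ ((W.s_mul_m' r s).trans (by rw [add_comm s]; rfl))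

/-- The crossing. -/
def X (a b : ℤ) : A :=
  ∑ p ∈ range (a.toNat + 1), (-1 : ℤ) ^ p • (W.E a b (a - p) * W.F p (a + b - p) (b - p))

/-- Once `p` exceeds `a` or `b`, one of the rungs has negative thickness. -/
theorem X_eq_sum (a b : ℤ) (N : ℕ) (h : a < N ∨ b < N) :
    W.X a b = ∑ p ∈ range N, (-1 : ℤ) ^ p • (W.E a b (a - p) * W.F p (a + b - p) (b - p)) := by
  refine sum_range_eq_sum_range _ _ _ (fun p hp => ?_) fun p hp => ?_
  · rw [W.E_neg (by omega), zero_mul, smul_zero]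
  · rcases h with h | h
    · rw [W.E_neg (by omega), zero_mul, smul_zero]
    · rw [W.F_neg (by omega), mul_zero, smul_zero]

/-- The exchange relation has upper index 0 here, so the rungs in each term of the crossing commute
without corrections. Hence the crossing is symmetric under the vertical mirror. -/
theorem E_mul_F_eq_F_mul_E (a b p : ℤ) : W.E a b (a - p) * W.F p (a + b - p) (b - p) =
    W.F a b (b - p) * W.E (a + b - p) p (a - p) := by
  have h := W.E_mul_F a b (b - p) (a - p) ((max (a - p) (b - p)).toNat + 1) (by omega) (by omega)
  rw [Finset.sum_eq_single 0] at h
  · simp only [Nat.cast_zero, sub_zero, Ring.choose_zero_right, one_smul] at h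
    convert h using 3 <;> ring
  · intro t _ ht
    rw [show a - b + (b - p) - (a - p) = 0 by ring, Ring.choose_zero_ite, if_neg ht, zero_smul]
  · simp

theorem X_eq_sum' (a b : ℤ) (N : ℕ) (h : a < N ∨ b < N) :
    W.X a b = ∑ p ∈ range N, (-1 : ℤ) ^ p • (W.F a b (b - p) * W.E (a + b - p) p (a - p)) := by
  simp only [W.X_eq_sum a b N h, E_mul_F_eq_F_mul_E]

theorem mirror_X (a b : ℤ) : W.mirror.X a b = W.X b a := by
  rw [W.X_eq_sum' b a (a.toNat + 1) (by omega)]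
  refine Finset.sum_congr rfl fun p _ => ?_
  rw [add_comm b a]; rfl

theorem X_neg_left {a : ℤ} (h : a < 0) (b : ℤ) : W.X a b = 0 := by
  rw [W.X_eq_sum a b 0 (by simpa using Or.inl h), Finset.sum_range_zero]

theorem X_neg_right {b : ℤ} (h : b < 0) (a : ℤ) : W.X a b = 0 := by
  rw [W.X_eq_sum a b 0 (by simpa using Or.inr h), Finset.sum_range_zero]

/-- This normalises one term of the product of two opposite crossings: the adjacent F-rungs fuse,
the first E-rung is moved past them, and the E-rungs then fuse. -/
theorem E_mul_F_mul_F_mul_E (a b P a' q Q : ℕ) (ha : a = a' + q) (hb : b = Q + q) :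
    (W.E a b (a - b + P) * W.F (b - P) (a + P) P) * (W.F b a a' * W.E (b + a') q Q) =
      ∑ v ∈ range (b + 1), (Ring.choose (a' + P : ℤ) P * Ring.choose (a' : ℤ) v *
        Ring.choose ((P + v : ℕ) : ℤ) Q) •
        (W.F a b (P + v : ℕ) * W.E (a + (P + v : ℕ)) (b - (P + v : ℕ)) (P + v : ℕ)) := by
  have h₁ := W.F_mul_F (b - P) (a + P) P a'
  rw [sub_add_cancel, add_sub_cancel_right] at h₁
  have h₂ := W.E_mul_F a b (P + a') (a - b + P) (a + P + a' + 1) (by omega) (by push_cast; omega)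
  have h₃ : W.E a b (a - b + P) * W.F (b - P) (a + P) (P + a') =
      ∑ v ∈ range (a' + 1), Ring.choose (a' : ℤ) v • (W.F a b (P + v : ℕ) *
        W.E (a + (P + v : ℕ)) (b - (P + v : ℕ)) (P + v - Q)) := by
    rw [show (b : ℤ) - P = a - (a - b + P) by ring, show (a : ℤ) + P = b + (a - b + P) by ring, h₂,
      show (a : ℤ) - b + (P + a') - (a - b + P) = a' by ring]
    -- The upper index is the natural number `a'`, so the sum stops at `t = a'`; it is then indexed
    -- by `v = a' - t`.
    rw [sum_range_eq_sum_range _ (a + P + a' + 1) (a' + 1), ← Finset.sum_range_reflect]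
    · refine Finset.sum_congr rfl fun v hv => ?_
      rw [Finset.mem_range] at hv
      obtain ⟨u, hu⟩ := Nat.exists_eq_add_of_le (Nat.lt_succ_iff.1 hv)
      rw [show a' + 1 - 1 - v = u by omega, Ring.choose_natCast, Ring.choose_natCast, hu,
        Nat.choose_symm_add, show (P : ℤ) + (v + u : ℕ) - u = (P + v : ℕ) by push_cast; ring,
        show (a : ℤ) - b + P - u = P + v - Q by omega]
    · intro t ht
      rw [choose_eq_zero_of_lt (by omega) (by omega), zero_smul]
    · intro t ht
      rw [choose_eq_zero_of_lt (by omega) (by omega), zero_smul]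
  calc _ = W.E a b (a - b + P) * (W.F (b - P) (a + P) P * W.F b a a') * W.E (b + a') q Q := by
        simp only [mul_assoc]
    _ = ∑ v ∈ range (a' + 1), (Ring.choose (a' + P : ℤ) P * Ring.choose (a' : ℤ) v) •
        (W.F a b (P + v : ℕ) * (W.E (a + (P + v : ℕ)) (b - (P + v : ℕ)) (P + v - Q) *
          W.E (b + a') q Q)) := by
        rw [h₁, mul_smul_comm, h₃, Finset.smul_sum, Finset.sum_mul, add_comm (P : ℤ)]
        simp only [smul_smul, smul_mul_assoc, mul_assoc]
    _ = ∑ v ∈ range (a' + 1), (Ring.choose (a' + P : ℤ) P * Ring.choose (a' : ℤ) v *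
        Ring.choose ((P + v : ℕ) : ℤ) Q) •
        (W.F a b (P + v : ℕ) * W.E (a + (P + v : ℕ)) (b - (P + v : ℕ)) (P + v : ℕ)) := by
        refine Finset.sum_congr rfl fun v _ => ?_
        have h := W.E_mul_E (a + (P + v : ℕ)) (b - (P + v : ℕ)) (P + v - Q) Q
        rw [show (a : ℤ) + (P + v : ℕ) - (P + v - Q) = b + a' by omega,
          show (b : ℤ) - (P + v : ℕ) + (P + v - Q) = q by omega,
          show (P : ℤ) + v - Q + Q = (P + v : ℕ) by omega] at h
        rw [h, mul_smul_comm, smul_smul]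
    _ = _ := by
        refine sum_range_eq_sum_range _ _ _ (fun v hv => ?_) fun v hv => ?_
        · rw [choose_eq_zero_of_lt (x := (a' : ℤ)) (by omega) (by omega)]
          simp
        · rw [W.F_of_lt (by omega)]
          simp

/-- Everything is written in terms of F^(n) E^(n). The terms with `P + v = n` contribute a sign by
Vandermonde, and the remaining sum over `q` is an alternating row sum of Pascal's triangle, nonzero
only for `n = 0`. The assumption `b ≤ a` keeps `a - q` a natural number for all `q ≤ b`. -/
theorem X_mul_X_of_le (a b : ℕ) (h : b ≤ a) : W.X a b * W.X b a = 𝕚 a ⊙ 𝕚 b := by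
  -- The first crossing is indexed by `P = b - p`, the thickness of its F-rung.
  have hX : W.X a b = ∑ P ∈ range (b + 1), ((-1) ^ (b + P) : ℤ) •
      (W.E a b (a - b + P) * W.F (b - P) (a + P) P) := by
    rw [W.X_eq_sum a b (b + 1) (by omega), ← Finset.sum_range_reflect]
    refine Finset.sum_congr rfl fun P hP => ?_
    rw [Finset.mem_range] at hP
    obtain ⟨u, rfl⟩ := Nat.exists_eq_add_of_le (Nat.lt_succ_iff.1 hP)
    rw [show P + u + 1 - 1 - P = u by omega, show P + u + P = u + 2 * P by ring, pow_add _ u, pow_mul,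
      neg_one_sq, one_pow, mul_one, show (a : ℤ) - u = a - (P + u : ℕ) + P by omega,
      show (u : ℤ) = (P + u : ℕ) - P by omega,
      show (a : ℤ) + (P + u : ℕ) - ((P + u : ℕ) - P) = a + P by ring,
      show ((P + u : ℕ) : ℤ) - ((P + u : ℕ) - P) = P by ring]
  calc _ = ∑ q ∈ range (b + 1), ∑ P ∈ range (b + 1), ((-1) ^ q * (-1) ^ (b + P) : ℤ) •
        ((W.E a b (a - b + P) * W.F (b - P) (a + P) P) *
          (W.F b a ((a - q : ℕ) : ℤ) * W.E (b + (a - q : ℕ)) q (b - q : ℕ))) := by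
        rw [hX, W.X_eq_sum' b a (b + 1) (by omega), Finset.mul_sum]
        refine Finset.sum_congr rfl fun q hq => ?_
        rw [Finset.mem_range] at hq
        rw [Finset.sum_mul]
        refine Finset.sum_congr rfl fun P hP => ?_
        rw [mul_smul_comm, smul_mul_assoc, smul_smul, Nat.cast_sub (by omega),
          Nat.cast_sub (by omega), add_sub_assoc]
    _ = ∑ q ∈ range (b + 1), ∑ n ∈ range (b + 1), ((-1) ^ q * (-1) ^ b * (-1) ^ n *
        n.choose (b - q) : ℤ) • (W.F a b n * W.E (a + n) (b - n) n) := by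
        refine Finset.sum_congr rfl fun q hq => ?_
        rw [Finset.mem_range] at hq
        simp only [W.E_mul_F_mul_F_mul_E a b _ (a - q) q (b - q) (by omega) (by omega),
          Finset.smul_sum, smul_smul]
        rw [sum_range_range_eq_sum_antidiagonal]
        · refine Finset.sum_congr rfl fun n _ => ?_
          rw [← sum_antidiagonal_neg_one_pow_choose (a - q) n, Finset.mul_sum, Finset.sum_mul,
            Finset.sum_smul]
          refine Finset.sum_congr rfl fun x hx => ?_
          rw [Finset.HasAntidiagonal.mem_antidiagonal.1 hx, Ring.choose_natCast n]
          congr 1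
          ring
        · intro P v hPv
          rw [W.F_of_lt (by omega)]
          simp
    _ = ∑ n ∈ range (b + 1), ((-1 : ℤ) ^ n * ∑ q ∈ range (b + 1), (-1 : ℤ) ^ (b + q) * (n.choose (b - q) : ℤ)) •
        (W.F a b n * W.E (a + n) (b - n) n) := by
        rw [Finset.sum_comm]
        refine Finset.sum_congr rfl fun n _ => ?_
        rw [← Finset.sum_smul, Finset.mul_sum]
        congr 1
        refine Finset.sum_congr rfl fun q _ => ?_
        ring
    _ = ∑ n ∈ range (b + 1), ((-1 : ℤ) ^ n * if n = 0 then 1 else 0) •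
        (W.F a b n * W.E (a + n) (b - n) n) := by
        refine Finset.sum_congr rfl fun n hn => ?_
        rw [Finset.mem_range] at hn
        rw [← Finset.sum_range_reflect, ← Int.alternating_sum_range_choose, ←
          sum_range_eq_sum_range _ (b + 1) (n + 1)]
        · congr 2
          refine Finset.sum_congr rfl fun q hq => ?_
          rw [Finset.mem_range] at hq
          rw [show b - (b + 1 - 1 - q) = q by omega,
            show b + (b + 1 - 1 - q) = q + 2 * (b - q) by omega, pow_add, pow_mul]
          simp
        · intro q hq
          rw [Nat.choose_eq_zero_of_lt (by omega)]; simp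
        · intro q hq
          rw [Nat.choose_eq_zero_of_lt (by omega)]; simp
    _ = _ := by
        rw [Finset.sum_eq_single 0]
        · simp only [pow_zero, if_true, mul_one, one_smul, Nat.cast_zero, add_zero, sub_zero]
          rw [W.F_zero, W.E_zero, ← W.i_tn_mul, W.i_mul_i]
        · intro n _ hn
          simp [hn]
        · simp

theorem X_mul_X (a b : ℤ) : W.X a b * W.X b a = 𝕚 a ⊙ 𝕚 b := by
  rcases lt_or_ge a 0 with ha | ha
  · rw [W.X_neg_left ha, W.i_neg a ha]; simp
  rcases lt_or_ge b 0 with hb | hb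
  · rw [W.X_neg_right hb, W.i_neg b hb]; simp
  lift a to ℕ using ha
  lift b to ℕ using hb
  rcases le_total b a with h | h
  · exact W.X_mul_X_of_le a b h
  · have := W.mirror.X_mul_X_of_le b a h
    rwa [mirror_X, mirror_X] at this

/-! ### Naturality of merges and splits -/

/-- A left strand `a` absorbs the rung of thickness `γ` from a strand, gives away a strand `α`,
which is merged with the strand `δ`. -/
def rungMerge (a c α γ δ : ℤ) : A :=
  (𝕞 a γ ⊙ 𝕚 δ) * (𝕤 c α ⊙ 𝕚 δ) * (𝕚 c ⊙ 𝕞 α δ)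

/-- By associativity the strand `b` can absorb `π` before it is merged with `a`; then a merge is
followed directly by a split, which `merge_mul_split` can resolve. -/
theorem merge_tn_mul_F_mul_E (a b c p π : ℤ) (hc : c = π + p) :
    (𝕞 a b ⊙ 𝕚 c) * (W.F (a + b) c π * W.E (a + b + π) p (a + b - p)) =
      (𝕚 a ⊙ W.F b c π) * (((𝕞 a (b + π) * 𝕤 c (a + b - p)) ⊙ 𝕚 p) * (𝕚 c ⊙ 𝕞 (a + b - p) p)) := by
  subst hc
  rw [add_comm π p, W.F_def, W.F_def, W.E_def, add_sub_cancel_right, add_comm p π,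
    show a + b + π - (a + b - p) = π + p by ring]
  have h₁ := W.m_s a b π p
  have h₂ : (𝕞 a b ⊙ 𝕚 π ⊙ 𝕚 p) * (𝕞 (a + b) π ⊙ 𝕚 p) =
      (𝕚 a ⊙ 𝕞 b π ⊙ 𝕚 p) * (𝕞 a (b + π) ⊙ 𝕚 p) := by
    rw [← W.tn_assoc, ← W.mul_tn_i, W.m_assoc, W.mul_tn_i, W.tn_assoc]
  simp only [W.i_tn_mul, W.mul_tn_i, mul_assoc]
  rw [mul_mul_of_mul_eq h₁, mul_assoc, mul_mul_of_mul_eq h₂, mul_assoc]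

/-- The part `β` of the middle strand that takes no part in the exchange with `a` is merged into `p`
first, as a rung between the two strands on the right; what remains is the common tail `rungMerge`.
-/
theorem F_mul_E_tn_mul_merge (a c p α γ β : ℤ) (h : a + γ = c + α) :
    ((W.F a (γ + β) γ * W.E (a + γ) β α) ⊙ 𝕚 p) * (𝕚 c ⊙ 𝕞 (α + β) p) =
      (𝕚 a ⊙ ((𝕤 γ β ⊙ 𝕚 p) * (𝕚 γ ⊙ 𝕞 β p))) * W.rungMerge a c α γ (β + p) := by
  rw [W.F_def, W.E_def, add_sub_cancel_left, h, add_sub_cancel_right, rungMerge]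
  have h₁ : (𝕚 c ⊙ 𝕞 α β ⊙ 𝕚 p) * (𝕚 c ⊙ 𝕞 (α + β) p) =
      (𝕚 c ⊙ 𝕚 α ⊙ 𝕞 β p) * (𝕚 c ⊙ 𝕞 α (β + p)) := by
    rw [← W.i_tn_mul, W.m_assoc, W.i_tn_mul]
  have h₂ := W.s_m c α β p
  have h₃ := W.m_m a γ β p
  rw [h] at h₃
  simp only [W.i_tn_mul, W.mul_tn_i, mul_assoc, W.tn_assoc]
  rw [h₁, mul_mul_of_mul_eq h₂, mul_assoc, mul_mul_of_mul_eq h₃, mul_assoc]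

theorem E_mul_split_mul_merge (b c p π β γ : ℤ) (q : ℕ) (hc : c = γ + q) (hb : b = β + p)
    (hπ : c = π + p) :
    W.E (b + π) p β * ((𝕤 γ q ⊙ 𝕚 b) * (𝕚 γ ⊙ 𝕞 q b)) =
      Ring.choose (β + q) q • W.E (b + π) p (β + q) := by
  subst hb
  rw [W.E_def, W.E_def, show β + p + π - β = c by omega, show β + p + π - (β + q) = γ by omega,
    hc, add_comm β (q : ℤ)]
  have h₁ := W.s_m γ q β p
  have h₂ : (𝕤 (γ + q) β ⊙ 𝕚 p) * (𝕤 γ q ⊙ 𝕚 β ⊙ 𝕚 p) =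
      (𝕤 γ (q + β) ⊙ 𝕚 p) * (𝕚 γ ⊙ 𝕤 q β ⊙ 𝕚 p) := by
    rw [← W.tn_assoc, ← W.mul_tn_i, W.s_assoc, W.mul_tn_i, W.tn_assoc]
  have h₃ : (𝕚 γ ⊙ 𝕚 q ⊙ 𝕞 β p) * (𝕚 γ ⊙ 𝕞 q (β + p)) =
      (𝕚 γ ⊙ 𝕞 q β ⊙ 𝕚 p) * (𝕚 γ ⊙ 𝕞 (q + β) p) := by
    rw [← W.i_tn_mul, ← W.m_assoc, W.i_tn_mul]
  have h₄ : (𝕚 γ ⊙ 𝕤 q β ⊙ 𝕚 p) * (𝕚 γ ⊙ 𝕞 q β ⊙ 𝕚 p) =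
      Ring.choose (q + β) q • (𝕚 γ ⊙ 𝕚 (q + β) ⊙ 𝕚 p) := by
    rw [← W.i_tn_mul, ← W.mul_tn_i, W.s_mul_m', map_zsmul, AddMonoidHom.zsmul_apply, map_zsmul]
  have h₅ : (𝕤 γ (q + β) ⊙ 𝕚 p) * (𝕚 γ ⊙ 𝕚 (q + β) ⊙ 𝕚 p) = 𝕤 γ (q + β) ⊙ 𝕚 p := by
    rw [← W.tn_assoc, ← W.mul_tn_i, W.s_mul_i]
  simp only [mul_assoc]
  rw [mul_mul_of_mul_eq h₁.symm, mul_assoc, mul_mul_of_mul_eq h₂, h₃, mul_assoc,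
    mul_mul_of_mul_eq h₄, smul_mul_assoc, mul_smul_comm, mul_mul_of_mul_eq h₅]

theorem F_mul_E_mul_F_mul_E_mul_merge (a b c p π α β γ : ℤ) (q : ℕ) (ha : a = α + q)
    (hb : b = β + p) (hc : c = π + p) (hc' : c = γ + q) :
    (𝕚 a ⊙ (W.F b c π * W.E (b + π) p β)) * (((W.F a c γ * W.E (a + γ) q α) ⊙ 𝕚 b) * (𝕚 c ⊙ 𝕞 a b)) =
      Ring.choose (β + q) q •
        ((𝕚 a ⊙ (W.F b c π * W.E (b + π) p (β + q))) * W.rungMerge a c α γ (q + b)) := by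
  have h₁ := W.F_mul_E_tn_mul_merge a c b α γ q (by omega)
  rw [← ha, ← hc'] at h₁
  have h₂ := W.E_mul_split_mul_merge b c p π β γ q hc' hb hc
  rw [h₁, ← mul_assoc, ← W.i_tn_mul, mul_assoc, h₂, mul_smul_comm, map_zsmul, smul_mul_assoc]

/-- This is the exchange relation with an empty left strand in the middle: the merge is an E-rung
that uses all of `a`, and the split an F-rung that starts a new strand. -/
theorem merge_mul_split (a b c d : ℤ) (h : a + b = c + d) (N : ℕ) (ha : a < N) (hc : c < N) :
    𝕞 a b * 𝕤 c d = ∑ q ∈ range N, Ring.choose (c - b) q •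
      (W.F a b (c - q) * W.E (a + (c - q)) (b - (c - q)) (a - q)) := by
  have h₁ := W.E_mul_F a b c a N hc ha
  rw [W.E_left_self, sub_self, add_comm b a, h, W.F_left_zero] at h₁
  rw [h₁]
  refine Finset.sum_congr rfl fun q _ => ?_
  rw [show a - b + c - a = c - b by ring]

/-- Rewriting F E as a combination of E F has the constant upper index `q`. After grouping by `w = p
+ u`, the rung E is too thick for `w < q`, and otherwise the coefficient is a `q`-th difference of a
polynomial of degree `j`. -/
theorem sum_choose_smul_F_mul_E_eq_zero (b c : ℤ) (q j N : ℕ) (hj : j < q) (hN : c < N) :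
    ∑ p ∈ range N, ((-1 : ℤ) ^ p * Ring.choose (p - b - 1) j) •
      (W.F b c (c - p) * W.E (b + (c - p)) p (b - p + q)) = 0 := by
  obtain ⟨M, hM⟩ : ∃ M : ℕ, N ≤ M ∧ b + q < M := ⟨max N (b + q + 1).toNat, by omega, by omega⟩
  have h₁ (p : ℕ) : W.F b c (c - p) * W.E (b + (c - p)) p (b - p + q) =
      ∑ u ∈ range M, Ring.choose (q : ℤ) u • (W.E b c (b + q - (p + u : ℕ)) *
        W.F ((p + u : ℕ) - q) (b + c + q - (p + u : ℕ)) (c - (p + u : ℕ))) := by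
    have h := W.F_mul_E b c (c - p) (b - p + q) M (by omega) (by omega)
    rw [show c - (c - p) = (p : ℤ) by ring, show c - b + (b - p + q) - (c - p) = (q : ℤ) by ring] at h
    rw [h]
    refine Finset.sum_congr rfl fun u _ => ?_
    push_cast
    congr 3 <;> ring
  rw [sum_range_eq_sum_range _ N M]
  · simp only [h₁, Finset.smul_sum, smul_smul]
    rw [sum_range_range_eq_sum_antidiagonal M (fun p u => _)]
    · refine Finset.sum_eq_zero fun w _ => ?_
      rcases lt_or_ge w q with hw | hw
      · refine Finset.sum_eq_zero fun x hx => ?_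
        rw [Finset.HasAntidiagonal.mem_antidiagonal.1 hx, W.E_of_lt (by omega)]
        simp
      · have h := sum_antidiagonal_choose_sub_eq_zero (b + 1) hj hw
        rw [Finset.sum_congr rfl (g := fun x : ℕ × ℕ => ((-1 : ℤ) ^ x.1 *
          (Ring.choose (x.1 - (b + 1)) j * Ring.choose (q : ℤ) x.2)) • (W.E b c (b + q - w) *
            W.F (w - q) (b + c + q - w) (c - w)))]
        · rw [← Finset.sum_smul, h, zero_smul]
        · intro x hx
          rw [Finset.HasAntidiagonal.mem_antidiagonal.1 hx, mul_assoc, sub_sub]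
    · intro p u h
      rw [W.F_neg (by omega)]
      simp
  · intro p hp
    rw [W.F_neg (by omega)]
    simp
  · intro p hp
    rw [W.F_neg (by omega)]
    simp

/-- Merges are natural with respect to crossings. -/
theorem merge_tn_mul_X (a b c : ℤ) : (𝕞 a b ⊙ 𝕚 c) * W.X (a + b) c =
    (𝕚 a ⊙ W.X b c) * ((W.X a c ⊙ 𝕚 b) * (𝕚 c ⊙ 𝕞 a b)) := by
  obtain ⟨N, hc, ha⟩ : ∃ N : ℕ, c < N ∧ a < N := ⟨(max a c).toNat + 1, by omega, by omega⟩
  -- Here `p` numbers the terms of the crossing and `q` comes from resolving the merge followed by a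
  -- split. In `hr` both indices number terms of crossings, and the ladders are the same.
  have hl : (𝕞 a b ⊙ 𝕚 c) * W.X (a + b) c = ∑ q ∈ range N, ∑ p ∈ range N,
      ((-1 : ℤ) ^ p * Ring.choose (p - b) q) • ((𝕚 a ⊙ (W.F b c (c - p) *
        W.E (b + (c - p)) p (b - p + q))) * W.rungMerge a c (a - q) (c - q) (q + b)) := by
    rw [W.X_eq_sum' _ _ N (Or.inr hc), Finset.sum_comm, Finset.mul_sum]
    refine Finset.sum_congr rfl fun p _ => ?_
    have h₁ := W.merge_tn_mul_F_mul_E a b c p (c - p) (by ring)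
    rw [← add_sub_assoc] at h₁
    rw [mul_smul_comm, h₁, W.merge_mul_split a (b + (c - p)) c (a + b - p) (by ring) N ha hc,
      map_sum, AddMonoidHom.finsetSum_apply, Finset.sum_mul, Finset.mul_sum, Finset.smul_sum]
    refine Finset.sum_congr rfl fun q _ => ?_
    have h₂ := W.F_mul_E_tn_mul_merge a c p (a - q) (c - q) (b - p + q) (by ring)
    rw [show c - q + (b - p + q) = b + (c - p) by ring, show a - q + (b - p + q) = a + b - p by ring,
      show b - p + q + p = q + b by ring] at h₂
    rw [map_zsmul, AddMonoidHom.zsmul_apply, smul_mul_assoc, mul_smul_comm, smul_smul,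
      show c - (b + (c - p)) = p - b by ring, show b + (c - p) - (c - q) = b - p + q by ring, h₂,
      ← mul_assoc, ← W.i_tn_mul, W.E_def _ _ (b - p + q),
      show b + (c - p) - (b - p + q) = c - q by ring]
  have hr : (𝕚 a ⊙ W.X b c) * ((W.X a c ⊙ 𝕚 b) * (𝕚 c ⊙ 𝕞 a b)) = ∑ q ∈ range N, ∑ p ∈ range N,
      ((-1 : ℤ) ^ p * Ring.choose (p - b - 1) q) • ((𝕚 a ⊙ (W.F b c (c - p) *
        W.E (b + (c - p)) p (b - p + q))) * W.rungMerge a c (a - q) (c - q) (q + b)) := by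
    rw [W.X_eq_sum' b c N (Or.inr hc), W.X_eq_sum' a c N (Or.inr hc), map_sum, map_sum,
      Finset.sum_comm, Finset.sum_mul]
    refine Finset.sum_congr rfl fun p _ => ?_
    rw [AddMonoidHom.finsetSum_apply, Finset.sum_mul, Finset.mul_sum]
    refine Finset.sum_congr rfl fun q _ => ?_
    have h := W.F_mul_E_mul_F_mul_E_mul_merge a b c p (c - p) (a - q) (b - p) (c - q) q (by ring)
      (by ring) (by ring) (by ring)
    rw [map_zsmul, map_zsmul, AddMonoidHom.zsmul_apply, smul_mul_assoc, smul_mul_assoc,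
      mul_smul_comm, add_sub_assoc, add_sub_assoc, h, smul_smul, smul_smul,
      show (p : ℤ) - b - 1 = -(b - p) - 1 by ring, choose_neg_sub_one, mul_assoc]
  rw [hl, hr, ← sub_eq_zero, ← Finset.sum_sub_distrib]
  refine Finset.sum_eq_zero fun q _ => ?_
  rw [← Finset.sum_sub_distrib]
  cases q with
  | zero => simp
  | succ j =>
    -- The coefficients `Ring.choose (p - b) q` and `Ring.choose (p - b - 1) q` differ by
    -- `Ring.choose (p - b - 1) (q - 1)`, whose degree is one too small to survive the alternating
    -- sum.
    have h := W.sum_choose_smul_F_mul_E_eq_zero b c (j + 1) j N (by omega) hc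
    have h' := congrArg (fun x => (𝕚 a ⊙ x) * W.rungMerge a c (a - (j + 1 : ℕ)) (c - (j + 1 : ℕ)) ((j + 1 : ℕ) + b)) h
    simp only [map_sum, map_zsmul, map_zero, zero_mul, Finset.sum_mul, smul_mul_assoc] at h'
    rw [← h']
    refine Finset.sum_congr rfl fun p _ => ?_
    have := Ring.choose_succ_succ ((p : ℤ) - b - 1) j
    rw [sub_add_cancel] at this
    rw [← sub_smul, this]
    congr 1
    ring

/-- The horizontal reflection exchanges the kinds of rungs and reverses composition, so a product E
F goes to a product E F. -/
theorem op_X (a b : ℤ) : W.op.X a b = .op (W.X b a) := by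
  rw [W.X_eq_sum b a (a.toNat + 1) (by omega), X, Finset.op_sum]
  refine Finset.sum_congr rfl fun p _ => ?_
  rw [MulOpposite.op_smul]
  congr 1
  obtain ⟨x, rfl⟩ : ∃ x, a = p + x := ⟨a - p, by ring⟩
  obtain ⟨y, rfl⟩ : ∃ y, b = p + y := ⟨b - p, by ring⟩
  rw [add_sub_cancel_left, add_sub_cancel_left, show p + x + (p + y) - p = p + x + y by ring,
    show p + y + (p + x) - p = p + y + x by ring, W.op.E_add, W.op.F_add, W.E_add, W.F_add]
  rfl

theorem F_mul_tn (a b r : ℤ) : W.F a b r * (𝕚 (a + r) ⊙ 𝕚 (b - r)) = W.F a b r := by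
  rw [F_def, mul_assoc, ← W.mul_tn_i, W.m_mul_i]

theorem X_mul_tn (a b : ℤ) : W.X a b * (𝕚 b ⊙ 𝕚 a) = W.X a b := by
  rw [X, Finset.sum_mul]
  refine Finset.sum_congr rfl fun p _ => ?_
  have h := W.F_mul_tn p (a + b - p) (b - p)
  rw [show p + (b - p) = b by ring, show a + b - p - (b - p) = a by ring] at h
  rw [smul_mul_assoc, mul_assoc, h]

theorem tn_mul_X (a b : ℤ) : (𝕚 a ⊙ 𝕚 b) * W.X a b = W.X a b := by
  rw [← W.X_mul_X, mul_assoc, W.X_mul_X, X_mul_tn]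

/-- Splits are natural with respect to crossings. -/
theorem split_tn_mul_X (a b c : ℤ) : (𝕤 a b ⊙ 𝕚 c) * ((𝕚 a ⊙ W.X b c) * (W.X a c ⊙ 𝕚 b)) =
    W.X (a + b) c * (𝕚 c ⊙ 𝕤 a b) := by
  -- Reflecting naturality of merges gives this form, with the opposite crossings. The claim follows
  -- by multiplying with the inverse crossings on both sides.
  have h : W.X c (a + b) * (𝕤 a b ⊙ 𝕚 c) =
      (𝕚 c ⊙ 𝕤 a b) * (W.X c a ⊙ 𝕚 b) * (𝕚 a ⊙ W.X c b) := by
    have h := congrArg MulOpposite.unop (W.op.merge_tn_mul_X a b c)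
    simp only [op_X] at h
    exact h
  have h₁ : (𝕚 a ⊙ W.X c b) * (𝕚 a ⊙ W.X b c) = 𝕚 a ⊙ 𝕚 c ⊙ 𝕚 b := by
    rw [← W.i_tn_mul, W.X_mul_X]
  have h₂ : (W.X c a ⊙ 𝕚 b) * (W.X a c ⊙ 𝕚 b) = 𝕚 c ⊙ 𝕚 a ⊙ 𝕚 b := by
    rw [← W.mul_tn_i, W.X_mul_X, W.tn_assoc]
  have h₃ : (𝕚 a ⊙ 𝕚 c ⊙ 𝕚 b) * (W.X a c ⊙ 𝕚 b) = W.X a c ⊙ 𝕚 b := by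
    rw [← W.tn_assoc, ← W.mul_tn_i, W.tn_mul_X]
  have h₄ : (𝕚 c ⊙ 𝕤 a b) * (𝕚 c ⊙ 𝕚 a ⊙ 𝕚 b) = 𝕚 c ⊙ 𝕤 a b := by
    rw [← W.i_tn_mul, W.s_mul_i]
  have h₅ : (𝕚 (a + b) ⊙ 𝕚 c) * (𝕤 a b ⊙ 𝕚 c) = 𝕤 a b ⊙ 𝕚 c := by
    rw [← W.mul_tn_i, W.i_mul_s]
  rw [← h₅, ← W.X_mul_X, mul_assoc, mul_assoc, mul_mul_of_mul_eq h]
  simp only [mul_assoc]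
  rw [mul_mul_of_mul_eq h₁, h₃, h₂, h₄]

/-! ### Crossings with strands of thickness zero or one -/

theorem X_zero_left (a : ℤ) : W.X 0 a = 𝕚 a := by
  rw [W.X_eq_sum 0 a 1 (by simp), Finset.sum_range_one]
  simp only [pow_zero, one_smul, Nat.cast_zero, sub_zero, zero_add]
  rw [W.E_zero, W.F_right_self, W.m_zero_left, W.zero_tn, W.i_mul_i]

theorem X_zero_right (a : ℤ) : W.X a 0 = 𝕚 a := by
  rw [← W.mirror_X]; exact W.mirror.X_zero_left a

theorem X_right_one (c : ℤ) : W.X c 1 =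
    𝕞 c 1 * 𝕤 1 c - (𝕤 1 (c - 1) ⊙ 𝕚 1) * (𝕚 1 ⊙ 𝕞 (c - 1) 1) := by
  have h := W.X_eq_sum' c 1 2 (by simp)
  rw [Finset.sum_range_succ, Finset.sum_range_one] at h
  simp only [pow_zero, one_smul, Nat.cast_zero, sub_zero, pow_one, neg_smul, Nat.cast_one,
    sub_self] at h
  have h₁ := W.E_add 1 1 (c - 1)
  have h₂ := W.i_mul_s 1 (c - 1)
  rw [add_sub_cancel] at h₁ h₂
  rw [h, add_sub_cancel_right, h₁, W.F_right_self, add_comm c 1, W.E_right_zero, W.F_zero,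
    ← sub_eq_add_neg, ← mul_assoc, ← W.mul_tn_i, h₂]

theorem X_left_one (c : ℤ) : W.X 1 c =
    𝕞 1 c * 𝕤 c 1 - (𝕚 1 ⊙ 𝕤 (c - 1) 1) * (𝕞 1 (c - 1) ⊙ 𝕚 1) := by
  rw [← W.mirror_X]; exact W.mirror.X_right_one c

theorem X_one_one : W.X 1 1 = 𝕞 1 1 * 𝕤 1 1 - 𝕚 1 ⊙ 𝕚 1 := by
  rw [X_right_one, sub_self, W.s_zero_right, W.m_zero_left, ← W.mul_tn_i, W.i_mul_i]

/-- Splits are cocommutative. -/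
theorem s_mul_X_one (c : ℕ) : 𝕤 1 c * W.X 1 c = 𝕤 c 1 := by
  have h₁ : 𝕤 1 c * (𝕚 1 ⊙ 𝕤 (c - 1) 1) = 𝕤 c 1 * (𝕤 1 (c - 1) ⊙ 𝕚 1) := by
    have := W.s_assoc 1 (c - 1) 1
    rw [add_sub_cancel, sub_add_cancel] at this
    exact this.symm
  have h₂ : 𝕤 1 (c - 1) * 𝕞 1 (c - 1) = (c : ℤ) • 𝕚 c := by
    have := W.s_mul_m' 1 (c - 1)
    rwa [Nat.cast_one, add_sub_cancel, Ring.choose_one_right] at this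
  have h₃ : 𝕤 1 c * 𝕞 1 c = (c + 1 : ℤ) • 𝕚 (c + 1) := by
    have := W.s_mul_m' 1 c
    rwa [Nat.cast_one, Ring.choose_one_right, add_comm 1 (c : ℤ)] at this
  -- The digons contribute the coefficients `c + 1` and `c`, which differ by one.
  rw [X_left_one, mul_sub, mul_mul_of_mul_eq h₃, mul_mul_of_mul_eq h₁, mul_assoc, ← W.mul_tn_i, h₂,
    map_zsmul, AddMonoidHom.zsmul_apply, mul_smul_comm, smul_mul_assoc, W.s_mul_i, W.i_mul_s,
    ← sub_smul, add_sub_cancel_left, one_smul]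

theorem X_one_one_mul_m : W.X 1 1 * 𝕞 1 1 = 𝕞 1 1 := by
  have h := W.s_mul_m' 1 1
  simp only [Nat.cast_one, Ring.choose_one_right] at h
  rw [X_one_one, sub_mul, mul_assoc, h, mul_smul_comm, W.m_mul_i, W.i_mul_m, add_smul, one_smul,
    add_sub_cancel_right]

theorem s_mul_X_one_one : 𝕤 1 1 * W.X 1 1 = 𝕤 1 1 := by
  have := W.s_mul_X_one 1
  rwa [Nat.cast_one] at this

/-- The exchange relation gives F E plus `1 - c` times the identity, and replacing the inner merge
and split by `X 1 1 + 1` adds a digon worth `c`. The correction factors through a thinner merge,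
which makes induction on thickness possible over any ring. -/
theorem merge_mul_split_one (c : ℕ) : 𝕞 1 c * 𝕤 1 c = 𝕚 1 ⊙ 𝕚 c +
    (𝕚 1 ⊙ 𝕤 1 (c - 1)) * ((W.X 1 1 ⊙ 𝕚 (c - 1)) * (𝕚 1 ⊙ 𝕞 1 (c - 1))) := by
  have h₂ : 𝕤 1 (c - 1) * 𝕞 1 (c - 1) = (c : ℤ) • 𝕚 c := by
    have := W.s_mul_m' 1 (c - 1)
    rwa [Nat.cast_one, add_sub_cancel, Ring.choose_one_right] at this
  have h := W.E_mul_F 1 c 1 1 2 (by simp) (by simp)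
  rw [W.E_left_self, sub_self, add_comm (c : ℤ) 1, W.F_left_zero, Finset.sum_range_succ,
    Finset.sum_range_one] at h
  simp only [Nat.cast_zero, sub_zero, Nat.cast_one, sub_self, Ring.choose_zero_right, one_smul,
    add_sub_cancel_right, Ring.choose_one_right, add_zero] at h
  have h₃ := W.E_add 1 (c - 1) 1
  have h₄ : (𝕚 1 ⊙ 𝕤 1 (c - 1)) * ((𝕚 1 ⊙ 𝕚 1 ⊙ 𝕚 (c - 1)) * (𝕚 1 ⊙ 𝕞 1 (c - 1))) =
      (c : ℤ) • (𝕚 1 ⊙ 𝕚 c) := by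
    rw [← W.i_tn_mul, W.i_mul_m, ← W.i_tn_mul, h₂, map_zsmul]
  have h₅ : W.F 1 c 1 * W.E (1 + 1) (c - 1) 1 = (𝕚 1 ⊙ 𝕤 1 (c - 1)) *
      (((𝕞 1 1 * 𝕤 1 1) ⊙ 𝕚 (c - 1)) * (𝕚 1 ⊙ 𝕞 1 (c - 1))) := by
    rw [h₃, F_def, W.mul_tn_i]
    simp only [mul_assoc]
  rw [h, W.F_zero, W.E_zero, ← W.i_tn_mul, W.i_mul_i, h₅, X_one_one, map_sub,
    AddMonoidHom.sub_apply, sub_mul, mul_sub, W.tn_assoc, h₄, sub_smul, one_smul]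
  abel

theorem tn_merge_mul_X (a b c : ℤ) : (𝕚 c ⊙ 𝕞 a b) * W.X c (a + b) =
    (W.X c a ⊙ 𝕚 b) * ((𝕚 a ⊙ W.X c b) * (𝕞 a b ⊙ 𝕚 c)) := by
  have h := W.mirror.merge_tn_mul_X b a c
  simp only [mirror_X] at h
  rw [add_comm a b]
  exact h

/-- The braid relation. -/
theorem X_one_one_braid : (W.X 1 1 ⊙ 𝕚 1) * ((𝕚 1 ⊙ W.X 1 1) * (W.X 1 1 ⊙ 𝕚 1)) =
    (𝕚 1 ⊙ W.X 1 1) * ((W.X 1 1 ⊙ 𝕚 1) * (𝕚 1 ⊙ W.X 1 1)) := by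
  have hm := W.merge_tn_mul_X 1 1 1
  have hs := W.split_tn_mul_X 1 1 1
  -- Naturality of splits and merges moves `𝕞 1 1 * 𝕤 1 1`, which is the crossing plus the identity;
  -- the identity parts agree and cancel.
  have h : ((𝕞 1 1 * 𝕤 1 1) ⊙ 𝕚 1) * ((𝕚 1 ⊙ W.X 1 1) * (W.X 1 1 ⊙ 𝕚 1)) =
      (𝕚 1 ⊙ W.X 1 1) * ((W.X 1 1 ⊙ 𝕚 1) * (𝕚 1 ⊙ (𝕞 1 1 * 𝕤 1 1))) := by
    rw [W.mul_tn_i, mul_assoc, hs, mul_mul_of_mul_eq hm, W.i_tn_mul]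
    simp only [mul_assoc]
  have h₁ : ((𝕚 1 ⊙ 𝕚 1) ⊙ 𝕚 1) * ((𝕚 1 ⊙ W.X 1 1) * (W.X 1 1 ⊙ 𝕚 1)) =
      (𝕚 1 ⊙ W.X 1 1) * (W.X 1 1 ⊙ 𝕚 1) := by
    rw [W.tn_assoc, ← mul_assoc, ← W.i_tn_mul, W.tn_mul_X]
  have h₂ : (W.X 1 1 ⊙ 𝕚 1) * (𝕚 1 ⊙ 𝕚 1 ⊙ 𝕚 1) = W.X 1 1 ⊙ 𝕚 1 := by
    rw [← W.tn_assoc, ← W.mul_tn_i, W.X_mul_tn]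
  have h₃ : 𝕞 1 1 * 𝕤 1 1 = W.X 1 1 + 𝕚 1 ⊙ 𝕚 1 := by rw [X_one_one, sub_add_cancel]
  rw [h₃, map_add, AddMonoidHom.add_apply, add_mul, h₁, map_add, mul_add, mul_add, h₂] at h
  exact add_right_cancel h

/-! ### Odd caps pass through crossings -/

/-- The relations of an odd cap `n` and the antenna `α` with splits and merges. -/
structure IsCap (n α : A) : Prop where
  tn_mul : (𝕚 1 ⊙ 𝕚 1) * n = n
  split_mul : 𝕤 1 1 * n = α + α
  merge_mul : 𝕞 1 1 * α = n
  merge_tn (a b : ℤ) : (𝕞 a b ⊙ 𝕚 1 ⊙ 𝕚 1) * (𝕚 (a + b) ⊙ n) = (𝕚 a ⊙ 𝕚 b ⊙ n) * 𝕞 a b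
  tn_merge (a b : ℤ) : (𝕚 1 ⊙ 𝕚 1 ⊙ 𝕞 a b) * (n ⊙ 𝕚 (a + b)) = (n ⊙ 𝕚 a ⊙ 𝕚 b) * 𝕞 a b
  X_tn_X (a : ℤ) : (𝕚 1 ⊙ 𝕚 1 ⊙ W.X a 1) * (W.X 1 1 ⊙ 𝕚 1 ⊙ 𝕚 a) =
    (W.X 1 1 ⊙ 𝕚 a ⊙ 𝕚 1) * (𝕚 1 ⊙ 𝕚 1 ⊙ W.X a 1)
  split_split (c : ℕ) : 0 < c → 𝕤 1 c * ((𝕚 1 ⊙ 𝕤 1 (c - 1)) * (n ⊙ 𝕚 (c - 1))) =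
    𝕤 (c - 1) 2 * (𝕚 (c - 1) ⊙ α) + 𝕤 (c - 1) 2 * (𝕚 (c - 1) ⊙ α)
  rungR (c : ℕ) : 0 < c → (𝕤 1 c ⊙ 𝕚 1) * ((𝕚 1 ⊙ (𝕞 c 1 * 𝕤 1 c)) * (n ⊙ 𝕚 c)) =
    (𝕤 c 1 ⊙ 𝕚 1) * (𝕚 c ⊙ n) +
      ((((𝕤 (c - 1) 2 * (𝕚 (c - 1) ⊙ α)) ⊙ 𝕚 1) * 𝕞 (c - 1) 1) +
        ((𝕤 (c - 1) 2 * (𝕚 (c - 1) ⊙ α)) ⊙ 𝕚 1) * 𝕞 (c - 1) 1)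
  rungL : (𝕚 1 ⊙ 𝕤 1 1) * (((𝕞 1 1 * 𝕤 1 1) ⊙ 𝕚 1) * (𝕚 1 ⊙ n)) =
    (𝕚 1 ⊙ 𝕤 1 1) * (n ⊙ 𝕚 1) + (𝕚 1 ⊙ (α + α))

namespace IsCap

variable {W} {n α : A} (h : W.IsCap n α)

include h

theorem X_mul : W.X 1 1 * n = n := by
  rw [← h.merge_mul, ← mul_assoc, W.X_one_one_mul_m]

/-- Writing the crossing as merge-split minus a rung, the antenna terms from `rungR` and from
`split_split` cancel. What is left is the cap on the other side, where the split absorbs the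
crossing by cocommutativity. -/
theorem split_tn_mul (c : ℕ) (hc : 0 < c) :
    (𝕤 1 c ⊙ 𝕚 1) * ((𝕚 1 ⊙ W.X c 1) * (n ⊙ 𝕚 c)) =
      (𝕤 1 c ⊙ 𝕚 1) * ((W.X 1 c ⊙ 𝕚 1) * (𝕚 c ⊙ n)) := by
  have h₁ : (𝕚 1 ⊙ 𝕚 1 ⊙ 𝕞 (c - 1) 1) * (n ⊙ 𝕚 c) = (n ⊙ 𝕚 (c - 1) ⊙ 𝕚 1) * 𝕞 (c - 1) 1 := by
    have := h.tn_merge (c - 1) 1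
    rwa [sub_add_cancel] at this
  have h₂ : (𝕤 1 c ⊙ 𝕚 1) * ((𝕚 1 ⊙ 𝕤 1 (c - 1) ⊙ 𝕚 1) * ((n ⊙ 𝕚 (c - 1) ⊙ 𝕚 1) * 𝕞 (c - 1) 1)) =
      (((𝕤 (c - 1) 2 * (𝕚 (c - 1) ⊙ α)) ⊙ 𝕚 1) * 𝕞 (c - 1) 1) +
        ((𝕤 (c - 1) 2 * (𝕚 (c - 1) ⊙ α)) ⊙ 𝕚 1) * 𝕞 (c - 1) 1 := by
    rw [← add_mul, ← AddMonoidHom.add_apply, ← map_add, ← h.split_split c hc]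
    simp only [W.mul_tn_i, W.tn_assoc, mul_assoc]
  have h₃ : (𝕤 1 c ⊙ 𝕚 1) * ((W.X 1 c ⊙ 𝕚 1) * (𝕚 c ⊙ n)) = (𝕤 c 1 ⊙ 𝕚 1) * (𝕚 c ⊙ n) := by
    rw [← mul_assoc, ← W.mul_tn_i, W.s_mul_X_one c]
  rw [h₃, X_right_one, map_sub, sub_mul, mul_sub, h.rungR c hc, W.i_tn_mul, mul_assoc, h₁, h₂,
    add_sub_cancel_right]

theorem tn_split_mul : (𝕚 1 ⊙ 𝕤 1 1) * ((𝕚 1 ⊙ W.X 1 1) * (n ⊙ 𝕚 1)) =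
    (𝕚 1 ⊙ 𝕤 1 1) * ((W.X 1 1 ⊙ 𝕚 1) * (𝕚 1 ⊙ n)) := by
  have h₁ : 𝕚 1 ⊙ (α + α) = (𝕚 1 ⊙ 𝕤 1 1) * (((𝕚 1 ⊙ 𝕚 1) ⊙ 𝕚 1) * (𝕚 1 ⊙ n)) := by
    rw [W.tn_assoc, ← W.i_tn_mul, ← W.i_tn_mul, h.tn_mul, h.split_mul]
  have h₂ := h.rungL
  rw [h₁, ← sub_eq_iff_eq_add, ← mul_sub, ← sub_mul, ← AddMonoidHom.sub_apply, ← map_sub,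
    ← X_one_one] at h₂
  rw [h₂, ← mul_assoc, ← W.i_tn_mul, W.s_mul_X_one_one]

/-- Let s, t be the crossings of the first and last two of three strands, and M, N the cap on the
first and last two. The claim is tM = sN. Composing the preceding lemmas with merges gives stM + tM
= N + sN and M + tM = tsN + sN. Applying t to the former and using tst = sts with sM = M and tN = N
gives stM + M = N + tsN. A signed sum of the three yields 2tM = 2sN. -/
theorem X_tn_mul_one (h2 : ∀ x : A, x + x = 0 → x = 0) :
    (𝕚 1 ⊙ W.X 1 1) * (n ⊙ 𝕚 1) = (W.X 1 1 ⊙ 𝕚 1) * (𝕚 1 ⊙ n) := by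
  have hms : 𝕞 1 1 * 𝕤 1 1 = W.X 1 1 + 𝕚 1 ⊙ 𝕚 1 := by rw [X_one_one, sub_add_cancel]
  have hs : (W.X 1 1 ⊙ 𝕚 1) * (n ⊙ 𝕚 1) = n ⊙ 𝕚 1 := by rw [← W.mul_tn_i, h.X_mul]
  have ht : (𝕚 1 ⊙ W.X 1 1) * (𝕚 1 ⊙ n) = 𝕚 1 ⊙ n := by rw [← W.i_tn_mul, h.X_mul]
  have hss : (W.X 1 1 ⊙ 𝕚 1) * ((W.X 1 1 ⊙ 𝕚 1) * (𝕚 1 ⊙ n)) = 𝕚 1 ⊙ n := by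
    rw [← mul_assoc, ← W.mul_tn_i, W.X_mul_X, W.tn_assoc, ← W.i_tn_mul, h.tn_mul]
  have htt : (𝕚 1 ⊙ W.X 1 1) * ((𝕚 1 ⊙ W.X 1 1) * (n ⊙ 𝕚 1)) = n ⊙ 𝕚 1 := by
    rw [← mul_assoc, ← W.i_tn_mul, W.X_mul_X, ← W.tn_assoc, ← W.mul_tn_i, h.tn_mul]
  have hi (f : A) : ((𝕚 1 ⊙ 𝕚 1) ⊙ 𝕚 1) * ((𝕚 1 ⊙ W.X 1 1) * f) = (𝕚 1 ⊙ W.X 1 1) * f := by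
    rw [← mul_assoc, W.tn_assoc, ← W.i_tn_mul, W.tn_mul_X]
  have hi' (f : A) : ((𝕚 1 ⊙ 𝕚 1) ⊙ 𝕚 1) * ((W.X 1 1 ⊙ 𝕚 1) * f) = (W.X 1 1 ⊙ 𝕚 1) * f := by
    rw [← mul_assoc, ← W.mul_tn_i, W.tn_mul_X]
  have e₁ := congrArg (fun x => (𝕞 1 1 ⊙ 𝕚 1) * x) (h.split_tn_mul 1 one_pos)
  have e₂ := congrArg (fun x => (𝕚 1 ⊙ 𝕞 1 1) * x) h.tn_split_mul
  simp only [Nat.cast_one, ← mul_assoc (𝕞 1 1 ⊙ 𝕚 1), ← mul_assoc (𝕚 1 ⊙ 𝕞 1 1), ← W.mul_tn_i,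
    ← W.i_tn_mul] at e₁ e₂
  rw [hms, map_add, AddMonoidHom.add_apply, add_mul, add_mul, hss, hi, hi'] at e₁
  rw [hms, map_add, add_mul, add_mul, htt, ← W.tn_assoc, hi, hi'] at e₂
  -- The braid relation then identifies the only word of length three with one of length two,
  -- because the cap absorbs a crossing.
  have e₃ := congrArg (fun x => (𝕚 1 ⊙ W.X 1 1) * x) e₁
  have hb := congrArg (fun x => x * (n ⊙ 𝕚 1)) W.X_one_one_braid
  simp only [mul_assoc, hs] at hb
  simp only [mul_add, htt, ht, ← hb] at e₃
  rw [← sub_eq_zero]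
  apply h2
  generalize (𝕚 1 ⊙ W.X 1 1) * ((W.X 1 1 ⊙ 𝕚 1) * (𝕚 1 ⊙ n)) = a₁ at *
  generalize (W.X 1 1 ⊙ 𝕚 1) * ((𝕚 1 ⊙ W.X 1 1) * (n ⊙ 𝕚 1)) = a₂ at *
  generalize (W.X 1 1 ⊙ 𝕚 1) * (𝕚 1 ⊙ n) = a₃ at *
  generalize (𝕚 1 ⊙ W.X 1 1) * (n ⊙ 𝕚 1) = a₄ at *
  rw [← sub_eq_zero] at e₁ e₂ e₃
  have h₀ := congrArg₂ (fun x y => x + y) (congrArg₂ (fun x y => x - y) e₁ e₃) e₂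
  simp only [sub_self, add_zero] at h₀
  rw [← h₀]
  abel

/-- The identity is known after a split, hence after a merge followed by a split. By
`merge_mul_split_one` the latter is the identity plus a term through a thinner merge, on which both
sides agree by the induction hypothesis and the case of thickness one. -/
theorem X_tn_mul (h2 : ∀ x : A, x + x = 0 → x = 0) (c : ℕ) :
    (𝕚 1 ⊙ W.X c 1) * (n ⊙ 𝕚 c) = (W.X 1 c ⊙ 𝕚 1) * (𝕚 c ⊙ n) := by
  induction c with
  | zero =>
    rw [Nat.cast_zero, X_zero_left, X_zero_right, W.zero_tn, W.tn_zero, h.tn_mul]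
  | succ c ih =>
    rcases Nat.eq_zero_or_pos c with rfl | hc
    · simpa using h.X_tn_mul_one h2
    -- After the merge, the thick strand is crossed as strands `1` and `c` one at a time. `h₁` and
    -- `h₂` bring the two sides to the same expression.
    have h₁ : (𝕚 1 ⊙ 𝕞 1 c ⊙ 𝕚 1) * ((𝕚 1 ⊙ W.X (1 + c) 1) * (n ⊙ 𝕚 (1 + c))) =
        (W.X 1 1 ⊙ 𝕚 c ⊙ 𝕚 1) * ((𝕚 1 ⊙ W.X 1 c ⊙ 𝕚 1) * ((𝕚 1 ⊙ 𝕚 c ⊙ n) * 𝕞 1 c)) := by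
      have e₁ : (𝕚 1 ⊙ W.X 1 1 ⊙ 𝕚 c) * (n ⊙ 𝕚 1 ⊙ 𝕚 c) =
          (W.X 1 1 ⊙ 𝕚 1 ⊙ 𝕚 c) * (𝕚 1 ⊙ n ⊙ 𝕚 c) := by
        simp only [← W.tn_assoc]
        rw [← W.mul_tn_i, h.X_tn_mul_one h2, W.mul_tn_i]
      have e₂ : (𝕚 1 ⊙ 𝕚 1 ⊙ W.X c 1) * (𝕚 1 ⊙ n ⊙ 𝕚 c) =
          (𝕚 1 ⊙ W.X 1 c ⊙ 𝕚 1) * (𝕚 1 ⊙ 𝕚 c ⊙ n) := by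
        rw [← W.i_tn_mul, ih, W.i_tn_mul]
      rw [← mul_assoc, ← W.i_tn_mul, W.merge_tn_mul_X, W.i_tn_mul, W.i_tn_mul, mul_assoc, mul_assoc,
        h.tn_merge, mul_mul_of_mul_eq e₁, mul_assoc, mul_mul_of_mul_eq (h.X_tn_X c), mul_assoc,
        mul_mul_of_mul_eq e₂, mul_assoc]
    have h₂ : (𝕚 1 ⊙ 𝕞 1 c ⊙ 𝕚 1) * ((W.X 1 (1 + c) ⊙ 𝕚 1) * (𝕚 (1 + c) ⊙ n)) =
        (W.X 1 1 ⊙ 𝕚 c ⊙ 𝕚 1) * ((𝕚 1 ⊙ W.X 1 c ⊙ 𝕚 1) * ((𝕚 1 ⊙ 𝕚 c ⊙ n) * 𝕞 1 c)) := by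
      rw [← W.tn_assoc, ← mul_assoc, ← W.mul_tn_i, W.tn_merge_mul_X, W.mul_tn_i, W.mul_tn_i,
        mul_assoc, mul_assoc, W.tn_assoc, W.tn_assoc, W.tn_assoc, h.merge_tn]
    have h₃ := congrArg (fun x => (𝕞 1 (c + 1 : ℕ) ⊙ 𝕚 1) * x) (h.split_tn_mul (c + 1) (by omega))
    have hc' : ((c + 1 : ℕ) : ℤ) = 1 + c := by push_cast; ring
    have h₄ := W.merge_mul_split_one (c + 1)
    have e₁ : ((𝕚 1 ⊙ 𝕚 (1 + c)) ⊙ 𝕚 1) * ((𝕚 1 ⊙ W.X (1 + c) 1) * (n ⊙ 𝕚 (1 + c))) =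
        (𝕚 1 ⊙ W.X (1 + c) 1) * (n ⊙ 𝕚 (1 + c)) := by
      rw [W.tn_assoc, ← mul_assoc, ← W.i_tn_mul, W.tn_mul_X]
    have e₂ : ((𝕚 1 ⊙ 𝕚 (1 + c)) ⊙ 𝕚 1) * ((W.X 1 (1 + c) ⊙ 𝕚 1) * (𝕚 (1 + c) ⊙ n)) =
        (W.X 1 (1 + c) ⊙ 𝕚 1) * (𝕚 (1 + c) ⊙ n) := by
      rw [← mul_assoc, ← W.mul_tn_i, W.tn_mul_X]
    rw [hc'] at h₃ h₄ ⊢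
    rw [add_sub_cancel_left] at h₄
    simp only [← mul_assoc (𝕞 1 (1 + c) ⊙ 𝕚 1), ← W.mul_tn_i, h₄] at h₃
    rw [map_add, AddMonoidHom.add_apply, add_mul, add_mul, e₁, e₂, W.mul_tn_i, W.mul_tn_i,
      W.tn_assoc (𝕚 1) (𝕞 1 c), mul_assoc, mul_assoc, mul_assoc, mul_assoc, h₁, h₂] at h₃
    exact add_right_cancel h₃

/-- Caps are natural with respect to crossings. -/
theorem tn_mul_X (h2 : ∀ x : A, x + x = 0 → x = 0) (c : ℕ) :
    (𝕚 1 ⊙ W.X 1 c) * ((W.X 1 c ⊙ 𝕚 1) * (𝕚 c ⊙ n)) = n ⊙ 𝕚 c := by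
  rw [← h.X_tn_mul h2, ← mul_assoc, ← W.i_tn_mul, W.X_mul_X, ← W.tn_assoc, ← W.mul_tn_i, h.tn_mul]

end IsCap

end LadderAlgebra

end Ladders

/-! ### Symmetric crossings in a total algebra -/

/-- The total algebra of a strict monoidal supercategory whose monoid of objects is free on `S`.
The multiplication is composition (in diagrammatic order) and `tn` is the product of morphisms. -/
structure MorphismAlgebra (k S A : Type*) [CommRing k] [NonUnitalRing A] [Module k A] where
  tn : A →ₗ[k] A →ₗ[k] A
  e : List S → A
  homs : List S → List S → Submodule k A
  phoms : List S → List S → ZMod 2 → Submodule k A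
  phoms_le {X Y : List S} {p : ZMod 2} : phoms X Y p ≤ homs X Y
  e_mem (X : List S) : e X ∈ phoms X X 0
  mul_mem {X Y Z : List S} {f g : A} : f ∈ homs X Y → g ∈ homs Y Z → f * g ∈ homs X Z
  tn_mem {X Y X' Y' : List S} {f g : A} : f ∈ homs X Y → g ∈ homs X' Y' →
    tn f g ∈ homs (X ++ X') (Y ++ Y')
  mul_mem_even {X Y Z : List S} {f g : A} : f ∈ phoms X Y 0 → g ∈ phoms Y Z 0 → f * g ∈ phoms X Z 0
  tn_mem_even {X Y X' Y' : List S} {f g : A} : f ∈ phoms X Y 0 → g ∈ phoms X' Y' 0 →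
    tn f g ∈ phoms (X ++ X') (Y ++ Y') 0
  e_mul {X Y : List S} {f : A} : f ∈ homs X Y → e X * f = f
  mul_e {X Y : List S} {f : A} : f ∈ homs X Y → f * e Y = f
  e_tn_e (X Y : List S) : tn (e X) (e Y) = e (X ++ Y)
  tn_assoc (f g h : A) : tn (tn f g) h = tn f (tn g h)
  nil_tn (f : A) : tn (e []) f = f
  tn_nil (f : A) : tn f (e []) = f
  e_tn_mul (X : List S) (f g : A) : tn (e X) (f * g) = tn (e X) f * tn (e X) g
  tn_e_mul (X : List S) (f g : A) : tn (f * g) (e X) = tn f (e X) * tn g (e X)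
  tn_eq_right_left {X Y X' Y' : List S} {f g : A} : f ∈ homs X Y → g ∈ homs X' Y' →
    tn (e X) g * tn f (e Y') = tn f g
  tn_eq_left_right {X Y X' Y' : List S} {f g : A} {p q : ZMod 2} : f ∈ phoms X Y p →
    g ∈ phoms X' Y' q → tn f (e X') * tn (e Y) g = superSign k (p * q) • tn f g
  slide {X Y X' Y' : List S} {f g : A} : f ∈ phoms X Y 0 → g ∈ homs X' Y' →
    tn f (e X') * tn (e Y) g = tn (e X) g * tn f (e Y')
  slide' {X Y X' Y' : List S} {f g : A} : f ∈ homs X Y → g ∈ phoms X' Y' 0 →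
    tn f (e X') * tn (e Y) g = tn (e X) g * tn f (e Y')

/-- The total algebra of a presented supercategory. -/
noncomputable def SuperPresentation.morphismAlgebra {k : Type*} [CommRing k]
    (P : SuperPresentation k) : MorphismAlgebra k P.Strand P.Alg where
  tn := P.tn
  e := P.e
  homs := P.homs
  phoms := P.phoms
  phoms_le h := phoms_le h
  e_mem := e_mem
  mul_mem := mul_mem
  tn_mem := tn_mem
  mul_mem_even := mul_mem_even
  tn_mem_even := tn_mem_even
  e_mul := e_mul
  mul_e := mul_e
  e_tn_e := e_tn_e
  tn_assoc := tn_assoc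
  nil_tn := nil_tn
  tn_nil := tn_nil
  e_tn_mul := e_tn_mul
  tn_e_mul := tn_e_mul
  tn_eq_right_left := tn_eq_right_left
  tn_eq_left_right := tn_eq_left_right
  slide := slide
  slide' := slide'

namespace MorphismAlgebra

variable {k S A : Type*} [CommRing k] [NonUnitalRing A] [Module k A] (T : MorphismAlgebra k S A)

local notation:75 f:76 " ⊙ " g:75 => T.tn f g

section Cross

theorem e_mul_e (X : List S) : T.e X * T.e X = T.e X := T.e_mul (T.phoms_le (T.e_mem X))

theorem e_cons (x : S) (X : List S) : T.e (x :: X) = T.e [x] ⊙ T.e X := (T.e_tn_e [x] X).symm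

variable {T} in
theorem homs_cast {X Y X' Y' : List S} {f : A} (h : f ∈ T.homs X Y) (hX : X = X') (hY : Y = Y') :
    f ∈ T.homs X' Y' := hX ▸ hY ▸ h

variable {T} in
theorem phoms_cast {X Y X' Y' : List S} {p : ZMod 2} {f : A} (h : f ∈ T.phoms X Y p) (hX : X = X')
    (hY : Y = Y') : f ∈ T.phoms X' Y' p := hX ▸ hY ▸ h

variable (c : S → S → A)

/-- The crossing of a strand with a word, where `c` are the crossings of strands. -/
def crossOne (x : S) : List S → A
  | [] => T.e [x]
  | y :: Y => (c x y ⊙ T.e Y) * (T.e [y] ⊙ crossOne x Y)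

/-- The crossing of two words, where `c` are the crossings of strands. -/
def cross : List S → List S → A
  | [], Y => T.e Y
  | x :: X, Y => (T.e [x] ⊙ cross X Y) * (T.crossOne c x Y ⊙ T.e X)

variable {c} (hc : ∀ x y, c x y ∈ T.phoms ([x] ++ [y]) ([y] ++ [x]) 0)

include hc in
theorem crossOne_mem (x : S) (Y : List S) : T.crossOne c x Y ∈ T.phoms ([x] ++ Y) (Y ++ [x]) 0 := by
  induction Y with
  | nil => exact T.e_mem _
  | cons y Y ih =>
    have h := T.tn_mem_even (hc x y) (T.e_mem Y)
    have h' := T.tn_mem_even (T.e_mem [y]) ih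
    exact T.mul_mem_even h h'

include hc in
theorem cross_mem (X Y : List S) : T.cross c X Y ∈ T.phoms (X ++ Y) (Y ++ X) 0 := by
  induction X with
  | nil => exact phoms_cast (T.e_mem Y) rfl (by simp)
  | cons x X ih =>
    have h := T.tn_mem_even (T.e_mem [x]) ih
    have h' := T.tn_mem_even (T.crossOne_mem hc x Y) (T.e_mem X)
    exact T.mul_mem_even h (phoms_cast h' (by simp) (by simp))

theorem cross_nil_left (Y : List S) : T.cross c [] Y = T.e Y := rfl

include hc in
theorem cross_singleton_left (x : S) (Y : List S) : T.cross c [x] Y = T.crossOne c x Y := by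
  rw [cross, cross_nil_left, T.tn_nil, T.e_tn_e, T.e_mul (T.phoms_le (T.crossOne_mem hc x Y))]

theorem cross_nil_right (X : List S) : T.cross c X [] = T.e X := by
  induction X with
  | nil => rfl
  | cons x X ih => rw [cross, ih, crossOne, T.e_tn_e, T.e_mul_e]; rfl

include hc in
theorem cross_append_left (X Y Z : List S) :
    T.cross c (X ++ Y) Z = (T.e X ⊙ T.cross c Y Z) * (T.cross c X Z ⊙ T.e Y) := by
  induction X with
  | nil =>
    rw [cross_nil_left, T.nil_tn, T.e_tn_e, T.mul_e (T.phoms_le (T.cross_mem hc Y Z))]; rfl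
  | cons x X ih =>
    rw [List.cons_append, cross, ih, cross, T.e_tn_mul, T.tn_e_mul, ← T.e_tn_e X Y, T.e_cons x X]
    simp only [T.tn_assoc, mul_assoc]

include hc in
theorem crossOne_append (x : S) (Y Z : List S) : T.crossOne c x (Y ++ Z) =
    (T.crossOne c x Y ⊙ T.e Z) * (T.e Y ⊙ T.crossOne c x Z) := by
  induction Y with
  | nil => rw [crossOne, T.nil_tn, T.e_tn_e, T.e_mul (T.phoms_le (T.crossOne_mem hc x Z))]; rfl
  | cons y Y ih =>
    rw [List.cons_append, crossOne, ih, crossOne, T.e_tn_mul, T.tn_e_mul, ← T.e_tn_e Y Z,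
      T.e_cons y Y]
    simp only [T.tn_assoc, mul_assoc]

include hc in
-- The recursion is on the left word, so this hexagon needs an argument: the crossing of `x` with
-- `Y` and that of `X` with `Z` are even and far apart, hence commute.
theorem cross_append_right (X Y Z : List S) :
    T.cross c X (Y ++ Z) = (T.cross c X Y ⊙ T.e Z) * (T.e Y ⊙ T.cross c X Z) := by
  induction X with
  | nil => simp only [cross_nil_left, T.e_tn_e, T.e_mul_e]
  | cons x X ih =>
    have h := T.slide (T.crossOne_mem hc x Y) (T.phoms_le (T.cross_mem hc X Z))
    simp only [← T.e_tn_e, T.tn_assoc] at h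
    simp only [cross, ih, T.crossOne_append hc, T.e_tn_mul, T.tn_e_mul, T.tn_assoc, mul_assoc]
    rw [mul_mul_of_mul_eq h.symm, mul_assoc]

include hc in
theorem cross_singleton (x y : S) : T.cross c [x] [y] = c x y := by
  rw [T.cross_singleton_left hc, crossOne, crossOne, T.tn_nil, T.e_tn_e,
    T.mul_e (T.phoms_le (hc x y))]

include hc in
theorem cross_cons_left (x : S) (X Y : List S) :
    T.cross c (x :: X) Y = (T.e [x] ⊙ T.cross c X Y) * (T.cross c [x] Y ⊙ T.e X) :=
  T.cross_append_left hc [x] X Y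

include hc in
theorem cross_cons_right (X : List S) (y : S) (Y : List S) :
    T.cross c X (y :: Y) = (T.cross c X [y] ⊙ T.e Y) * (T.e [y] ⊙ T.cross c X Y) :=
  T.cross_append_right hc X [y] Y

section Symmetric

variable (hs : ∀ x y, c x y * c y x = T.e [x, y])

include hc hs

theorem cross_mul_cross_singleton (x : S) (Y : List S) :
    T.cross c [x] Y * T.cross c Y [x] = T.e ([x] ++ Y) := by
  induction Y with
  | nil => rw [cross_nil_right, cross_nil_left, T.e_mul_e]; rfl
  | cons y Y ih =>
    rw [T.cross_cons_right hc, T.cross_cons_left hc y, mul_assoc,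
      ← mul_assoc (T.e [y] ⊙ T.cross c [x] Y), ← T.e_tn_mul, ih, T.cross_singleton hc,
      T.cross_singleton hc, ← T.e_tn_e, ← T.tn_assoc, ← T.tn_e_mul,
      T.e_tn_e [y] [x], T.e_mul (T.phoms_le (hc y x)), ← T.tn_e_mul, hs, T.e_tn_e]
    rfl

/-- The crossings of words are symmetric if the crossings of strands are. -/
theorem cross_mul_cross (X Y : List S) : T.cross c X Y * T.cross c Y X = T.e (X ++ Y) := by
  induction X with
  | nil => rw [cross_nil_right, cross_nil_left, T.e_mul_e]; rfl
  | cons x X ih =>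
    have h := T.cross_mem hc Y X
    rw [T.cross_cons_left hc, T.cross_cons_right hc Y, mul_assoc,
      ← mul_assoc (T.cross c [x] Y ⊙ T.e X), ← T.tn_e_mul, T.cross_mul_cross_singleton hc hs,
      ← T.e_tn_e, T.tn_assoc, ← T.e_tn_mul, T.e_tn_e Y, T.e_mul (T.phoms_le h), ← T.e_tn_mul, ih,
      T.e_tn_e]
    rfl

end Symmetric

end Cross

end MorphismAlgebra

theorem mul_mul_mul_of_mul_mul_eq {A : Type*} [Semigroup A] {x y z w : A} (h : x * (y * z) = w)
    (t : A) : x * (y * (z * t)) = w * t := by rw [← h]; simp only [mul_assoc]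

/-! ### Morphisms that pass through crossings -/

namespace MorphismAlgebra

variable {k S A : Type*} [CommRing k] [NonUnitalRing A] [Module k A] (T : MorphismAlgebra k S A)

local notation:75 f:76 " ⊙ " g:75 => T.tn f g

/-- The morphism `f : X ⟶ Y` passes through the crossings with `Z`. -/
structure Natural (c : S → S → A) (Z X Y : List S) (f : A) : Prop where
  mem : f ∈ T.homs X Y
  comm : (f ⊙ T.e Z) * T.cross c Y Z = T.cross c X Z * (T.e Z ⊙ f)

namespace Natural

variable {T} {c : S → S → A} {X Y Z W : List S} {f g : A}

theorem cast {X' Y' : List S} (h : T.Natural c Z X Y f) (hX : X = X') (hY : Y = Y') :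
    T.Natural c Z X' Y' f := hX ▸ hY ▸ h

theorem zero : T.Natural c Z X Y 0 := ⟨zero_mem _, by simp⟩

theorem add (hf : T.Natural c Z X Y f) (hg : T.Natural c Z X Y g) : T.Natural c Z X Y (f + g) where
  mem := add_mem hf.mem hg.mem
  comm := by simp only [map_add, LinearMap.add_apply, add_mul, mul_add, hf.comm, hg.comm]

theorem smul [IsScalarTower k A A] [SMulCommClass k A A] (a : k) (hf : T.Natural c Z X Y f) :
    T.Natural c Z X Y (a • f) where
  mem := Submodule.smul_mem _ _ hf.mem
  comm := by
    simp only [map_smul, LinearMap.smul_apply, smul_mul_assoc, mul_smul_comm, hf.comm]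

theorem mul (hf : T.Natural c Z X Y f) (hg : T.Natural c Z Y W g) : T.Natural c Z X W (f * g) where
  mem := T.mul_mem hf.mem hg.mem
  comm := by
    rw [T.tn_e_mul, mul_assoc, hg.comm, mul_mul_of_mul_eq hf.comm, mul_assoc, ← T.e_tn_mul]

theorem nil (hf : f ∈ T.homs X Y) : T.Natural c [] X Y f where
  mem := hf
  comm := by rw [cross_nil_right, cross_nil_right, T.tn_nil, T.nil_tn, T.mul_e hf, T.e_mul hf]

section Even

variable (hc : ∀ x y, c x y ∈ T.phoms ([x] ++ [y]) ([y] ++ [x]) 0)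

include hc

theorem id (X : List S) : T.Natural c Z X X (T.e X) where
  mem := T.phoms_le (T.e_mem X)
  comm := by
    have h := T.phoms_le (T.cross_mem hc X Z)
    rw [T.e_tn_e, T.e_tn_e, T.e_mul h, T.mul_e h]

theorem tn_id (hf : T.Natural c Z X Y f) (W : List S) :
    T.Natural c Z (X ++ W) (Y ++ W) (f ⊙ T.e W) where
  mem := T.tn_mem hf.mem (T.phoms_le (T.e_mem W))
  comm := by
    have h := T.slide' hf.mem (T.cross_mem hc W Z)
    simp only [← T.e_tn_e] at h
    rw [T.cross_append_left hc, T.cross_append_left hc, T.tn_assoc, mul_mul_of_mul_eq h, mul_assoc,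
      ← T.tn_assoc f, ← T.tn_e_mul, hf.comm, T.tn_e_mul, T.tn_assoc, mul_assoc]

theorem id_tn (hf : T.Natural c Z X Y f) (W : List S) :
    T.Natural c Z (W ++ X) (W ++ Y) (T.e W ⊙ f) where
  mem := T.tn_mem (T.phoms_le (T.e_mem W)) hf.mem
  comm := by
    have h := T.slide (T.cross_mem hc W Z) hf.mem
    simp only [← T.e_tn_e, T.tn_assoc] at h
    rw [T.cross_append_left hc, T.cross_append_left hc, T.tn_assoc, ← mul_assoc, ← T.e_tn_mul,
      hf.comm, T.e_tn_mul, mul_assoc, ← h, mul_assoc]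

theorem tn {X' Y' : List S} (hf : T.Natural c Z X Y f) (hg : T.Natural c Z X' Y' g) :
    T.Natural c Z (X ++ X') (Y ++ Y') (f ⊙ g) := by
  rw [← T.tn_eq_right_left hf.mem hg.mem]
  exact (hg.id_tn hc X).mul (hf.tn_id hc Y')

/-- This will give naturality of the rightward crossings and of tag-out, from that of their
inverses. -/
theorem inv (hf : T.Natural c Z X Y f) (hg : g ∈ T.homs Y X) (h : f * g = T.e X)
    (h' : g * f = T.e Y) : T.Natural c Z Y X g where
  mem := hg
  comm := by
    have hX := T.phoms_le (T.cross_mem hc X Z)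
    have hY := T.phoms_le (T.cross_mem hc Y Z)
    calc (g ⊙ T.e Z) * T.cross c X Z
        = (g ⊙ T.e Z) * (T.cross c X Z * (T.e Z ⊙ (f * g))) := by rw [h, T.e_tn_e, T.mul_e hX]
      _ = ((g * f) ⊙ T.e Z) * (T.cross c Y Z * (T.e Z ⊙ g)) := by
        rw [T.e_tn_mul, mul_mul_of_mul_eq hf.comm.symm, T.tn_e_mul]
        simp only [mul_assoc]
      _ = _ := by rw [h', T.e_tn_e, ← mul_assoc, T.e_mul hY]

theorem append {Z' : List S} (h : T.Natural c Z X Y f) (h' : T.Natural c Z' X Y f) :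
    T.Natural c (Z ++ Z') X Y f where
  mem := h.mem
  comm := by
    rw [T.cross_append_right hc, T.cross_append_right hc, ← T.e_tn_e, ← T.tn_assoc f,
      ← mul_assoc, ← T.tn_e_mul, h.comm, T.tn_e_mul, mul_assoc, T.tn_assoc, ← T.e_tn_mul, h'.comm,
      T.e_tn_mul, T.tn_assoc, mul_assoc]

theorem of_forall (h : ∀ z, T.Natural c [z] X Y f) (hf : f ∈ T.homs X Y) (Z : List S) :
    T.Natural c Z X Y f := by
  induction Z with
  | nil => exact .nil hf
  | cons z Z ih => exact (h z).append hc ih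

variable (hs : ∀ x y, c x y * c y x = T.e ([x] ++ [y]))

include hs

/-- Multiplying by the inverse crossings turns passage of `Z` from right to left into passage from
left to right. -/
theorem comm' (h : T.Natural c Z X Y f) :
    (T.e Z ⊙ f) * T.cross c Z Y = T.cross c Z X * (f ⊙ T.e Z) := by
  have h₁ := T.tn_mem (T.phoms_le (T.e_mem Z)) h.mem
  have h₂ := T.tn_mem h.mem (T.phoms_le (T.e_mem Z))
  rw [← T.e_mul h₁, ← T.cross_mul_cross hc hs, mul_assoc, mul_assoc,
    mul_mul_of_mul_eq h.comm.symm, mul_assoc, T.cross_mul_cross hc hs, T.mul_e h₂]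

theorem of_comm' (hf : f ∈ T.homs X Y)
    (h : (T.e Z ⊙ f) * T.cross c Z Y = T.cross c Z X * (f ⊙ T.e Z)) : T.Natural c Z X Y f where
  mem := hf
  comm := by
    have h₁ := T.tn_mem (T.phoms_le (T.e_mem Z)) hf
    have h₂ := T.tn_mem hf (T.phoms_le (T.e_mem Z))
    rw [← T.e_mul h₂, ← T.cross_mul_cross hc hs, mul_assoc, mul_assoc,
      mul_mul_of_mul_eq h.symm, mul_assoc, T.cross_mul_cross hc hs, T.mul_e h₁]

end Even

end Natural

/-- Naturality of the crossing in both arguments. -/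
theorem tn_mul_cross [IsScalarTower k A A] [SMulCommClass k A A] {c : S → S → A}
    (hc : ∀ x y, c x y ∈ T.phoms ([x] ++ [y]) ([y] ++ [x]) 0)
    (hs : ∀ x y, c x y * c y x = T.e ([x] ++ [y])) {X X' Y Y' : List S} {f g : A} {p q : ZMod 2}
    (hf : f ∈ T.phoms X X' p) (hg : g ∈ T.phoms Y Y' q) (hf' : T.Natural c Y' X X' f)
    (hg' : T.Natural c X Y Y' g) :
    (f ⊙ g) * T.cross c X' Y' = superSign k (p * q) • (T.cross c X Y * (g ⊙ f)) := by
  -- Passing the morphisms through one at a time leaves them in the order that costs the interchange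
  -- sign.
  rw [← T.tn_eq_right_left hf'.mem hg'.mem, mul_assoc, hf'.comm,
    mul_mul_of_mul_eq (hg'.comm' hc hs), mul_assoc, T.tn_eq_left_right hg hf, mul_smul_comm,
    mul_comm p]

/-! ### Duals -/

/-- `D` is a left dual of `X`. -/
structure Dual (D X : List S) (ev coev : A) : Prop where
  ev_mem : ev ∈ T.phoms (D ++ X) [] 0
  coev_mem : coev ∈ T.phoms [] (X ++ D) 0
  zigzag : (coev ⊙ T.e X) * (T.e X ⊙ ev) = T.e X
  zigzag' : (T.e D ⊙ coev) * (ev ⊙ T.e D) = T.e D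

namespace Dual

variable {T} {D X D' X' : List S} {ev coev ev' coev' : A}

theorem nil : T.Dual [] [] (T.e []) (T.e []) where
  ev_mem := T.e_mem _
  coev_mem := T.e_mem _
  zigzag := by rw [T.nil_tn, T.e_mul_e]
  zigzag' := by rw [T.nil_tn, T.e_mul_e]

/-- The dual of a product. -/
theorem append (h : T.Dual D X ev coev) (h' : T.Dual D' X' ev' coev') :
    T.Dual (D' ++ D) (X ++ X') ((T.e D' ⊙ ev ⊙ T.e X') * ev') (coev * (T.e X ⊙ coev' ⊙ T.e D)) where
  ev_mem := by
    have h₁ := T.tn_mem_even (T.e_mem D') (T.tn_mem_even h.ev_mem (T.e_mem X'))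
    exact T.mul_mem_even (phoms_cast h₁ (by simp) (by simp)) h'.ev_mem
  coev_mem := by
    have h₁ := T.tn_mem_even (T.e_mem X) (T.tn_mem_even h'.coev_mem (T.e_mem D))
    exact T.mul_mem_even h.coev_mem (phoms_cast h₁ (by simp) (by simp))
  zigzag := by
    have h₁ := T.slide h'.coev_mem (T.phoms_le h.ev_mem)
    simp only [← T.e_tn_e, T.tn_assoc, T.nil_tn, T.tn_nil] at h₁
    have h₂ : (T.e X ⊙ coev' ⊙ T.e D ⊙ T.e X ⊙ T.e X') * (T.e X ⊙ T.e X' ⊙ T.e D' ⊙ ev ⊙ T.e X') =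
        (T.e X ⊙ ev ⊙ T.e X') * (T.e X ⊙ coev' ⊙ T.e X') := by
      rw [← T.e_tn_mul, ← T.e_tn_mul]
      congr 1
      have := congrArg (fun x => x ⊙ T.e X') h₁
      simpa only [T.tn_e_mul, T.tn_assoc] using this
    have h₃ : (coev ⊙ T.e X ⊙ T.e X') * (T.e X ⊙ ev ⊙ T.e X') = T.e X ⊙ T.e X' := by
      have := congrArg (fun x => x ⊙ T.e X') h.zigzag
      simpa only [T.tn_e_mul, T.tn_assoc] using this
    have h₄ : (T.e X ⊙ coev' ⊙ T.e X') * (T.e X ⊙ T.e X' ⊙ ev') = T.e X ⊙ T.e X' := by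
      rw [← T.e_tn_mul, h'.zigzag]
    rw [T.e_tn_mul, T.tn_e_mul]
    simp only [← T.e_tn_e, T.tn_assoc, mul_assoc]
    rw [mul_mul_of_mul_eq h₂, mul_assoc, h₄, mul_mul_of_mul_eq h₃, T.e_tn_e, T.e_mul_e]
  zigzag' := by
    have h₁ := T.slide h.ev_mem (T.phoms_le h'.coev_mem)
    simp only [← T.e_tn_e, T.tn_assoc, T.nil_tn, T.tn_nil] at h₁
    have h₂ : (T.e D' ⊙ T.e D ⊙ T.e X ⊙ coev' ⊙ T.e D) * (T.e D' ⊙ ev ⊙ T.e X' ⊙ T.e D' ⊙ T.e D) =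
        (T.e D' ⊙ ev ⊙ T.e D) * (T.e D' ⊙ coev' ⊙ T.e D) := by
      rw [← T.e_tn_mul, ← T.e_tn_mul]
      congr 1
      have := congrArg (fun x => x ⊙ T.e D) h₁.symm
      simpa only [T.tn_e_mul, T.tn_assoc] using this
    have h₃ : (T.e D' ⊙ T.e D ⊙ coev) * (T.e D' ⊙ ev ⊙ T.e D) = T.e D' ⊙ T.e D := by
      rw [← T.e_tn_mul, h.zigzag']
    have h₄ : (T.e D' ⊙ coev' ⊙ T.e D) * (ev' ⊙ T.e D' ⊙ T.e D) = T.e D' ⊙ T.e D := by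
      have := congrArg (fun x => x ⊙ T.e D) h'.zigzag'
      simpa only [T.tn_e_mul, T.tn_assoc] using this
    rw [T.e_tn_mul, T.tn_e_mul]
    simp only [← T.e_tn_e, T.tn_assoc, mul_assoc]
    rw [mul_mul_of_mul_eq h₂, mul_assoc, h₄, mul_mul_of_mul_eq h₃, T.e_tn_e, T.e_mul_e]

section Cross

variable {c : S → S → A} (hc : ∀ x y, c x y ∈ T.phoms ([x] ++ [y]) ([y] ++ [x]) 0)
  (hs : ∀ x y, c x y * c y x = T.e ([x] ++ [y]))

include hc hs

/-- In the presence of a symmetric braiding, left duals are right duals. -/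
theorem symm (h : T.Dual D X ev coev) (hev : ∀ Z, T.Natural c Z (D ++ X) [] ev)
    (hcoev : ∀ Z, T.Natural c Z [] (X ++ D) coev)
    (hD : T.Natural c X (D ++ D) (D ++ D) (T.cross c D D))
    (hX : T.Natural c D (X ++ X) (X ++ X) (T.cross c X X)) :
    T.Dual X D (T.cross c X D * ev) (coev * T.cross c X D) where
  ev_mem := T.mul_mem_even (T.cross_mem hc X D) h.ev_mem
  coev_mem := T.mul_mem_even h.coev_mem (T.cross_mem hc X D)
  zigzag := by
    -- Naturality moves the cup, and in `h₂` the cap, to the other side of the strand `D` at the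
    -- cost of crossings.
    have h₁ : coev ⊙ T.e D = (T.e D ⊙ coev) * ((T.cross c D X ⊙ T.e D) *
        (T.e X ⊙ T.cross c D D)) := by
      rw [← T.cross_append_right hc, (hcoev D).comm' hc hs, cross_nil_right,
        T.e_mul (Y := X ++ D ++ D)]
      exact T.tn_mem (X := []) (T.phoms_le h.coev_mem) (T.phoms_le (T.e_mem D))
    have h₂ : T.e D ⊙ ev = (T.cross c D D ⊙ T.e X) * ((T.e D ⊙ T.cross c D X) * (ev ⊙ T.e D)) := by
      rw [← mul_assoc, ← T.cross_append_right hc, ← (hev D).comm' hc hs, cross_nil_right,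
        T.mul_e (X := D ++ (D ++ X))]
      exact homs_cast (T.tn_mem (T.phoms_le (T.e_mem D)) (T.phoms_le h.ev_mem)) rfl (by simp)
    -- This is the Yang–Baxter relation. It brings every crossing next to its inverse; what remains
    -- is the other original zigzag.
    have h₃ : (T.e X ⊙ T.cross c D D) * ((T.cross c X D ⊙ T.e D) * (T.e D ⊙ T.cross c X D)) =
        (T.cross c X D ⊙ T.e D) * ((T.e D ⊙ T.cross c X D) * (T.cross c D D ⊙ T.e X)) := by
      have := hD.comm' hc hs
      rwa [T.cross_append_right hc, mul_assoc] at this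
    have h₄ : (T.cross c D X ⊙ T.e D) * (T.cross c X D ⊙ T.e D) = T.e D ⊙ T.e X ⊙ T.e D := by
      rw [← T.tn_e_mul, T.cross_mul_cross hc hs, ← T.e_tn_e, T.tn_assoc]
    have h₅ : (T.cross c D D ⊙ T.e X) * (T.cross c D D ⊙ T.e X) = T.e D ⊙ T.e D ⊙ T.e X := by
      rw [← T.tn_e_mul, T.cross_mul_cross hc hs, ← T.e_tn_e, T.tn_assoc]
    have h₆ : (T.e D ⊙ T.cross c X D) * (T.e D ⊙ T.cross c D X) = T.e D ⊙ T.e X ⊙ T.e D := by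
      rw [← T.e_tn_mul, T.cross_mul_cross hc hs, ← T.e_tn_e]
    have h₇ : (T.e D ⊙ T.e D ⊙ T.e X) * ((T.e D ⊙ T.cross c D X) * (ev ⊙ T.e D)) =
        (T.e D ⊙ T.cross c D X) * (ev ⊙ T.e D) := by
      rw [← mul_assoc, ← T.e_tn_mul, T.e_tn_e, T.e_mul (T.phoms_le (T.cross_mem hc D X))]
    have h₈ : (T.e D ⊙ T.e X ⊙ T.e D) * (ev ⊙ T.e D) = ev ⊙ T.e D := by
      rw [← T.tn_assoc, ← T.tn_e_mul, T.e_tn_e, T.e_mul (T.phoms_le h.ev_mem)]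
    rw [T.tn_e_mul, T.e_tn_mul, h₁, h₂]
    simp only [mul_assoc]
    rw [mul_mul_mul_of_mul_mul_eq h₃]
    simp only [mul_assoc]
    rw [mul_mul_of_mul_eq h₅, h₇, mul_mul_of_mul_eq h₆, h₈, mul_mul_of_mul_eq h₄, h₈, h.zigzag']
  zigzag' := by
    have h₁ : T.e X ⊙ coev = (coev ⊙ T.e X) * ((T.e X ⊙ T.cross c D X) *
        (T.cross c X X ⊙ T.e D)) := by
      rw [← T.cross_append_left hc, (hcoev X).comm, cross_nil_left,
        T.e_mul (Y := X ++ (X ++ D))]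
      exact homs_cast (T.tn_mem (T.phoms_le (T.e_mem X)) (T.phoms_le h.coev_mem)) (by simp) rfl
    have h₂ : ev ⊙ T.e X = (T.e D ⊙ T.cross c X X) * ((T.cross c D X ⊙ T.e X) * (T.e X ⊙ ev)) := by
      rw [← mul_assoc, ← T.cross_append_left hc, ← (hev X).comm, cross_nil_left,
        T.mul_e (X := D ++ X ++ X)]
      exact T.tn_mem (Y := []) (T.phoms_le h.ev_mem) (T.phoms_le (T.e_mem X))
    have h₃ : (T.cross c X X ⊙ T.e D) * ((T.e X ⊙ T.cross c X D) * (T.cross c X D ⊙ T.e X)) =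
        (T.e X ⊙ T.cross c X D) * ((T.cross c X D ⊙ T.e X) * (T.e D ⊙ T.cross c X X)) := by
      have := hX.comm
      rwa [T.cross_append_left hc, mul_assoc] at this
    have h₄ : (T.e X ⊙ T.cross c D X) * (T.e X ⊙ T.cross c X D) = T.e X ⊙ T.e D ⊙ T.e X := by
      rw [← T.e_tn_mul, T.cross_mul_cross hc hs, ← T.e_tn_e]
    have h₅ : (T.e D ⊙ T.cross c X X) * (T.e D ⊙ T.cross c X X) = T.e D ⊙ T.e X ⊙ T.e X := by
      rw [← T.e_tn_mul, T.cross_mul_cross hc hs, ← T.e_tn_e]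
    have h₆ : (T.cross c X D ⊙ T.e X) * (T.cross c D X ⊙ T.e X) = T.e X ⊙ T.e D ⊙ T.e X := by
      rw [← T.tn_e_mul, T.cross_mul_cross hc hs, ← T.e_tn_e, T.tn_assoc]
    have h₇ : (T.e D ⊙ T.e X ⊙ T.e X) * ((T.cross c D X ⊙ T.e X) * (T.e X ⊙ ev)) =
        (T.cross c D X ⊙ T.e X) * (T.e X ⊙ ev) := by
      rw [← mul_assoc, ← T.tn_assoc, ← T.tn_e_mul, T.e_tn_e,
        T.e_mul (T.phoms_le (T.cross_mem hc D X))]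
    have h₈ : (T.e X ⊙ T.e D ⊙ T.e X) * (T.e X ⊙ ev) = T.e X ⊙ ev := by
      rw [← T.e_tn_mul, T.e_tn_e, T.e_mul (T.phoms_le h.ev_mem)]
    rw [T.tn_e_mul, T.e_tn_mul, h₁, h₂]
    simp only [mul_assoc]
    rw [mul_mul_mul_of_mul_mul_eq h₃]
    simp only [mul_assoc]
    rw [mul_mul_of_mul_eq h₅, h₇, mul_mul_of_mul_eq h₆, h₈, mul_mul_of_mul_eq h₄, h₈, h.zigzag]

end Cross

end Dual

/-! ### Mates -/

/-- The mate `D W ⟶ W' D` of `g : W Z ⟶ Z W'`, where `D` is a left dual of `Z`. -/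
def mate (D W W' : List S) (ev coev g : A) : A :=
  (T.e D ⊙ T.e W ⊙ coev) * ((T.e D ⊙ g ⊙ T.e D) * (ev ⊙ T.e W' ⊙ T.e D))

namespace Dual

variable {T} {D Z W W' X Y : List S} {ev coev f g h : A}

theorem zigzag_tn (hZ : T.Dual D Z ev coev) :
    (coev ⊙ T.e Z ⊙ T.e W) * (T.e Z ⊙ ev ⊙ T.e W) = T.e Z ⊙ T.e W := by
  have := congrArg (fun x => x ⊙ T.e W) hZ.zigzag
  simpa only [T.tn_e_mul, T.tn_assoc] using this

theorem zigzag_tn' (hZ : T.Dual D Z ev coev) :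
    (T.e D ⊙ coev ⊙ T.e W) * (ev ⊙ T.e D ⊙ T.e W) = T.e D ⊙ T.e W := by
  have := congrArg (fun x => x ⊙ T.e W) hZ.zigzag'
  simpa only [T.tn_e_mul, T.tn_assoc] using this

theorem mate_mem (hZ : T.Dual D Z ev coev) (hg : g ∈ T.phoms (W ++ Z) (Z ++ W') 0) :
    T.mate D W W' ev coev g ∈ T.phoms (D ++ W) (W' ++ D) 0 := by
  have h₁ := T.tn_mem_even (T.e_mem D) (T.tn_mem_even (T.e_mem W) hZ.coev_mem)
  have h₂ := T.tn_mem_even (T.e_mem D) (T.tn_mem_even hg (T.e_mem D))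
  have h₃ := T.tn_mem_even hZ.ev_mem (T.tn_mem_even (T.e_mem W') (T.e_mem D))
  exact T.mul_mem_even (phoms_cast h₁ (by simp) rfl)
    (T.mul_mem_even (phoms_cast h₂ (by simp) rfl) (phoms_cast h₃ (by simp) (by simp)))

/-- The outer cup slides past the inner one and forms a zigzag with the cap of the mate. -/
theorem coev_tn_mul_mate (hZ : T.Dual D Z ev coev) (hg : g ∈ T.phoms (W ++ Z) (Z ++ W') 0) :
    (coev ⊙ T.e W) * (T.e Z ⊙ T.mate D W W' ev coev g) = (T.e W ⊙ coev) * (g ⊙ T.e D) := by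
  have h₁ := T.slide hZ.coev_mem (T.tn_mem (T.phoms_le (T.e_mem W)) (T.phoms_le hZ.coev_mem))
  have h₂ := T.slide hZ.coev_mem (T.tn_mem (T.phoms_le hg) (T.phoms_le (T.e_mem D)))
  simp only [← T.e_tn_e, T.tn_assoc, T.nil_tn, T.tn_nil] at h₁ h₂
  rw [mate, T.e_tn_mul, T.e_tn_mul, mul_mul_of_mul_eq h₁, mul_assoc, mul_mul_of_mul_eq h₂, mul_assoc]
  have h₃ := hZ.zigzag_tn (W := W' ++ D)
  simp only [← T.e_tn_e] at h₃
  rw [h₃, T.e_tn_e, T.e_tn_e, T.mul_e]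
  exact homs_cast (T.tn_mem (T.phoms_le hg) (T.phoms_le (T.e_mem D))) rfl (by simp)

theorem mate_mul_tn_ev (hZ : T.Dual D Z ev coev) (hg : g ∈ T.phoms (W ++ Z) (Z ++ W') 0) :
    (T.mate D W W' ev coev g ⊙ T.e Z) * (T.e W' ⊙ ev) = (T.e D ⊙ g) * (ev ⊙ T.e W') := by
  have h₁ := T.slide (T.tn_mem_even hZ.ev_mem (T.e_mem W')) (T.phoms_le hZ.ev_mem)
  have h₂ := T.slide (T.tn_mem_even (T.e_mem D) hg) (T.phoms_le hZ.ev_mem)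
  simp only [← T.e_tn_e, T.tn_assoc, T.nil_tn, T.tn_nil] at h₁ h₂
  have h₃ : (T.e D ⊙ T.e W ⊙ coev ⊙ T.e Z) * (T.e D ⊙ T.e W ⊙ T.e Z ⊙ ev) =
      T.e D ⊙ T.e W ⊙ T.e Z := by
    rw [← T.e_tn_mul, ← T.e_tn_mul, hZ.zigzag]
  rw [mate, T.tn_e_mul, T.tn_e_mul]
  simp only [T.tn_assoc, mul_assoc]
  rw [h₁, mul_mul_of_mul_eq h₂, mul_assoc, mul_mul_of_mul_eq h₃, ← mul_assoc, ← T.e_tn_mul,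
    T.e_tn_e, T.e_mul (T.phoms_le hg)]

/-- Closing the added strand `Z` with the cap recovers `h` by a zigzag. -/
theorem eq_of_coev_tn_mul (hZ : T.Dual D Z ev coev) {V : List S} {h h' : A}
    (hh : h ∈ T.homs (D ++ W) V) (hh' : h' ∈ T.homs (D ++ W) V)
    (e : (coev ⊙ T.e W) * (T.e Z ⊙ h) = (coev ⊙ T.e W) * (T.e Z ⊙ h')) : h = h' := by
  have key {h : A} (hh : h ∈ T.homs (D ++ W) V) :
      (T.e D ⊙ ((coev ⊙ T.e W) * (T.e Z ⊙ h))) * (ev ⊙ T.e V) = h := by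
    have h₁ := T.slide hZ.ev_mem hh
    simp only [← T.e_tn_e, T.tn_assoc, T.nil_tn] at h₁
    rw [T.e_tn_mul, mul_assoc, ← h₁, ← mul_assoc, hZ.zigzag_tn', T.e_tn_e, T.e_mul hh]
  rw [← key hh, e, key hh']

/-- The mate is characterized by its compatibility with the cup. -/
theorem eq_mate (hZ : T.Dual D Z ev coev) (hg : g ∈ T.phoms (W ++ Z) (Z ++ W') 0)
    (hh : h ∈ T.homs (D ++ W) (W' ++ D))
    (e : (coev ⊙ T.e W) * (T.e Z ⊙ h) = (T.e W ⊙ coev) * (g ⊙ T.e D)) :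
    h = T.mate D W W' ev coev g :=
  hZ.eq_of_coev_tn_mul hh (T.phoms_le (hZ.mate_mem hg)) (e.trans (hZ.coev_tn_mul_mate hg).symm)

theorem mate_nil (hZ : T.Dual D Z ev coev) : T.mate D [] [] ev coev (T.e Z) = T.e D := by
  rw [mate, T.nil_tn, T.nil_tn, T.e_tn_e, T.e_tn_e, ← mul_assoc, T.mul_e, hZ.zigzag']
  exact homs_cast (T.tn_mem (T.phoms_le (T.e_mem D)) (T.phoms_le hZ.coev_mem)) rfl (by simp)

theorem mate_append {W₁ W₁' W₂ W₂' : List S} {g₁ g₂ : A} (hZ : T.Dual D Z ev coev)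
    (h₁ : g₁ ∈ T.phoms (W₁ ++ Z) (Z ++ W₁') 0) (h₂ : g₂ ∈ T.phoms (W₂ ++ Z) (Z ++ W₂') 0) :
    T.mate D (W₁ ++ W₂) (W₁' ++ W₂') ev coev ((T.e W₁ ⊙ g₂) * (g₁ ⊙ T.e W₂')) =
      (T.mate D W₁ W₁' ev coev g₁ ⊙ T.e W₂) * (T.e W₁' ⊙ T.mate D W₂ W₂' ev coev g₂) := by
  have m₁ := hZ.mate_mem h₁
  have m₂ := hZ.mate_mem h₂
  symm
  apply hZ.eq_mate
  · have h := T.tn_mem_even (T.e_mem W₁) h₂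
    have h' := T.tn_mem_even h₁ (T.e_mem W₂')
    exact T.mul_mem_even (phoms_cast h (by simp) rfl) (phoms_cast h' (by simp) (by simp))
  · have h := T.tn_mem (T.phoms_le m₁) (T.phoms_le (T.e_mem W₂))
    have h' := T.tn_mem (T.phoms_le (T.e_mem W₁')) (T.phoms_le m₂)
    exact T.mul_mem (homs_cast h (by simp) rfl) (homs_cast h' (by simp) (by simp))
  · have e₁ := hZ.coev_tn_mul_mate h₁
    have e₂ := hZ.coev_tn_mul_mate h₂
    have e₁' : (coev ⊙ T.e W₁ ⊙ T.e W₂) * (T.e Z ⊙ T.mate D W₁ W₁' ev coev g₁ ⊙ T.e W₂) =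
        (T.e W₁ ⊙ coev ⊙ T.e W₂) * (g₁ ⊙ T.e D ⊙ T.e W₂) := by
      have := congrArg (fun x => x ⊙ T.e W₂) e₁
      simpa only [T.tn_e_mul, T.tn_assoc] using this
    have e₂' : (T.e W₁ ⊙ coev ⊙ T.e W₂) * (T.e W₁ ⊙ T.e Z ⊙ T.mate D W₂ W₂' ev coev g₂) =
        (T.e W₁ ⊙ T.e W₂ ⊙ coev) * (T.e W₁ ⊙ g₂ ⊙ T.e D) := by
      rw [← T.e_tn_mul, e₂, T.e_tn_mul]
    have e₃ := T.slide h₁ (T.phoms_le m₂)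
    simp only [← T.e_tn_e, T.tn_assoc] at e₃
    rw [T.e_tn_mul, T.tn_e_mul]
    simp only [← T.e_tn_e, T.tn_assoc]
    rw [mul_mul_of_mul_eq e₁', mul_assoc, e₃, mul_mul_of_mul_eq e₂', mul_assoc]

/-- Since the cup and the cap are even, `f` and `f'` slide past them without signs, whatever their
parity. -/
theorem tn_mul_mate (hZ : T.Dual D Z ev coev) {W₁ W₁' W₂ W₂' : List S} {g₁ g₂ f f' : A}
    (hf : f ∈ T.homs W₁ W₂) (hf' : f' ∈ T.homs W₁' W₂') (e : (f ⊙ T.e Z) * g₂ = g₁ * (T.e Z ⊙ f')) :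
    (T.e D ⊙ f) * T.mate D W₂ W₂' ev coev g₂ = T.mate D W₁ W₁' ev coev g₁ * (f' ⊙ T.e D) := by
  have h₁ := T.slide' hf hZ.coev_mem
  have h₂ := T.slide hZ.ev_mem hf'
  simp only [← T.e_tn_e, T.tn_assoc, T.nil_tn, T.tn_nil] at h₁ h₂
  have h₁' : (T.e D ⊙ f) * (T.e D ⊙ T.e W₂ ⊙ coev) =
      (T.e D ⊙ T.e W₁ ⊙ coev) * (T.e D ⊙ f ⊙ T.e Z ⊙ T.e D) := by
    rw [← T.e_tn_mul, h₁, T.e_tn_mul]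
  have h₂' : (ev ⊙ T.e W₁' ⊙ T.e D) * (f' ⊙ T.e D) =
      (T.e D ⊙ T.e Z ⊙ f' ⊙ T.e D) * (ev ⊙ T.e W₂' ⊙ T.e D) := by
    have := congrArg (fun x => x ⊙ T.e D) h₂
    simpa only [T.tn_e_mul, T.tn_assoc] using this
  have h₃ : (T.e D ⊙ f ⊙ T.e Z ⊙ T.e D) * (T.e D ⊙ g₂ ⊙ T.e D) =
      (T.e D ⊙ g₁ ⊙ T.e D) * (T.e D ⊙ T.e Z ⊙ f' ⊙ T.e D) := by
    rw [← T.e_tn_mul, ← T.tn_assoc f, ← T.tn_e_mul, e, T.tn_e_mul, T.tn_assoc, T.e_tn_mul]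
  rw [mate, mul_mul_of_mul_eq h₁', mul_assoc, mul_mul_of_mul_eq h₃, mate]
  simp only [mul_assoc]
  rw [h₂']

section Cross

variable {c : S → S → A} (hc : ∀ x y, c x y ∈ T.phoms ([x] ++ [y]) ([y] ++ [x]) 0)

include hc

theorem cross_eq_mate {d z : S} (hZ : T.Dual [d] [z] ev coev)
    (hd : ∀ w, c d w = T.mate [d] [w] [w] ev coev (c w z)) (W : List S) :
    T.cross c [d] W = T.mate [d] W W ev coev (T.cross c W [z]) := by
  induction W with
  | nil => rw [cross_nil_right, cross_nil_left, hZ.mate_nil]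
  | cons w W ih =>
    have := hZ.mate_append (T.cross_mem hc [w] [z]) (T.cross_mem hc W [z])
    rw [T.cross_cons_right hc [d], T.cross_cons_left hc w W, ih, T.cross_singleton hc d, hd,
      ← T.cross_singleton hc w z]
    exact this.symm

/-- This transfers naturality from `z` to its dual: the crossings with `d` are mates of those with
`z`. -/
theorem natural_comm {d z : S} (hZ : T.Dual [d] [z] ev coev)
    (hd : ∀ w, c d w = T.mate [d] [w] [w] ev coev (c w z)) (hf : T.Natural c [z] X Y f) :
    (T.e [d] ⊙ f) * T.cross c [d] Y = T.cross c [d] X * (f ⊙ T.e [d]) := by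
  rw [hZ.cross_eq_mate hc hd, hZ.cross_eq_mate hc hd]
  exact hZ.tn_mul_mate hf.mem hf.mem hf.comm

/-- Cups are natural. -/
theorem natural_coev {d z w : S} (hZ : T.Dual [d] [z] ev coev)
    (hd : c d w = T.mate [d] [w] [w] ev coev (c w z)) (hs : c w z * c z w = T.e ([w] ++ [z])) :
    T.Natural c [w] [] ([z] ++ [d]) coev where
  mem := T.phoms_le hZ.coev_mem
  comm := by
    rw [T.cross_append_left hc, T.cross_singleton hc, T.cross_singleton hc, cross_nil_left, hd,
      ← mul_assoc, hZ.coev_tn_mul_mate (hc w z), mul_assoc, ← T.tn_e_mul, hs]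
    have h := T.tn_mem (T.phoms_le (T.e_mem [w])) (T.phoms_le hZ.coev_mem)
    rw [T.e_tn_e, T.mul_e (homs_cast h rfl (by simp)), T.e_mul (homs_cast h (by simp) rfl)]

/-- Caps are natural. -/
theorem natural_ev {d z w : S} (hZ : T.Dual [d] [z] ev coev)
    (hd : c d w = T.mate [d] [w] [w] ev coev (c w z)) (hs : c z w * c w z = T.e ([z] ++ [w])) :
    T.Natural c [w] ([d] ++ [z]) [] ev where
  mem := T.phoms_le hZ.ev_mem
  comm := by
    rw [T.cross_append_left hc, T.cross_singleton hc, T.cross_singleton hc, cross_nil_left, hd,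
      mul_assoc, hZ.mate_mul_tn_ev (hc w z), ← mul_assoc, ← T.e_tn_mul, hs]
    have h := T.tn_mem (T.phoms_le hZ.ev_mem) (T.phoms_le (T.e_mem [w]))
    rw [T.e_tn_e, T.mul_e (Y := [w]) h, T.e_mul (homs_cast h (by simp) rfl)]

/-- Crossings of duals are symmetric. -/
theorem mate_mul_mate {d z d' z' : S} {ev' coev' : A} (hZ : T.Dual [d] [z] ev coev)
    (hZ' : T.Dual [d'] [z'] ev' coev')
    (hd : ∀ w, c d w = T.mate [d] [w] [w] ev coev (c w z))
    (hd' : ∀ w, c d' w = T.mate [d'] [w] [w] ev' coev' (c w z'))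
    (hs' : c z' z * c z z' = T.e ([z'] ++ [z])) :
    c d d' * c d' d = T.e ([d] ++ [d']) := by
  -- The cup of `d` passes through `z'`, hence through the dual `d'`. So, next to this cup, the two
  -- crossings of `d` and `d'` cancel, and a morphism is determined by its composite with the cup.
  have h₁ := hZ'.natural_comm hc hd' (hZ.natural_coev hc (hd z') hs')
  rw [T.cross_append_right hc, cross_nil_right] at h₁
  simp only [T.cross_singleton hc] at h₁
  have h₂ := hZ.coev_tn_mul_mate (hc d' z)
  rw [← hd] at h₂
  have h₃ : (coev ⊙ T.e [d']) * (T.e [z] ⊙ (c d d' * c d' d)) = coev ⊙ T.e [d'] := by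
    rw [T.e_tn_mul, mul_mul_of_mul_eq h₂, mul_assoc, h₁]
    exact T.e_mul (X := [d']) (T.tn_mem (X := []) (T.phoms_le hZ.coev_mem) (T.phoms_le (T.e_mem [d'])))
  refine hZ.eq_of_coev_tn_mul (W := [d']) (V := [d] ++ [d'])
    (T.phoms_le (T.mul_mem_even (hc d d') (hc d' d))) (T.phoms_le (T.e_mem _)) ?_
  have m := T.tn_mem (X := []) (T.phoms_le hZ.coev_mem) (T.phoms_le (T.e_mem [d']))
  rw [h₃, T.e_tn_e, T.mul_e (homs_cast m rfl (by simp))]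

end Cross

end Dual

end MorphismAlgebra

/-! ### Webs -/

namespace Web

open DiagExpr WebGen

variable {k : Type*} [CommRing k] [Invertible (2 : k)]

variable (k) in
/-- The total algebra of the category of oriented webs of type P. -/
abbrev Alg := (presentation k).Alg

variable (k) in
/-- The structure of the total algebra of the category of oriented webs of type P. -/
noncomputable def alg : MorphismAlgebra k WebStrand (Alg k) := (presentation k).morphismAlgebra

/-- The element of the total algebra represented by an expression. -/
noncomputable def ev (f : Ex k) : Alg k := (presentation k).ev f

local notation:75 f:76 " ⊙ " g:75 => MorphismAlgebra.tn (alg _) f g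

theorem ev_id (X : List WebStrand) : ev (.id X : Ex k) = (alg k).e X := rfl

theorem ev_comp (f g : Ex k) : ev (f ⨾ g) = ev f * ev g := rfl

theorem ev_tens (f g : Ex k) : ev (f ⊠ g) = ev f ⊙ ev g := rfl

theorem ev_plus (f g : Ex k) : ev (.plus f g) = ev f + ev g := rfl

theorem ev_smul (c : k) (f : Ex k) : ev (.smul c f) = c • ev f := rfl

theorem ev_onlyIf (c : Prop) [Decidable c] (f : Ex k) : ev (onlyIf c f) = if c then ev f else 0 := by
  unfold onlyIf; split_ifs <;> rfl

theorem ev_sum (f : ℕ → Ex k) (n : ℕ) :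
    ev (sum ((List.range n).map f)) = ∑ i ∈ Finset.range n, ev (f i) := by
  have h (l : List (Ex k)) : ev (sum l) = (l.map ev).sum := by
    induction l with
    | nil => rfl
    | cons f l ih => rw [List.map_cons, List.sum_cons, ← ih]; rfl
  rw [h, List.map_map]
  rfl

theorem ev_rel {X Y : List WebStrand} {f g : Ex k} (h : Rel X Y f g) : ev f = ev g :=
  SuperPresentation.ev_eq_of_eqv (P := presentation k) (.rel h)

theorem ev_mem {X Y : List WebStrand} {f : Ex k} (h : WT f X Y) : ev f ∈ (alg k).homs X Y :=
  SuperPresentation.ev_mem (P := presentation k) h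

theorem ev_mem_phoms {X Y : List WebStrand} {f : Ex k} {p : ZMod 2} (h : WT f X Y) (hp : HP f p) :
    ev f ∈ (alg k).phoms X Y p :=
  SuperPresentation.ev_mem_phoms (P := presentation k) h hp

/-! ### The ladder algebra of upward strands -/

section Ladder

variable (k)

/-- The upward strand with an integer label. -/
noncomputable def strand (a : ℤ) : Alg k := if 0 ≤ a then (alg k).e (u a.toNat) else 0

/-- The split with integer labels. -/
noncomputable def splitInt (a b : ℤ) : Alg k :=
  if 0 ≤ a ∧ 0 ≤ b then ev (gen (split a.toNat b.toNat)) else 0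

/-- The merge with integer labels. -/
noncomputable def mergeInt (a b : ℤ) : Alg k :=
  if 0 ≤ a ∧ 0 ≤ b then ev (gen (merge a.toNat b.toNat)) else 0

/-- The product in the total algebra as an additive map. -/
noncomputable def tnHom : Alg k →+ Alg k →+ Alg k :=
  AddMonoidHom.mk' (fun f => ((alg k).tn f).toAddMonoidHom) fun f g => by ext; simp

variable {k}

theorem tnHom_apply (f g : Alg k) : tnHom k f g = f ⊙ g := rfl

theorem strand_coe (a : ℕ) : strand k a = (alg k).e (u a) := by simp [strand]

theorem splitInt_coe (a b : ℕ) : splitInt k a b = ev (gen (split a b)) := by simp [splitInt]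

theorem mergeInt_coe (a b : ℕ) : mergeInt k a b = ev (gen (merge a b)) := by simp [mergeInt]

theorem strand_neg {a : ℤ} (h : a < 0) : strand k a = 0 := by simp [strand, h]

theorem splitInt_neg {a b : ℤ} (h : a < 0 ∨ b < 0) : splitInt k a b = 0 := by
  rw [splitInt, if_neg (by omega)]

theorem mergeInt_neg {a b : ℤ} (h : a < 0 ∨ b < 0) : mergeInt k a b = 0 := by
  rw [mergeInt, if_neg (by omega)]

theorem ev_split_mem (a b : ℕ) :
    ev (gen (split a b)) ∈ (alg k).phoms (u (a + b)) (u a ++ u b) 0 :=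
  ev_mem_phoms (WT.gen (split a b)) rfl

theorem ev_merge_mem (a b : ℕ) :
    ev (gen (merge a b)) ∈ (alg k).phoms (u a ++ u b) (u (a + b)) 0 :=
  ev_mem_phoms (WT.gen (merge a b)) rfl

theorem strand_mul_strand (a : ℤ) : strand k a * strand k a = strand k a := by
  rw [strand]; split_ifs
  · exact (alg k).e_mul_e _
  · simp

theorem strand_tn_mul (a : ℤ) (f g : Alg k) :
    strand k a ⊙ (f * g) = (strand k a ⊙ f) * (strand k a ⊙ g) := by
  rw [strand]; split_ifs
  · exact (alg k).e_tn_mul _ _ _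
  · simp

theorem mul_tn_strand (a : ℤ) (f g : Alg k) :
    (f * g) ⊙ strand k a = (f ⊙ strand k a) * (g ⊙ strand k a) := by
  rw [strand]; split_ifs
  · exact (alg k).tn_e_mul _ _ _
  · simp

theorem ev_rungR {a s : ℕ} (b : ℕ) (h : s ≤ a) :
    ev (rungR a b s) = ladderE (tnHom k) (strand k) (splitInt k) (mergeInt k) a b s := by
  rw [ladderE, ← Nat.cast_sub h]
  simp only [strand_coe, splitInt_coe, mergeInt_coe]
  rfl

theorem ev_rungL (a : ℕ) {b r : ℕ} (h : r ≤ b) :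
    ev (rungL a b r) = ladderF (tnHom k) (strand k) (splitInt k) (mergeInt k) a b r := by
  rw [ladderF, ← Nat.cast_sub h]
  simp only [strand_coe, splitInt_coe, mergeInt_coe]
  rfl

theorem ladderE_eq_zero {a b r : ℤ} (h : r < 0 ∨ a < r ∨ b < 0) :
    ladderE (tnHom k) (strand k) (splitInt k) (mergeInt k) a b r = 0 := by
  rw [ladderE]
  rcases h with h | h | h
  · rw [splitInt_neg (by omega)]; simp
  · rw [splitInt_neg (by omega)]; simp
  · rw [mergeInt_neg (by omega)]; simp

theorem ladderF_eq_zero {a b r : ℤ} (h : r < 0 ∨ b < r ∨ a < 0) :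
    ladderF (tnHom k) (strand k) (splitInt k) (mergeInt k) a b r = 0 := by
  rw [ladderF]
  rcases h with h | h | h
  · rw [splitInt_neg (by omega)]; simp
  · rw [splitInt_neg (by omega)]; simp
  · rw [mergeInt_neg (by omega)]; simp

variable (k) in
/-- Splits and merges of upward strands. -/
noncomputable def ladder : LadderAlgebra (Alg k) where
  tn := tnHom k
  i := strand k
  s := splitInt k
  m := mergeInt k
  tn_assoc := (alg k).tn_assoc
  zero_tn f := ((congrArg (fun x => tnHom k x f) (strand_coe 0))).trans ((alg k).nil_tn f)
  tn_zero f := ((congrArg (fun x => tnHom k f x) (strand_coe 0))).trans ((alg k).tn_nil f)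
  i_tn_mul := strand_tn_mul
  mul_tn_i := mul_tn_strand
  i_mul_i := strand_mul_strand
  i_mul_s a b := by
    by_cases h : a < 0 ∨ b < 0
    · rw [splitInt_neg h, mul_zero]
    lift a to ℕ using by omega
    lift b to ℕ using by omega
    rw [splitInt_coe, ← Nat.cast_add, strand_coe]
    exact (alg k).e_mul ((alg k).phoms_le (ev_split_mem a b))
  s_mul_i a b := by
    by_cases h : a < 0 ∨ b < 0
    · rw [splitInt_neg h, zero_mul]
    lift a to ℕ using by omega
    lift b to ℕ using by omega
    rw [splitInt_coe, strand_coe, strand_coe, tnHom_apply, (alg k).e_tn_e]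
    exact (alg k).mul_e ((alg k).phoms_le (ev_split_mem a b))
  i_mul_m a b := by
    by_cases h : a < 0 ∨ b < 0
    · rw [mergeInt_neg h, mul_zero]
    lift a to ℕ using by omega
    lift b to ℕ using by omega
    rw [mergeInt_coe, strand_coe, strand_coe, tnHom_apply, (alg k).e_tn_e]
    exact (alg k).e_mul ((alg k).phoms_le (ev_merge_mem a b))
  m_mul_i a b := by
    by_cases h : a < 0 ∨ b < 0
    · rw [mergeInt_neg h, zero_mul]
    lift a to ℕ using by omega
    lift b to ℕ using by omega
    rw [mergeInt_coe, ← Nat.cast_add, strand_coe]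
    exact (alg k).mul_e ((alg k).phoms_le (ev_merge_mem a b))
  i_neg a h := strand_neg h
  s_zero_left a := by
    by_cases h : a < 0
    · rw [splitInt_neg (.inr h), strand_neg h]
    lift a to ℕ using by omega
    rw [strand_coe]
    exact (splitInt_coe 0 a).trans (ev_rel (.split_zero_left a))
  s_zero_right a := by
    by_cases h : a < 0
    · rw [splitInt_neg (.inl h), strand_neg h]
    lift a to ℕ using by omega
    rw [strand_coe]
    exact (splitInt_coe a 0).trans (ev_rel (.split_zero_right a))
  m_zero_left a := by
    by_cases h : a < 0
    · rw [mergeInt_neg (.inr h), strand_neg h]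
    lift a to ℕ using by omega
    rw [strand_coe]
    exact (mergeInt_coe 0 a).trans (ev_rel (.merge_zero_left a))
  m_zero_right a := by
    by_cases h : a < 0
    · rw [mergeInt_neg (.inl h), strand_neg h]
    lift a to ℕ using by omega
    rw [strand_coe]
    exact (mergeInt_coe a 0).trans (ev_rel (.merge_zero_right a))
  s_s a b c d := by
    by_cases h : a < 0 ∨ b < 0
    · simp [splitInt_neg h]
    by_cases h' : c < 0 ∨ d < 0
    · simp [splitInt_neg h']
    lift a to ℕ using by omega
    lift b to ℕ using by omega
    lift c to ℕ using by omega
    lift d to ℕ using by omega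
    simp only [splitInt_coe, ← Nat.cast_add, strand_coe, tnHom_apply]
    have := (alg k).slide (ev_split_mem a b) ((alg k).phoms_le (ev_split_mem c d))
    simpa only [← (alg k).e_tn_e, (alg k).tn_assoc] using this
  s_m a b c d := by
    by_cases h : a < 0 ∨ b < 0
    · simp [splitInt_neg h]
    by_cases h' : c < 0 ∨ d < 0
    · simp [mergeInt_neg h']
    lift a to ℕ using by omega
    lift b to ℕ using by omega
    lift c to ℕ using by omega
    lift d to ℕ using by omega
    simp only [splitInt_coe, mergeInt_coe, ← Nat.cast_add, strand_coe, tnHom_apply]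
    have := (alg k).slide (ev_split_mem a b) ((alg k).phoms_le (ev_merge_mem c d))
    simpa only [← (alg k).e_tn_e, (alg k).tn_assoc] using this
  m_s a b c d := by
    by_cases h : a < 0 ∨ b < 0
    · simp [mergeInt_neg h]
    by_cases h' : c < 0 ∨ d < 0
    · simp [splitInt_neg h']
    lift a to ℕ using by omega
    lift b to ℕ using by omega
    lift c to ℕ using by omega
    lift d to ℕ using by omega
    simp only [splitInt_coe, mergeInt_coe, ← Nat.cast_add, strand_coe, tnHom_apply]
    have := (alg k).slide (ev_merge_mem a b) ((alg k).phoms_le (ev_split_mem c d))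
    simpa only [← (alg k).e_tn_e, (alg k).tn_assoc] using this
  m_m a b c d := by
    by_cases h : a < 0 ∨ b < 0
    · simp [mergeInt_neg h]
    by_cases h' : c < 0 ∨ d < 0
    · simp [mergeInt_neg h']
    lift a to ℕ using by omega
    lift b to ℕ using by omega
    lift c to ℕ using by omega
    lift d to ℕ using by omega
    simp only [mergeInt_coe, ← Nat.cast_add, strand_coe, tnHom_apply]
    have := (alg k).slide (ev_merge_mem a b) ((alg k).phoms_le (ev_merge_mem c d))
    simpa only [← (alg k).e_tn_e, (alg k).tn_assoc] using this
  s_assoc a b c := by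
    by_cases h : a < 0 ∨ b < 0
    · rw [splitInt_neg h]
      rcases h with h | h
      · rw [splitInt_neg (.inl h)]; simp
      · rw [splitInt_neg (a := b) (.inl h)]; simp
    by_cases h' : c < 0
    · rw [splitInt_neg (.inr h'), splitInt_neg (a := b) (.inr h')]; simp
    lift a to ℕ using by omega
    lift b to ℕ using by omega
    lift c to ℕ using by omega
    simp only [splitInt_coe, ← Nat.cast_add, strand_coe]
    exact ev_rel (.split_assoc a b c)
  m_assoc a b c := by
    by_cases h : a < 0 ∨ b < 0
    · rw [mergeInt_neg h]
      rcases h with h | h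
      · rw [mergeInt_neg (.inl h)]; simp
      · rw [mergeInt_neg (a := b) (.inl h)]; simp
    by_cases h' : c < 0
    · rw [mergeInt_neg (.inr h'), mergeInt_neg (a := b) (.inr h')]; simp
    lift a to ℕ using by omega
    lift b to ℕ using by omega
    lift c to ℕ using by omega
    simp only [mergeInt_coe, ← Nat.cast_add, strand_coe]
    exact ev_rel (.merge_assoc a b c)
  swap a b r s N hr hs := by
    have hEF {a b r a' b' r' : ℤ} (h : (r < 0 ∨ a < r ∨ b < 0) ∨ r' < 0 ∨ b' < r' ∨ a' < 0) :
        ladderE (tnHom k) (strand k) (splitInt k) (mergeInt k) a b r *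
          ladderF (tnHom k) (strand k) (splitInt k) (mergeInt k) a' b' r' = 0 := by
      rcases h with h | h
      · rw [ladderE_eq_zero h, zero_mul]
      · rw [ladderF_eq_zero h, mul_zero]
    have hFE {a b r a' b' r' : ℤ} (h : (r < 0 ∨ b < r ∨ a < 0) ∨ r' < 0 ∨ a' < r' ∨ b' < 0) :
        ladderF (tnHom k) (strand k) (splitInt k) (mergeInt k) a b r *
          ladderE (tnHom k) (strand k) (splitInt k) (mergeInt k) a' b' r' = 0 := by
      rcases h with h | h
      · rw [ladderF_eq_zero h, zero_mul]
      · rw [ladderE_eq_zero h, mul_zero]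
    -- Outside the range of the defining relation, both sides contain a strand with a negative
    -- label.
    by_cases h : r < 0 ∨ s < 0 ∨ a < 0 ∨ b < 0 ∨ a + r < s ∨ b + s < r
    · rw [hEF (by omega), Finset.sum_eq_zero]
      intro t _
      rw [hFE (by omega), smul_zero]
    lift a to ℕ using by omega
    lift b to ℕ using by omega
    lift r to ℕ using by omega
    lift s to ℕ using by omega
    have e := ev_rel (k := k) (.rung_swap a b r s (by omega) (by omega))
    rw [ev_onlyIf, ev_sum] at e
    have e₁ : (if s ≤ a then ev (k := k) (rungR a b s ⨾ rungL (a - s) (b + s) r) else 0) =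
      ladderE (tnHom k) (strand k) (splitInt k) (mergeInt k) a b s *
        ladderF (tnHom k) (strand k) (splitInt k) (mergeInt k) (a - s) (b + s) r := by
      split_ifs with hsa
      · rw [ev_comp, ev_rungR b hsa, ev_rungL _ (by omega), Nat.cast_sub hsa, Nat.cast_add]
      · rw [ladderE_eq_zero (by omega), zero_mul]
    rw [← e₁, e]
    -- The summands with `t > min r s` contain a rung of negative thickness, so the cutoff does not
    -- matter.
    rw [sum_range_eq_sum_range _ N (min r s + 1)]
    · refine Finset.sum_congr rfl fun t ht => ?_
      rw [Finset.mem_range] at ht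
      rw [ev_onlyIf]
      split_ifs with hb
      · rw [ev_smul, ev_comp, ev_rungL _ hb, ev_rungR _ (by omega), Int.cast_smul_eq_zsmul,
          Nat.cast_sub hb, Nat.cast_add, Nat.cast_sub (show t ≤ r by omega),
          Nat.cast_sub (show t ≤ s by omega)]
      · rw [hFE (by omega), smul_zero]
    · intro t ht
      rw [hFE (by omega), smul_zero]
    · intro t ht
      rw [hFE (by omega), smul_zero]

theorem ladder_tn (f g : Alg k) : (ladder k).tn f g = f ⊙ g := rfl

theorem ladder_i (a : ℕ) : (ladder k).i a = (alg k).e (u a) := strand_coe a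

theorem ladder_s (a b : ℕ) : (ladder k).s a b = ev (gen (split a b)) := splitInt_coe a b

theorem ladder_m (a b : ℕ) : (ladder k).m a b = ev (gen (merge a b)) := mergeInt_coe a b

/-- The summation indices correspond by `p = a - s`; the summands omitted from `crossUp` have a rung
of negative thickness. -/
theorem ladder_X (a b : ℕ) : (ladder k).X a b = ev (crossUp a b) := by
  rw [crossUp, ev_sum, LadderAlgebra.X, ← Finset.sum_range_reflect, Int.toNat_natCast]
  refine Finset.sum_congr rfl fun s hs => ?_
  rw [Finset.mem_range] at hs
  rw [ev_onlyIf, show a + 1 - 1 - s = a - s by omega]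
  split_ifs with h
  · have h₁ : ((-1 : k) ^ (a - s)) = (((-1) ^ (a - s) : ℤ) : k) := by push_cast; rfl
    rw [ev_smul, h₁, Int.cast_smul_eq_zsmul, ev_comp, ev_rungR _ (by omega), ev_rungL _ (by omega),
      show ((a : ℤ) - (a - s : ℕ)) = s by omega,
      show ((a : ℤ) + b - (a - s : ℕ)) = (b + s : ℕ) by omega,
      show ((b : ℤ) - (a - s : ℕ)) = (s + b - a : ℕ) by omega]
    rfl
  · rw [LadderAlgebra.F_neg _ (by omega), mul_zero, smul_zero]

end Ladder

/-! ### The odd cap and the antenna of webs -/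

theorem ladder_i_one : (ladder k).i 1 = (alg k).e (u 1) := strand_coe 1

theorem ev_upCap_mem : ev (upCap : Ex k) ∈ (alg k).phoms (u 1 ++ u 1) [] 1 :=
  ev_mem_phoms wt_upCap hp_upCap

theorem ev_crossUp_mem (a b : ℕ) :
    ev (crossUp a b : Ex k) ∈ (alg k).phoms (u a ++ u b) (u b ++ u a) 0 :=
  ev_mem_phoms (wt_crossUp a b) (hp_crossUp a b)

theorem ev_split_upCap : ev (gen (split 1 1)) * ev (upCap : Ex k) = ev antenna + ev antenna := by
  rw [antenna, ev_smul, ev_comp, ← add_smul, invOf_two_add_invOf_two, one_smul]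

theorem ev_split_zero_left (a : ℕ) : ev (gen (split 0 a)) = (alg k).e (u a) :=
  ev_rel (.split_zero_left a)

theorem ev_split_zero_right (a : ℕ) : ev (gen (split a 0)) = (alg k).e (u a) :=
  ev_rel (.split_zero_right a)

theorem ev_capRung_one_left (b : ℕ) : ev (capRung 1 (b + 1) : Ex k) =
    ((alg k).e (u 1) ⊙ ev (gen (split 1 b))) * (ev upCap ⊙ (alg k).e (u b)) := by
  have h : ev (capRung 1 (b + 1) : Ex k) = (ev (gen (split 0 1)) ⊙ ev (gen (split 1 b))) *
      ((alg k).e [] ⊙ ev upCap ⊙ (alg k).e (u b)) := rfl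
  rw [h, ev_split_zero_left, (alg k).nil_tn]

theorem ev_capRung_one_right (a : ℕ) : ev (capRung (a + 1) 1 : Ex k) =
    (ev (gen (split a 1)) ⊙ (alg k).e (u 1)) * ((alg k).e (u a) ⊙ ev upCap) := by
  have h : ev (capRung (a + 1) 1 : Ex k) = (ev (gen (split a 1)) ⊙ ev (gen (split 1 0))) *
      ((alg k).e (u a) ⊙ ev upCap ⊙ (alg k).e []) := rfl
  rw [h, ev_split_zero_right, (alg k).tn_nil]

theorem ev_rungR_self (a b : ℕ) : ev (rungR a b a : Ex k) = ev (gen (merge a b)) := by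
  rw [ev_rungR _ le_rfl, ← ladder_m, ← (ladder k).E_left_self]
  rfl

theorem ev_merge_zero_right (a : ℕ) : ev (gen (merge a 0)) = (alg k).e (u a) :=
  ev_rel (.merge_zero_right a)

theorem ev_rungR_zero (a b : ℕ) : ev (rungR (a + b) 0 b : Ex k) = ev (gen (split a b)) := by
  rw [ev_rungR _ (by omega), ← ladder_s, ← (ladder k).E_right_zero, Nat.cast_add]
  rfl

/-- In the relation `cap_rungR` with an empty right strand, the direct term disappears and only the
antenna term is left. -/
theorem ev_split_split (n : ℕ) : ev (gen (split 1 (n + 1))) * (((alg k).e (u 1) ⊙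
    ev (gen (split 1 n))) * (ev upCap ⊙ (alg k).e (u n))) =
      (2 : k) • (ev (gen (split n 2)) * ((alg k).e (u n) ⊙ ev antenna)) := by
  have e := ev_rel (k := k) (.cap_rungR (1 + (n + 1)) 0 (n + 1) (by omega) (by omega))
  have h := (alg k).tn_mem ((alg k).phoms_le ((alg k).e_mem (u n)))
    (ev_mem (wt_antenna (k := k)))
  rw [Nat.add_sub_cancel, Nat.zero_add, show 1 + (n + 1) - 2 = n by omega,
    Nat.add_sub_cancel, ev_comp, ev_rungR_zero, ev_capRung_one_left, ev_plus, ev_smul, ev_onlyIf,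
    ev_onlyIf, if_neg (by omega), if_pos (by omega), ev_comp, ev_comp, ev_rungR_self,
    ev_merge_zero_right, zero_add, ev_tens, ev_tens, ev_tens, ev_id, ev_id, u_zero,
    (alg k).tn_nil, (alg k).tn_nil] at e
  rw [e, (alg k).mul_e (MorphismAlgebra.homs_cast h rfl (by simp))]

/-- This is `cap_rungR` for a right strand of thickness one, with a rung that leaves one unit on the
left strand for the cap. -/
theorem ev_rungR_capRung (n : ℕ) :
    (ev (gen (split 1 (n + 1))) ⊙ (alg k).e (u 1)) * (((alg k).e (u 1) ⊙
      (ev (gen (merge (n + 1) 1)) * ev (gen (split 1 (n + 1))))) * (ev upCap ⊙ (alg k).e (u (n + 1)))) =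
    (ev (gen (split (n + 1) 1)) ⊙ (alg k).e (u 1)) * ((alg k).e (u (n + 1)) ⊙ ev upCap) +
      (2 : k) • (((ev (gen (split n 2)) * ((alg k).e (u n) ⊙ ev antenna)) ⊙ (alg k).e (u 1)) *
        ev (gen (merge n 1))) := by
  have e := ev_rel (k := k) (.cap_rungR (1 + (n + 1)) 1 (n + 1) (by omega) (by omega))
  have h := (alg k).tn_mem ((alg k).phoms_le ((alg k).e_mem (u (n + 1)))) 
    ((alg k).phoms_le (ev_upCap_mem (k := k)))
  have e₁ : ev (rungR (1 + (n + 1)) 1 (n + 1) : Ex k) = (ev (gen (split 1 (n + 1))) ⊙ (alg k).e (u 1)) *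
      ((alg k).e (u 1) ⊙ ev (gen (merge (n + 1) 1))) := by
    rw [rungR, Nat.add_sub_cancel]; rfl
  rw [Nat.add_sub_cancel, Nat.add_comm 1 (n + 1), Nat.add_sub_cancel, Nat.sub_self,
    Nat.add_comm (n + 1) 1, show 1 + (n + 1) - 2 = n by omega, 
    Nat.add_sub_cancel, ev_comp, e₁, Nat.add_comm 1 (n + 1), ev_capRung_one_left, ev_plus, ev_smul, ev_onlyIf,
    ev_onlyIf, if_pos le_rfl, if_pos (by omega), ev_comp, ev_comp, ev_comp, ev_rungR_self,
    ev_capRung_one_right, ev_rungR_self,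
    ev_merge_zero_right, ev_tens, ev_tens, ev_tens, ev_id, ev_id] at e
  rw [mul_assoc _ _ ((alg k).e (u (n + 1))), (alg k).mul_e (MorphismAlgebra.homs_cast h rfl (by simp))] at e
  rw [(alg k).e_tn_mul, (alg k).tn_e_mul, (alg k).tn_assoc]
  simpa only [mul_assoc] using e

theorem ev_rungL_capRung :
    ((alg k).e (u 1) ⊙ ev (gen (split 1 1))) * (((ev (gen (merge 1 1)) * ev (gen (split 1 1))) ⊙
      (alg k).e (u 1)) * ((alg k).e (u 1) ⊙ ev upCap)) =
    ((alg k).e (u 1) ⊙ ev (gen (split 1 1))) * (ev upCap ⊙ (alg k).e (u 1)) +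
      (2 : k) • ((alg k).e (u 1) ⊙ ev antenna) := by
  have e : ev (rungL 1 2 1 ⨾ capRung 2 1 : Ex k) = ev (.plus (capRung 1 2 ⨾ rungL 0 1 1)
      (.smul 2 ((.id (u 1) ⊠ gen (split 2 0)) ⨾ (.id (u 1) ⊠ antenna ⊠ .id []) ⨾ rungL 1 0 0))) :=
    ev_rel (.cap_rungL 1 2 1 (by omega) (by omega))
  have e₁ : ev (rungL 1 2 1 : Ex k) = ((alg k).e (u 1) ⊙ ev (gen (split 1 1))) *
      (ev (gen (merge 1 1)) ⊙ (alg k).e (u 1)) := rfl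
  have e₂ : ev (rungL 0 1 1) = (alg k).e (u 1) := by
    have := (ladder k).F_left_zero 1 0
    rw [ev_rungL _ le_rfl, ← ladder_i_one, ← (ladder k).s_zero_right, ← this]
    rfl
  have e₃ : ev (rungL 1 0 0) = (alg k).e (u 1) := by
    have := (ladder k).F_zero 1 0
    rw [ev_rungL _ le_rfl, ← ladder_i_one, ← (ladder k).tn_zero ((ladder k).i 1), ← this]
    rfl
  have h := (alg k).tn_mem ((alg k).phoms_le (ev_upCap_mem (k := k)))
    ((alg k).phoms_le ((alg k).e_mem (u 1)))
  have h' := (alg k).tn_mem ((alg k).phoms_le ((alg k).e_mem (u 1))) (ev_mem (wt_antenna (k := k)))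
  have h'' := (alg k).e_mul h'
  rw [← (alg k).e_tn_e] at h''
  rw [ev_comp, e₁, ev_capRung_one_right, ev_plus, ev_comp, ev_capRung_one_left, e₂, ev_smul, ev_comp,
    ev_comp, e₃, ev_tens, ev_tens, ev_tens, ev_split_zero_right, ev_id, ev_id, (alg k).tn_nil,
    mul_assoc _ _ ((alg k).e (u 1)), (alg k).mul_e (Y := u 1) h,
    (alg k).mul_e (MorphismAlgebra.homs_cast h' rfl (by simp)), h''] at e
  rw [(alg k).tn_e_mul]
  simpa only [mul_assoc] using e

theorem isCap : (ladder k).IsCap (ev upCap) (ev antenna) where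
  tn_mul := by
    rw [ladder_tn, ladder_i_one, (alg k).e_tn_e]
    exact (alg k).e_mul ((alg k).phoms_le ev_upCap_mem)
  split_mul := ev_split_upCap
  merge_mul := ev_rel .merge_antenna
  merge_tn a b := by
    by_cases h : a < 0 ∨ b < 0
    · have : (ladder k).m a b = 0 := mergeInt_neg h
      simp [this]
    lift a to ℕ using by omega
    lift b to ℕ using by omega
    have := (alg k).slide (ev_merge_mem a b) ((alg k).phoms_le ev_upCap_mem)
    simp only [ladder_tn, ladder_i_one, ← Nat.cast_add, ladder_i, ladder_m]
    simpa only [← (alg k).e_tn_e, (alg k).tn_assoc, (alg k).tn_nil] using this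
  tn_merge a b := by
    by_cases h : a < 0 ∨ b < 0
    · have : (ladder k).m a b = 0 := mergeInt_neg h
      simp [this]
    lift a to ℕ using by omega
    lift b to ℕ using by omega
    have := (alg k).slide' ((alg k).phoms_le ev_upCap_mem) (ev_merge_mem a b)
    simp only [ladder_tn, ladder_i_one, ← Nat.cast_add, ladder_i, ladder_m]
    simpa only [← (alg k).e_tn_e, (alg k).tn_assoc, (alg k).nil_tn] using this.symm
  X_tn_X a := by
    by_cases h : a < 0
    · simp [(ladder k).X_neg_left h]
    lift a to ℕ using by omega
    have := (alg k).slide (ev_crossUp_mem 1 1) ((alg k).phoms_le (ev_crossUp_mem a 1))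
    simp only [← ladder_X, Nat.cast_one] at this
    simp only [ladder_tn, ladder_i_one, ladder_i]
    simpa only [← (alg k).e_tn_e, (alg k).tn_assoc] using this.symm
  split_split c hc := by
    obtain ⟨n, rfl⟩ := Nat.exists_eq_add_of_lt hc
    have h := ev_split_split (k := k) n
    rw [two_smul] at h
    simp only [zero_add, ← ladder_s, ← ladder_i, Nat.cast_add, Nat.cast_one, ← ladder_tn,
      add_sub_cancel_right] at h ⊢
    exact h
  rungR c hc := by
    obtain ⟨n, rfl⟩ := Nat.exists_eq_add_of_lt hc
    have h := ev_rungR_capRung (k := k) n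
    rw [two_smul] at h
    simp only [zero_add, ← ladder_s, ← ladder_m, ← ladder_i, Nat.cast_add, Nat.cast_one, ← ladder_tn,
      add_sub_cancel_right] at h ⊢
    exact h
  rungL := by
    have h := ev_rungL_capRung (k := k)
    rw [two_smul, ← map_add] at h
    simp only [← ladder_s, ← ladder_m, ← ladder_i, Nat.cast_one, ← ladder_tn] at h ⊢
    exact h

end Web

/-! ### Expressions in restricted sets of generators -/

namespace DiagExpr

variable {k S G : Type*}

/-- All generators in the expression `f` satisfy `p`. -/
def AllGens (p : G → Prop) : DiagExpr k S G → Prop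
  | gen g => p g
  | id _ => True
  | comp f g => AllGens p f ∧ AllGens p g
  | tens f g => AllGens p f ∧ AllGens p g
  | zero => True
  | plus f g => AllGens p f ∧ AllGens p g
  | smul _ f => AllGens p f

theorem AllGens.sum {p : G → Prop} {l : List (DiagExpr k S G)} (h : ∀ f ∈ l, AllGens p f) :
    AllGens p (.sum l) := by
  induction l with
  | nil => trivial
  | cons f l ih => exact ⟨h f (by simp), ih fun g hg => h g (by simp [hg])⟩

theorem AllGens.onlyIf {p : G → Prop} {c : Prop} [Decidable c] {f : DiagExpr k S G}
    (h : AllGens p f) : AllGens p (.onlyIf c f) := by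
  unfold DiagExpr.onlyIf
  split_ifs
  · exact h
  · trivial

theorem allGens_of_forall {p : G → Prop} (h : ∀ g, p g) (f : DiagExpr k S G) : AllGens p f := by
  induction f with
  | gen g => exact h g
  | id X => trivial
  | comp f g hf hg => exact ⟨hf, hg⟩
  | tens f g hf hg => exact ⟨hf, hg⟩
  | zero => trivial
  | plus f g hf hg => exact ⟨hf, hg⟩
  | smul c f hf => exact hf

end DiagExpr

/-! ### Crossings of oriented strands and their symmetry -/

namespace Web

open DiagExpr WebGen MorphismAlgebra

variable {k : Type*} [CommRing k] [Invertible (2 : k)]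

local notation:75 f:76 " ⊙ " g:75 => MorphismAlgebra.tn (alg _) f g

theorem hp_crossDown (a b : ℕ) : HP (k := k) (crossDown a b) 0 := by
  have t {f g : Ex k} (hf : HP f 0) (hg : HP g 0) : HP (f ⊠ g) 0 := hf.tens hg rfl
  have c {f g : Ex k} (hf : HP f 0) (hg : HP g 0) : HP (f ⨾ g) 0 := hf.comp hg rfl
  exact c (t rfl (c rfl (t rfl (t rfl rfl)))) (c (t rfl (t (hp_crossUp a b) rfl))
    (t (c (t rfl (t rfl rfl)) rfl) rfl))

theorem hp_crossStrand (x y : WebStrand) : HP (k := k) (crossStrand x y) 0 := by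
  cases x <;> cases y
  · exact hp_crossUp _ _
  · exact rfl
  · exact hp_crossLeft _ _
  · exact hp_crossDown _ _

variable (k) in
/-- The crossing of two strands in the total algebra. -/
noncomputable def crossing (x y : WebStrand) : Alg k := ev (crossStrand x y)

theorem crossing_mem (x y : WebStrand) :
    crossing k x y ∈ (alg k).phoms ([x] ++ [y]) ([y] ++ [x]) 0 :=
  ev_mem_phoms (wt_crossStrand x y) (hp_crossStrand x y)

theorem ev_crossOne (x : WebStrand) (Y : List WebStrand) :
    ev (crossOne x Y : Ex k) = (alg k).crossOne (crossing k) x Y := by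
  induction Y with
  | nil => rfl
  | cons y Y ih => rw [crossOne, ev_comp, ev_tens, ev_tens, ih]; rfl

theorem ev_crossWord (X Y : List WebStrand) :
    ev (crossWord X Y : Ex k) = (alg k).cross (crossing k) X Y := by
  induction X with
  | nil => rfl
  | cons x X ih => rw [crossWord, ev_comp, ev_tens, ev_tens, ih, ev_crossOne]; rfl

theorem dual_down_up (a : ℕ) :
    (alg k).Dual (d a) (u a) (ev (gen (lcap a))) (ev (gen (lcup a))) where
  ev_mem := ev_mem_phoms (WT.gen (lcap a)) rfl
  coev_mem := ev_mem_phoms (WT.gen (lcup a)) rfl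
  zigzag := ev_rel (.zigzag_up a)
  zigzag' := ev_rel (.zigzag_down a)

theorem ev_crossLeft (a b : ℕ) : ev (crossLeft a b : Ex k) =
    (alg k).mate (d a) (u b) (u b) (ev (gen (lcap a))) (ev (gen (lcup a))) (ev (crossUp b a)) := by
  simp only [crossLeft, MorphismAlgebra.mate, ev_comp, ev_tens, ev_id, ← (alg k).e_tn_e,
    (alg k).tn_assoc]

/-- Bending both strands with nested caps and cups is the same as bending one and then the other. -/
theorem ev_crossDown (a b : ℕ) : ev (crossDown a b : Ex k) =
    (alg k).mate (d a) (d b) (d b) (ev (gen (lcap a))) (ev (gen (lcup a))) (ev (crossLeft b a)) := by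
  rw [ev_crossLeft]
  have h (f g : Alg k) (X Y : List WebStrand) : (f * g) ⊙ (alg k).e X ⊙ (alg k).e Y =
      (f ⊙ (alg k).e X ⊙ (alg k).e Y) * (g ⊙ (alg k).e X ⊙ (alg k).e Y) := by
    rw [(alg k).e_tn_e, (alg k).tn_e_mul]
  simp only [crossDown, MorphismAlgebra.mate, ev_comp, ev_tens, ev_id, ← (alg k).e_tn_e,
    (alg k).tn_assoc, (alg k).e_tn_mul, (alg k).tn_e_mul, h, mul_assoc]

theorem dual_down_up_singleton (a : ℕ+) :
    (alg k).Dual [.down a] [.up a] (ev (gen (lcap a))) (ev (gen (lcup a))) := by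
  have := dual_down_up (k := k) a
  rwa [u_coe, d_coe] at this

theorem crossing_down (a : ℕ+) (x : WebStrand) : crossing k (.down a) x =
    (alg k).mate [.down a] [x] [x] (ev (gen (lcap a))) (ev (gen (lcup a)))
      (crossing k x (.up a)) := by
  rw [← d_coe]
  cases x with
  | up b => rw [← u_coe]; exact ev_crossLeft a b
  | down b => rw [← d_coe]; exact ev_crossDown a b

theorem ev_crossUp_mul (a b : ℕ) :
    ev (crossUp a b : Ex k) * ev (crossUp b a) = (alg k).e (u a ++ u b) := by
  rw [← ladder_X, ← ladder_X, (ladder k).X_mul_X, ladder_i, ladder_i, ladder_tn, (alg k).e_tn_e]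

theorem crossing_up_up (a b : ℕ+) :
    crossing k (.up a) (.up b) * crossing k (.up b) (.up a) = (alg k).e ([.up a] ++ [.up b]) := by
  rw [← u_coe, ← u_coe]
  exact ev_crossUp_mul a b

/-- The crossings of strands are symmetric. -/
theorem crossing_mul_crossing (x y : WebStrand) :
    crossing k x y * crossing k y x = (alg k).e ([x] ++ [y]) := by
  cases x with
  | up a => cases y with
    | up b => exact crossing_up_up a b
    | down b =>
      rw [← u_coe, ← d_coe]
      exact ev_rel (.right_left a b)
  | down a => cases y with
    | up b =>
      rw [← u_coe, ← d_coe]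
      exact ev_rel (.left_right a b)
    | down b =>
      -- Both downward crossings are mates, so their symmetry is inherited from that of upward
      -- strands.
      exact (dual_down_up_singleton a).mate_mul_mate crossing_mem (dual_down_up_singleton b)
        (crossing_down a) (crossing_down b) (crossing_up_up b a)

theorem cross_u_u (a b : ℕ) : (alg k).cross (crossing k) (u a) (u b) = ev (crossUp a b) := by
  rcases Nat.eq_zero_or_pos a with rfl | ha
  · rw [u_zero, MorphismAlgebra.cross_nil_left, ← ladder_X, Nat.cast_zero, (ladder k).X_zero_left,
      ladder_i]
  rcases Nat.eq_zero_or_pos b with rfl | hb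
  · rw [u_zero, MorphismAlgebra.cross_nil_right, ← ladder_X, Nat.cast_zero, (ladder k).X_zero_right,
      ladder_i]
  lift a to ℕ+ using ha
  lift b to ℕ+ using hb
  rw [u_coe, u_coe, (alg k).cross_singleton crossing_mem]
  rfl

/-- The predicate permits applications before all generators are known to be natural; upward
crossings need only splits and merges. -/
theorem natural_ev_of_allGens {p : WebGen → Prop} {Z : List WebStrand}
    (hp : ∀ g, p g → (alg k).Natural (crossing k) Z (src g) (tgt g) (ev (gen g)))
    {f : Ex k} {X Y : List WebStrand} (hf : f.AllGens p) (h : WT f X Y) :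
    (alg k).Natural (crossing k) Z X Y (ev f) := by
  induction f generalizing X Y with
  | gen g => obtain ⟨rfl, rfl⟩ := h; exact hp g hf
  | id X => obtain ⟨rfl, rfl⟩ := h; exact .id crossing_mem _
  | comp f g ihf ihg =>
    obtain ⟨W, h₁, h₂⟩ := h
    exact (ihf hf.1 h₁).mul (ihg hf.2 h₂)
  | tens f g ihf ihg =>
    obtain ⟨X₁, Y₁, X₂, Y₂, h₁, h₂, rfl, rfl⟩ := h
    exact (ihf hf.1 h₁).tn crossing_mem (ihg hf.2 h₂)
  | zero => exact .zero
  | plus f g ihf ihg => exact (ihf hf.1 h.1).add (ihg hf.2 h.2)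
  | smul c f ih => exact (ih hf h).smul c

/-! ### Naturality with respect to upward strands -/

section Up

variable (c : ℕ)

theorem natural_split (a b : ℕ) : (alg k).Natural (crossing k) (u c) (u (a + b)) (u a ++ u b)
    (ev (gen (split a b))) where
  mem := (alg k).phoms_le (ev_split_mem a b)
  comm := by
    have := (ladder k).split_tn_mul_X a b c
    rw [← Nat.cast_add] at this
    simp only [ladder_tn, ladder_i, ladder_X, ladder_s] at this
    rw [(alg k).cross_append_left crossing_mem, cross_u_u, cross_u_u, cross_u_u, this]

theorem natural_merge (a b : ℕ) : (alg k).Natural (crossing k) (u c) (u a ++ u b) (u (a + b))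
    (ev (gen (merge a b))) where
  mem := (alg k).phoms_le (ev_merge_mem a b)
  comm := by
    have := (ladder k).merge_tn_mul_X a b c
    rw [← Nat.cast_add] at this
    simp only [ladder_tn, ladder_i, ladder_X, ladder_m] at this
    rw [(alg k).cross_append_left crossing_mem, cross_u_u, cross_u_u, cross_u_u, this, mul_assoc]

theorem natural_upCap :
    (alg k).Natural (crossing k) (u c) (u 1 ++ u 1) [] (ev upCap) where
  mem := (alg k).phoms_le ev_upCap_mem
  comm := by
    -- Since 2 is invertible, the total algebra has no 2-torsion, as the cap argument for thickness
    -- one requires.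
    have h2 (x : Alg k) (h : x + x = 0) : x = 0 := by
      rw [← one_smul k x, ← invOf_mul_self (2 : k), mul_smul, two_smul, h, smul_zero]
    have := isCap.tn_mul_X h2 c
    have h₁ := ladder_X (k := k) 1 c
    rw [Nat.cast_one] at h₁
    simp only [ladder_tn, ladder_i, ladder_i_one, h₁] at this
    have h := (alg k).tn_mem ((alg k).phoms_le (ev_upCap_mem (k := k)))
      ((alg k).phoms_le ((alg k).e_mem (u c)))
    rw [(alg k).cross_append_left crossing_mem, cross_u_u, MorphismAlgebra.cross_nil_left,
      (alg k).mul_e (Y := u c) h, mul_assoc, this]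

theorem natural_crossUp (a b : ℕ) :
    (alg k).Natural (crossing k) (u c) (u a ++ u b) (u b ++ u a) (ev (crossUp a b)) := by
  refine natural_ev_of_allGens (p := fun g => ∃ a b, g = split a b ∨ g = merge a b) ?_ ?_
    (wt_crossUp a b)
  · rintro _ ⟨a, b, rfl | rfl⟩
    · exact natural_split c a b
    · exact natural_merge c a b
  · refine .sum fun f hf => ?_
    obtain ⟨s, -, rfl⟩ := List.mem_map.1 hf
    exact .onlyIf ⟨⟨⟨⟨_, _, .inl rfl⟩, trivial⟩, trivial, ⟨_, _, .inr rfl⟩⟩,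
      ⟨trivial, ⟨_, _, .inl rfl⟩⟩, ⟨_, _, .inr rfl⟩, trivial⟩

theorem natural_lcup (c : ℕ+) (a : ℕ) :
    (alg k).Natural (crossing k) [.up c] [] (u a ++ d a) (ev (gen (lcup a))) := by
  rcases Nat.eq_zero_or_pos a with rfl | ha
  · rw [show ev (gen (lcup 0)) = (alg k).e [] from ev_rel .lcup_zero]
    exact .id crossing_mem _
  lift a to ℕ+ using ha
  rw [u_coe, d_coe]
  exact (dual_down_up_singleton a).natural_coev crossing_mem (crossing_down a _) (crossing_up_up c a)

theorem natural_lcap (c : ℕ+) (a : ℕ) :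
    (alg k).Natural (crossing k) [.up c] (d a ++ u a) [] (ev (gen (lcap a))) := by
  rcases Nat.eq_zero_or_pos a with rfl | ha
  · rw [show ev (gen (lcap 0)) = (alg k).e [] from ev_rel .lcap_zero]
    exact .id crossing_mem _
  lift a to ℕ+ using ha
  rw [u_coe, d_coe]
  exact (dual_down_up_singleton a).natural_ev crossing_mem (crossing_down a _) (crossing_up_up a c)

theorem natural_crossLeft (c : ℕ+) (a b : ℕ) :
    (alg k).Natural (crossing k) [.up c] (d a ++ u b) (u b ++ d a) (ev (crossLeft a b)) := by
  have h₁ := (natural_lcup (k := k) c a).id_tn crossing_mem (d a ++ u b)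
  have h₂ := (((natural_crossUp (k := k) c b a).tn_id crossing_mem (d a)).id_tn crossing_mem (d a))
  have h₃ := (natural_lcap (k := k) c a).tn_id crossing_mem (u b ++ d a)
  rw [u_coe] at h₂
  exact (h₁.cast (by simp) rfl).mul ((h₂.cast (by simp) rfl).mul (h₃.cast (by simp) (by simp)))

/-- The rightward crossing is not built from other generators; only its being inverse to a leftward
crossing is available. -/
theorem natural_rcross (c : ℕ+) (a b : ℕ) :
    (alg k).Natural (crossing k) [.up c] (u a ++ d b) (d b ++ u a) (ev (gen (rcross a b))) :=
  (natural_crossLeft c b a).inv crossing_mem (ev_mem (WT.gen (rcross a b)))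
    (ev_rel (.left_right b a)) (ev_rel (.right_left a b))

end Up

/-! ### Tags -/

theorem tagIn_mem : ev (gen tagIn : Ex k) ∈ (alg k).phoms (u 1) (d 1) 1 :=
  ev_mem_phoms (WT.gen tagIn) rfl

theorem tagOut_mem : ev (gen tagOut : Ex k) ∈ (alg k).phoms (d 1) (u 1) 1 :=
  ev_mem_phoms (WT.gen tagOut) rfl

/-- Bending one leg of the odd cap down undoes the leftward cap in its definition, so naturality of
the odd cap carries over to the tag. -/
theorem ev_tagIn : ev (gen tagIn : Ex k) =
    ((alg k).e (u 1) ⊙ ev (gen (lcup 1))) * (ev upCap ⊙ (alg k).e (d 1)) := by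
  have h := (alg k).phoms_le (tagIn_mem (k := k))
  have h₁ := (alg k).slide' h (dual_down_up (k := k) 1).coev_mem
  simp only [← (alg k).e_tn_e, (alg k).tn_nil] at h₁
  rw [upCap, ev_comp, ev_tens, ev_id, (alg k).tn_e_mul, (alg k).tn_assoc, ← mul_assoc, ← h₁, mul_assoc,
    (dual_down_up (k := k) 1).zigzag', (alg k).mul_e h]

/-- In the left straightening relation the two odd tags sit on different strands. Moving them past
each other gives a sign, which cancels the sign in that relation; a zigzag then remains. -/
theorem tagIn_mul_tagOut : ev (gen tagIn : Ex k) * ev (gen tagOut) = (alg k).e (u 1) := by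
  have h := (alg k).phoms_le (tagIn_mem (k := k))
  have h' := (alg k).phoms_le (tagOut_mem (k := k))
  have D := dual_down_up (k := k) 1
  have m : (alg k).e (u 1) ⊙ ev (gen tagOut) ∈ (alg k).phoms (u 1 ++ d 1) (u 1 ++ u 1) 1 :=
    ev_mem_phoms ((WT.id (u 1)).tens (WT.gen tagOut)) (HP.tens (p := 0) (q := 1) rfl rfl rfl)
  have e₁ := (alg k).tn_eq_right_left h ((alg k).phoms_le m)
  have e₂ := (alg k).tn_eq_left_right tagIn_mem m
  have e₃ := (alg k).slide' h D.coev_mem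
  have e₄ := (alg k).slide D.ev_mem h'
  rw [← e₁, show superSign k (1 * 1) = -1 by simp [superSign, ZMod.val_one], neg_one_smul] at e₂
  simp only [← (alg k).e_tn_e, (alg k).tn_assoc, (alg k).tn_nil, (alg k).nil_tn] at e₂ e₃ e₄
  have r : ev _ = ev _ := ev_rel (k := k) .straighten_left
  simp only [upCap, upCup, ev_comp, ev_tens, ev_id, ev_smul, (alg k).e_tn_mul, (alg k).tn_e_mul,
    (alg k).tn_assoc, mul_assoc] at r
  rw [← mul_assoc (_ ⊙ _ ⊙ _), ← neg_eq_iff_eq_neg.2 e₂, neg_mul, mul_neg, mul_assoc, ← e₄,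
    ← mul_assoc, ← e₃, mul_assoc, ← mul_assoc (_ ⊙ _) (_ ⊙ _), D.zigzag', (alg k).e_mul h',
    neg_one_smul, neg_inj] at r
  exact r

/-- In the right straightening relation the tags meet on one strand, so no sign arises. Closing with
a leftward cup shows that the composite is absorbed by the cup, which forces it to be the identity.
-/
theorem tagOut_mul_tagIn : ev (gen tagOut : Ex k) * ev (gen tagIn) = (alg k).e (d 1) := by
  have D := dual_down_up (k := k) 1
  have h := (alg k).mul_mem ((alg k).phoms_le (tagOut_mem (k := k)))
    ((alg k).phoms_le (tagIn_mem (k := k)))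
  have e₁ := (alg k).slide D.coev_mem ((alg k).phoms_le D.coev_mem)
  have e₂ := (alg k).slide' h D.coev_mem
  have r : ev _ = ev _ := ev_rel (k := k) .straighten_right
  simp only [upCap, upCup, ev_comp, ev_tens, ev_id, (alg k).e_tn_mul, (alg k).tn_e_mul,
    (alg k).tn_assoc, mul_assoc] at r
  rw [← mul_assoc (_ ⊙ _ ⊙ _), ← (alg k).e_tn_mul, ← (alg k).tn_e_mul] at r
  generalize (ev (gen tagOut) : Alg k) * ev (gen tagIn) = t at *
  replace r := congrArg (fun x : Alg k => ev (gen (lcup 1)) * (x ⊙ (alg k).e (d 1))) r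
  simp only [(alg k).tn_e_mul, (alg k).tn_assoc] at r
  simp only [← (alg k).e_tn_e, (alg k).tn_assoc, (alg k).tn_nil, (alg k).nil_tn] at e₁ e₂
  have m := (alg k).tn_mem ((alg k).phoms_le ((alg k).e_mem (u 1))) h
  rw [mul_mul_of_mul_eq e₁.symm, mul_assoc, ← mul_assoc (_ ⊙ _ ⊙ _), ← (alg k).e_tn_mul, ← e₂,
    (alg k).e_tn_mul, mul_assoc, ← (alg k).e_tn_mul, D.zigzag', (alg k).e_tn_e,
    (alg k).mul_e m] at r
  refine D.eq_of_coev_tn_mul (W := []) (V := d 1) (homs_cast h (by simp) rfl)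
    ((alg k).phoms_le (phoms_cast ((alg k).e_mem _) (by simp) rfl)) ?_
  rw [(alg k).tn_nil, (alg k).e_tn_e, r]

theorem natural_gen_up (c : ℕ+) (g : WebGen) :
    (alg k).Natural (crossing k) [.up c] (src g) (tgt g) (ev (gen g)) := by
  have hτ : (alg k).Natural (crossing k) [.up c] (u 1) (d 1) (ev (gen tagIn)) := by
    rw [ev_tagIn]
    have h := natural_upCap (k := k) c
    rw [u_coe] at h
    have h₁ := (natural_lcup (k := k) c 1).id_tn crossing_mem (u 1)
    exact h₁.mul ((h.tn_id crossing_mem (d 1)).cast (by simp) rfl)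
  cases g with
  | split a b => rw [← u_coe]; exact natural_split c a b
  | merge a b => rw [← u_coe]; exact natural_merge c a b
  | lcap a => exact natural_lcap c a
  | lcup a => exact natural_lcup c a
  | tagIn => exact hτ
  | tagOut =>
    exact hτ.inv crossing_mem ((alg k).phoms_le tagOut_mem) tagIn_mul_tagOut tagOut_mul_tagIn
  | rcross a b => exact natural_rcross c a b

/-- All morphisms are natural with respect to the crossings. -/
theorem natural_ev {f : Ex k} {X Y : List WebStrand} (h : WT f X Y) (Z : List WebStrand) :
    (alg k).Natural (crossing k) Z X Y (ev f) := by
  refine natural_ev_of_allGens (p := fun _ => True) (fun g _ => ?_)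
    (allGens_of_forall (fun _ => trivial) f) h
  have hg := ev_mem (k := k) (WT.gen g)
  refine .of_forall crossing_mem (fun z => ?_) hg Z
  cases z with
  | up c => exact natural_gen_up c g
  | down c =>
    -- For a downward strand, the mate argument gives naturality from the left; symmetry of the
    -- crossings turns it around.
    exact .of_comm' crossing_mem crossing_mul_crossing hg
      ((dual_down_up_singleton c).natural_comm crossing_mem (crossing_down c) (natural_gen_up c g))

/-! ### Rightward duality and rainbows -/

theorem cross_u_d (a b : ℕ) : (alg k).cross (crossing k) (u a) (d b) = ev (gen (rcross a b)) := by
  rcases Nat.eq_zero_or_pos a with rfl | ha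
  · rw [u_zero, cross_nil_left]
    exact (ev_rel (.rcross_zero_left b)).symm
  rcases Nat.eq_zero_or_pos b with rfl | hb
  · rw [d_zero, cross_nil_right]
    exact (ev_rel (.rcross_zero_right a)).symm
  lift a to ℕ+ using ha
  lift b to ℕ+ using hb
  rw [u_coe, d_coe, (alg k).cross_singleton crossing_mem]
  rfl

theorem natural_cross (X Y Z : List WebStrand) :
    (alg k).Natural (crossing k) Z (X ++ Y) (Y ++ X) ((alg k).cross (crossing k) X Y) := by
  rw [← ev_crossWord]
  exact natural_ev (wt_crossWord X Y) Z

/-- The rightward cap and cup are the leftward ones twisted by the rightward crossing, which is the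
word crossing of an upward with a downward strand, also for label zero. -/
theorem dual_up_down (a : ℕ) : (alg k).Dual (u a) (d a) (ev (rcap a)) (ev (rcup a)) := by
  have h := (dual_down_up (k := k) a).symm crossing_mem crossing_mul_crossing
    (natural_ev (WT.gen (lcap a))) (natural_ev (WT.gen (lcup a))) (natural_cross _ _ _)
    (natural_cross _ _ _)
  rwa [cross_u_d] at h

theorem dual_strand (x : WebStrand) :
    (alg k).Dual [dualStrand x] [x] (ev (evStrand x)) (ev (coevStrand x)) := by
  cases x with
  | up a => exact dual_down_up_singleton a
  | down a =>
    have h := dual_up_down (k := k) a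
    rwa [u_coe, d_coe] at h

theorem dual_word (X : List WebStrand) :
    (alg k).Dual (dualWord X) X (ev (evWord X)) (ev (coevWord X)) := by
  induction X with
  | nil => exact .nil
  | cons x X ih => exact (dual_strand x).append ih

theorem dual_word' (X : List WebStrand) :
    (alg k).Dual X (dualWord X) (ev (evWord' X)) (ev (coevWord' X)) := by
  induction X with
  | nil => exact .nil
  | cons x X ih =>
    have h := dual_strand (k := k) (dualStrand x)
    rw [dualStrand_dualStrand] at h
    -- Here the given word is the left dual, so the two factors enter in the opposite order from
    -- `dual_word`.
    exact ih.append h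

end Web

/-! ### Return from the total algebra to the category -/

namespace SuperPresentation

variable {k : Type*} [CommRing k] {P : SuperPresentation k}

theorem of_comp {X Y Z : P.Cat} (f : X ⟶ Y) (g : Y ⟶ Z) :
    P.of X Z (f ≫ g) = P.of X Y f * P.of Y Z g := (P.of_mul_of f g).symm

theorem of_eqToHom_comp {X Y Z : P.Cat} (h : X = Y) (f : Y ⟶ Z) :
    P.of X Z (eqToHom h ≫ f) = P.of Y Z f := by
  subst h; rw [eqToHom_refl, Category.id_comp]

theorem of_comp_eqToHom {X Y Z : P.Cat} (f : X ⟶ Y) (h : Y = Z) :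
    P.of X Z (f ≫ eqToHom h) = P.of X Y f := by
  subst h; rw [eqToHom_refl, Category.comp_id]

variable [Invertible (2 : k)]

open StrictMonoidalSupercategory in
theorem of_tensor {X Y X' Y' : P.Cat} (f : X ⟶ Y) (g : X' ⟶ Y') :
    P.of (X * X') (Y * Y') (tensor (k := k) f g) = P.morphismAlgebra.tn (P.of X Y f) (P.of X' Y' g) :=
  (of_tn_of f g).symm

theorem of_mem_phoms {X Y : P.Cat} {f : X ⟶ Y} {p : ZMod 2} :
    P.of X Y f ∈ P.morphismAlgebra.phoms X Y p ↔
      f ∈ StrictMonoidalSupercategory.parity (k := k) X Y p :=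
  (P.of_injective X Y).mem_set_image

theorem isDualPair {D X : P.Cat} {ev : D * X ⟶ 1} {coev : 1 ⟶ X * D}
    (h : P.morphismAlgebra.Dual D X (P.of _ _ ev) (P.of _ _ coev)) : IsDualPair k D X ev coev where
  ev_even := of_mem_phoms.1 h.ev_mem
  coev_even := of_mem_phoms.1 h.coev_mem
  zigzag := by
    apply P.of_injective
    rw [of_eqToHom_comp, of_comp, of_eqToHom_comp, of_comp_eqToHom, of_tensor, of_tensor]
    exact h.zigzag
  zigzag' := by
    apply P.of_injective
    rw [of_eqToHom_comp, of_comp, of_eqToHom_comp, of_comp_eqToHom, of_tensor, of_tensor]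
    exact h.zigzag'

/-- The inclusions of morphism spaces are injective and forget transports, so each axiom becomes the
corresponding identity of the total algebra. -/
theorem isSymmetricBraiding {β : ∀ X Y : P.Cat, X * Y ⟶ Y * X}
    {c : P.Strand → P.Strand → P.Alg}
    (hβ : ∀ X Y, P.of _ _ (β X Y) = P.morphismAlgebra.cross c X Y)
    (hc : ∀ x y, c x y ∈ P.morphismAlgebra.phoms ([x] ++ [y]) ([y] ++ [x]) 0)
    (hs : ∀ x y, c x y * c y x = P.morphismAlgebra.e ([x] ++ [y]))
    (h : ∀ {X Y : P.Cat} (f : X ⟶ Y) (Z : P.Cat), P.morphismAlgebra.Natural c Z X Y (P.of X Y f)) :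
    IsSymmetricBraiding k β where
  even X Y := by
    rw [← of_mem_phoms, hβ]
    exact P.morphismAlgebra.cross_mem hc X Y
  natural f g hf hg := by
    apply P.of_injective
    rw [map_smul, of_comp, of_comp, of_tensor, of_tensor, hβ, hβ]
    exact P.morphismAlgebra.tn_mul_cross hc hs (of_mem_phoms.2 hf) (of_mem_phoms.2 hg) (h _ _) (h _ _)
  hexagon_forward X Y Z := by
    apply P.of_injective
    rw [of_eqToHom_comp, of_comp, of_eqToHom_comp, of_comp_eqToHom, of_tensor, of_tensor, hβ, hβ, hβ]
    exact P.morphismAlgebra.cross_append_right hc X Y Z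
  hexagon_reverse X Y Z := by
    apply P.of_injective
    rw [of_eqToHom_comp, of_comp, of_eqToHom_comp, of_comp_eqToHom, of_tensor, of_tensor, hβ, hβ, hβ]
    exact P.morphismAlgebra.cross_append_left hc X Y Z
  symmetry X Y := by
    apply P.of_injective
    rw [of_comp, hβ, hβ]
    exact P.morphismAlgebra.cross_mul_cross hc hs X Y

end SuperPresentation

namespace PWebUD

open Web SuperPresentation

variable {k : Type*} [CommRing k] [Invertible (2 : k)]

theorem isDualPair_mor {D X : PWebUD k} {f g : Ex k} (hf : WT f (D * X) (1 : PWebUD k))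
    (hg : WT g (1 : PWebUD k) (X * D))
    (h : (alg k).Dual D X (ev f) (ev g)) :
    IsDualPair k D X (mor (P := presentation k) f hf) (mor (P := presentation k) g hg) := by
  refine isDualPair (P := presentation k) ?_
  have ef : (presentation k).of (D * X) 1 (mor f hf) = ev f := of_mor hf
  have eg : (presentation k).of 1 (X * D) (mor g hg) = ev g := of_mor hg
  rw [ef, eg]
  exact h

theorem isSymmetricBraiding_crossing : IsSymmetricBraiding k (PWebUD.crossing k) := by
  refine isSymmetricBraiding (c := Web.crossing k) (fun X Y => ?_) crossing_mem crossing_mul_crossing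
    fun f Z => ?_
  · exact (of_mor (P := presentation k) (wt_crossWord X Y)).trans (ev_crossWord X Y)
  -- Every morphism is represented by an expression, so naturality for expressions covers the whole
  -- category.
  · obtain ⟨t, ht, e⟩ := exists_ev f
    rw [e]
    exact natural_ev ht Z

end PWebUD

theorem corollaryC (k : Type*) [CommRing k] [IsDomain k] [Invertible (2 : k)] :
    IsSymmetricBraiding k (PWebUD.crossing k) ∧
    (∀ a : ℕ,
      IsDualPair k (PWebUD.down k a) (PWebUD.up k a) (PWebUD.leftCap k a) (PWebUD.leftCup k a) ∧
      IsDualPair k (PWebUD.up k a) (PWebUD.down k a)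
        (PWebUD.rightCap k a) (PWebUD.rightCup k a)) ∧
    (∀ X : PWebUD k,
      IsDualPair k (PWebUD.dual X) X (PWebUD.rainbowCap X) (PWebUD.rainbowCup X) ∧
      IsDualPair k X (PWebUD.dual X) (PWebUD.rainbowCap' X) (PWebUD.rainbowCup' X)) ∧
    IsRigid k (PWebUD k) := by
  have h (X : PWebUD k) := PWebUD.isDualPair_mor (Web.wt_evWord X) (Web.wt_coevWord X)
    (Web.dual_word (k := k) X)
  have h' (X : PWebUD k) := PWebUD.isDualPair_mor (Web.wt_evWord' X) (Web.wt_coevWord' X)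
    (Web.dual_word' (k := k) X)
  exact ⟨PWebUD.isSymmetricBraiding_crossing,
    fun a => ⟨PWebUD.isDualPair_mor _ _ (Web.dual_down_up a),
      PWebUD.isDualPair_mor _ _ (Web.dual_up_down a)⟩,
    fun X => ⟨h X, h' X⟩, fun X => ⟨⟨_, _, _, h X⟩, _, _, _, h' X⟩⟩
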